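/- Let $B>0$, let $H_L=(-i\partial_x+By)^2-\partial_y^2$ be the Landau Hamiltonian on $L^2(\mathbb{R}^2)$ and $H_1(F)=H_L-Fx$ (both are the closures of the operators defined on $C_0^\infty(\mathbb{R}^2)$). Let $V$ be a potential on $\mathbb{R}^2$ which is real on $\mathbb{R}^2$ and such that, for given positive constants $\beta,a_0,a_1$ (independent of $F$): (a) for all sufficiently small $F>0$, $V$ is $H_1(F)$-translation analytic in the strip $|\Im z|<\beta$: for each $y$ the function $V(z,y)$ is analytic in $|\Im z|<\beta$, and $z\mapsto V(x+z,y)(H_1(F)+i)^{-1}$ is an analytic function on this strip with values in the compact operators; (b) there are $0<\beta_0\le\beta$, $V_0\ge 0$ and $\nu>0$ such that for $|\Im z|\le\beta_0$ and all real $x,y$: $|V(x+z,y)|\le V_0$ if $x+\Re z\in[-a_0,a_0]$ and $y\in[-a_1,a_1]$; $|V(x+z,y)|\le V_0e^{-\nu(x+\Re z)^2}$ if $x+\Re z\notin[-a_0,a_0]$; and $V(x+z,y)=0$ if $y\notin[-a_1,a_1]$. Let $\varepsilon,\gamma_0,\bar C>0$ and $\tau\in\mathbb{R}$, and for $F>0$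 put $\gamma_F=\gamma_0F^{-(1-\varepsilon)}$, $\bar x=\bar CF^{-(1-\varepsilon)}$, $\bar y=a_1+3+3F^{-\tau}$, $A=[-\bar y,\bar y]$, $$h_F(x)=\tfrac12\{\tanh(\gamma_F(x+\bar x))-\tanh(\gamma_F(x-\bar x))\},$$ $$H(0)=H_L+V,\qquad H_2(F)=H_L+V-Fx\,h_F(x)\,\chi_A(y).$$ Here $\sigma_d$ denotes the set of isolated points of the spectrum that are eigenvalues of finite multiplicity, and $\sigma_{ess}=\sigma\setminus\sigma_d$. Then $H_L$, $H(0)$ and $H_2(F)$, $F>0$, are self-adjoint, $\|(H_2(F)-z)^{-1}-(H(0)-z)^{-1}\|\to0$ as $F\to0^+$ for every $z\in\mathbb{C}\setminus\mathbb{R}$ (norm-resolvent convergence), and: 1. For each $e\in\sigma(H(0))$ there is a family $\lambda(F)\in\sigma(H_2(F))$, $F>0$, with $\lambda(F)\to e$ as $F\to0^+$. 2. Let $\Delta$ be a bounded interval with endpoints $a<b$, $a,b\notin\sigma(H(0))$, and let $P_\Delta(F)$ and $P_\Delta(0)$ be the spectral projections of $H_2(F)$ and $H(0)$ onto $\Delta$.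 Then $\|P_\Delta(F)-P_\Delta(0)\|\to0$ as $F\to0^+$. 3. For every $F>0$, $\sigma_{ess}(H_2(F))=\sigma_{ess}(H_L)=\{(2n+1)B:\ n=0,1,2,\dots\}$. 4. For each $e\in\sigma_d(H(0))$ there is a constant $c>0$ such that every family $\lambda(F)\in\sigma(H_2(F))$ with $\lambda(F)\to e$ as $F\to 0^+$ satisfies, for all sufficiently small $F>0$, $\lambda(F)\in\sigma_d(H_2(F))$ and $\lambda(F)\in[e-cF^{\varepsilon},\,e+cF^{\varepsilon}]$. -/

import Mathlib

open MeasureTheory Filter Topology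
open scoped ContDiff

namespace MagneticStark

noncomputable section

/-! ### Unbounded operators on a complex Hilbert space -/

section Abstract

variable {H : Type*} [NormedAddCommGroup H] [InnerProductSpace ℂ H]

/-- `R` is a bounded two-sided inverse of `T - z : dom T → H`. -/
def IsResolventAt (T : H →ₗ.[ℂ] H) (z : ℂ) (R : H →L[ℂ] H) : Prop :=
  (∀ ψ : H, ∃ h : R ψ ∈ T.domain, T ⟨R ψ, h⟩ - z • R ψ = ψ) ∧
    ∀ ψ : T.domain, R (T ψ - z • (ψ : H)) = ψ

/-- The resolvent set of an unbounded operator. -/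
def resolventSet (T : H →ₗ.[ℂ] H) : Set ℂ := {z | ∃ R : H →L[ℂ] H, IsResolventAt T z R}

/-- The spectrum of an unbounded operator. -/
def spec (T : H →ₗ.[ℂ] H) : Set ℂ := (resolventSet T)ᶜ

open Classical in
/-- The resolvent `(T - z)⁻¹`, for `z` in the resolvent set (and `0` elsewhere). -/
def resolvent (T : H →ₗ.[ℂ] H) (z : ℂ) : H →L[ℂ] H :=
  if h : ∃ R : H →L[ℂ] H, IsResolventAt T z R then h.choose else 0

/-- The eigenspace `{ψ ∈ dom T : T ψ = z ψ}`. -/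
def eigenspace (T : H →ₗ.[ℂ] H) (z : ℂ) : Submodule ℂ H :=
  (LinearMap.ker (T.toFun - z • T.domain.subtype)).map T.domain.subtype

/-- The discrete spectrum of a self-adjoint operator: the isolated points of the spectrum
that are eigenvalues of finite multiplicity. -/
def discreteSpec (T : H →ₗ.[ℂ] H) : Set ℂ :=
  {z | z ∈ spec T ∧ (∃ r > 0, ∀ w ∈ spec T, ‖w - z‖ < r → w = z) ∧
    eigenspace T z ≠ ⊥ ∧ FiniteDimensional ℂ (eigenspace T z)}

/-- The essential spectrum: the complement of the discrete spectrum in the spectrum. -/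
def essSpec (T : H →ₗ.[ℂ] H) : Set ℂ := spec T \ discreteSpec T

/-- `P` is the spectral projection of the self-adjoint operator `T` onto the Borel set `Δ`:
`⟨ψ, P ψ⟩ = μ_ψ(Δ)`, where `μ_ψ` is the spectral measure of `T` at `ψ`, that is, the finite
measure on `ℝ` with `⟨ψ, (T - z)⁻¹ ψ⟩ = ∫ (t - z)⁻¹ dμ_ψ(t)` for all non-real `z`. -/
def IsSpectralProjection [CompleteSpace H] (T : H →ₗ.[ℂ] H) (Δ : Set ℝ) (P : H →L[ℂ] H) : Prop :=
  IsStarProjection P ∧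
    ∀ ψ : H, ∃ μ : Measure ℝ, IsFiniteMeasure μ ∧
      (∀ z : ℂ, z.im ≠ 0 → inner ℂ ψ (resolvent T z ψ) = ∫ t : ℝ, ((t : ℂ) - z)⁻¹ ∂μ) ∧
      inner ℂ ψ (P ψ) = ((μ.real Δ : ℝ) : ℂ)

end Abstract

/-! ### Magnetic Schrödinger operators on `L²(ℝ²)` -/

/-- The Hilbert space `L²(ℝ²; ℂ)`. -/
abbrev L2 : Type := Lp ℂ 2 (volume : Measure (ℝ × ℝ))

/-- `-i ∂ₓ φ + B y φ`. -/
def momX (B : ℝ) (φ : ℝ × ℝ → ℂ) (p : ℝ × ℝ) : ℂ :=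
  -Complex.I * fderiv ℝ φ p (1, 0) + (B * p.2 : ℝ) * φ p

/-- `-i ∂_y φ`. -/
def momY (φ : ℝ × ℝ → ℂ) (p : ℝ × ℝ) : ℂ := -Complex.I * fderiv ℝ φ p (0, 1)

/-- The differential expression `(-i ∂ₓ + B y)² φ - ∂_y² φ + v φ`. -/
def magneticExpr (B : ℝ) (v : ℝ × ℝ → ℝ) (φ : ℝ × ℝ → ℂ) (p : ℝ × ℝ) : ℂ :=
  momX B (momX B φ) p + momY (momY φ) p + (v p : ℂ) * φ p

lemma contDiff_momX (B : ℝ) {φ : ℝ × ℝ → ℂ} (hφ : ContDiff ℝ ∞ φ) :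
    ContDiff ℝ ∞ (momX B φ) := by
  have h1 : ContDiff ℝ ∞ (fun p => fderiv ℝ φ p (1, 0)) :=
    (hφ.fderiv_right (m := ∞) (by simp)).clm_apply contDiff_const
  have h2 : ContDiff ℝ ∞ (fun p : ℝ × ℝ => ((B * p.2 : ℝ) : ℂ)) :=
    Complex.ofRealCLM.contDiff.comp (contDiff_const.mul contDiff_snd)
  exact (contDiff_const.mul h1).add (h2.mul hφ)

lemma contDiff_momY {φ : ℝ × ℝ → ℂ} (hφ : ContDiff ℝ ∞ φ) : ContDiff ℝ ∞ (momY φ) :=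
  contDiff_const.mul ((hφ.fderiv_right (m := ∞) (by simp)).clm_apply contDiff_const)

lemma momX_add (B : ℝ) {φ χ : ℝ × ℝ → ℂ} (hφ : ContDiff ℝ ∞ φ) (hχ : ContDiff ℝ ∞ χ) :
    momX B (φ + χ) = momX B φ + momX B χ := by
  funext p
  simp only [momX, Pi.add_apply,
    fderiv_add (hφ.differentiable (by simp) p) (hχ.differentiable (by simp) p),
    add_apply]
  ring

lemma momY_add {φ χ : ℝ × ℝ → ℂ} (hφ : ContDiff ℝ ∞ φ) (hχ : ContDiff ℝ ∞ χ) :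
    momY (φ + χ) = momY φ + momY χ := by
  funext p
  simp only [momY, Pi.add_apply,
    fderiv_add (hφ.differentiable (by simp) p) (hχ.differentiable (by simp) p),
    add_apply]
  ring

lemma momX_smul (B : ℝ) (c : ℂ) {φ : ℝ × ℝ → ℂ} (hφ : ContDiff ℝ ∞ φ) :
    momX B (c • φ) = c • momX B φ := by
  funext p
  simp only [momX, Pi.smul_apply, fderiv_const_smul (hφ.differentiable (by simp) p) c,
    smul_apply, smul_eq_mul]
  ring

lemma momY_smul (c : ℂ) {φ : ℝ × ℝ → ℂ} (hφ : ContDiff ℝ ∞ φ) :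
    momY (c • φ) = c • momY φ := by
  funext p
  simp only [momY, Pi.smul_apply, fderiv_const_smul (hφ.differentiable (by simp) p) c,
    smul_apply, smul_eq_mul]
  ring

lemma magneticExpr_add (B : ℝ) (v : ℝ × ℝ → ℝ) {φ χ : ℝ × ℝ → ℂ}
    (hφ : ContDiff ℝ ∞ φ) (hχ : ContDiff ℝ ∞ χ) :
    magneticExpr B v (φ + χ) = magneticExpr B v φ + magneticExpr B v χ := by
  funext p
  simp only [magneticExpr, momX_add B hφ hχ, momY_add hφ hχ, Pi.add_apply,
    momX_add B (contDiff_momX B hφ) (contDiff_momX B hχ),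
    momY_add (contDiff_momY hφ) (contDiff_momY hχ)]
  ring

lemma magneticExpr_smul (B : ℝ) (v : ℝ × ℝ → ℝ) (c : ℂ) {φ : ℝ × ℝ → ℂ}
    (hφ : ContDiff ℝ ∞ φ) : magneticExpr B v (c • φ) = c • magneticExpr B v φ := by
  funext p
  simp only [magneticExpr, momX_smul B c hφ, momY_smul c hφ, Pi.smul_apply, smul_eq_mul,
    momX_smul B c (contDiff_momX B hφ), momY_smul c (contDiff_momY hφ)]
  ring

/-- The graph of `φ ↦ (-i ∂ₓ + B y)² φ - ∂_y² φ + v φ` on `C_c^∞(ℝ²)`, inside `L² × L²`. -/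
def magneticGraph (B : ℝ) (v : ℝ × ℝ → ℝ) : Submodule ℂ (L2 × L2) where
  carrier := {q | ∃ φ : ℝ × ℝ → ℂ, ContDiff ℝ ∞ φ ∧ HasCompactSupport φ ∧
    q.1 =ᵐ[volume] φ ∧ q.2 =ᵐ[volume] magneticExpr B v φ}
  zero_mem' := by
    refine ⟨0, contDiff_const, HasCompactSupport.zero, Lp.coeFn_zero _ _ _, ?_⟩
    have h : magneticExpr B v 0 = 0 := by
      simpa using magneticExpr_smul B v 0 (φ := 0) contDiff_const
    rw [h]
    exact Lp.coeFn_zero _ _ _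
  add_mem' := by
    rintro q r ⟨φ, h1, h2, h3, h4⟩ ⟨χ, k1, k2, k3, k4⟩
    refine ⟨φ + χ, h1.add k1, h2.add k2, (Lp.coeFn_add _ _).trans (h3.add k3), ?_⟩
    rw [magneticExpr_add B v h1 k1]
    exact (Lp.coeFn_add _ _).trans (h4.add k4)
  smul_mem' := by
    rintro c q ⟨φ, h1, h2, h3, h4⟩
    refine ⟨c • φ, contDiff_const.smul h1, h2.smul_left (f := fun _ => c),
      (Lp.coeFn_smul c _).trans (h3.const_smul c), ?_⟩
    rw [magneticExpr_smul B v c h1]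
    exact (Lp.coeFn_smul c _).trans (h4.const_smul c)

/-- `magneticGraph` is the graph of an operator. -/
lemma magneticGraph_single_valued (B : ℝ) (v : ℝ × ℝ → ℝ) (q : L2 × L2)
    (hq : q ∈ magneticGraph B v) (h0 : q.1 = 0) : q.2 = 0 := by
  obtain ⟨φ, h1, h2, h3, h4⟩ := hq
  have hφ : φ = 0 := by
    refine (Continuous.ae_eq_iff_eq volume h1.continuous continuous_const).1 ?_
    rw [h0] at h3
    exact h3.symm.trans (Lp.coeFn_zero _ _ _)
  have h : magneticExpr B v φ = 0 := by
    rw [hφ]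
    simpa using magneticExpr_smul B v 0 (φ := 0) contDiff_const
  rw [h] at h4
  exact (Lp.eq_zero_iff_ae_eq_zero).2 h4

/-- The closure of `(-i ∂ₓ + B y)² - ∂_y² + v` defined on `C_c^∞(ℝ²)`. -/
def magneticOp (B : ℝ) (v : ℝ × ℝ → ℝ) : L2 →ₗ.[ℂ] L2 :=
  (magneticGraph B v).toLinearPMap.closure

/-- The Landau Hamiltonian `H_L = (-i ∂ₓ + B y)² - ∂_y²`. -/
def landauOp (B : ℝ) : L2 →ₗ.[ℂ] L2 := magneticOp B 0

/-- The crossed fields Hamiltonian `H₁(F) = H_L - F x`. -/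
def crossedOp (B F : ℝ) : L2 →ₗ.[ℂ] L2 := magneticOp B (fun p => -F * p.1)

/-- Multiplication by `v`, on its maximal domain `{ψ ∈ L² : v ψ ∈ L²}`. -/
def mulOp (v : ℝ × ℝ → ℂ) : L2 →ₗ.[ℂ] L2 where
  domain :=
    { carrier := {ψ | MemLp (fun p => v p * ψ p) 2 (volume : Measure (ℝ × ℝ))}
      zero_mem' := by
        refine (memLp_congr_ae ?_).2 (MemLp.zero' : MemLp (fun _ : ℝ × ℝ => (0 : ℂ)) 2 volume)
        filter_upwards [Lp.coeFn_zero ℂ 2 (volume : Measure (ℝ × ℝ))] with p hp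
        simp only [hp, Pi.zero_apply, mul_zero]
      add_mem' := by
        intro ψ χ hψ hχ
        refine (memLp_congr_ae ?_).2 (MemLp.add hψ hχ)
        filter_upwards [Lp.coeFn_add ψ χ] with p hp
        simp only [hp, Pi.add_apply, mul_add]
      smul_mem' := by
        intro c ψ hψ
        refine (memLp_congr_ae ?_).2 (MemLp.const_smul hψ c)
        filter_upwards [Lp.coeFn_smul c ψ] with p hp
        simp only [hp, Pi.smul_apply, smul_eq_mul]
        ring }
  toFun :=
    { toFun := fun ψ => MemLp.toLp (fun p => v p * (ψ : L2) p) ψ.2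
      map_add' := by
        intro ψ χ
        rw [← MemLp.toLp_add]
        refine MemLp.toLp_congr _ _ ?_
        filter_upwards [Lp.coeFn_add (ψ : L2) (χ : L2)] with p hp
        simp only [Submodule.coe_add, hp, Pi.add_apply, mul_add]
      map_smul' := by
        intro c ψ
        rw [RingHom.id_apply, ← MemLp.toLp_const_smul]
        refine MemLp.toLp_congr _ _ ?_
        filter_upwards [Lp.coeFn_smul c (ψ : L2)] with p hp
        simp only [Submodule.coe_smul, hp, Pi.smul_apply, smul_eq_mul]
        ring }

/-! ### The impurity potential

A potential is a function `V : ℂ → ℝ → ℂ`; `V x y` with real `x` is the potential itself, and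
`V z y` is its analytic continuation in the first variable. -/

/-- `V(·, y)` is analytic in the strip `|Im z| < β`, and `z ↦ V(x + z, y) (H₁(F) + i)⁻¹` is an
analytic function on this strip with values in the compact operators. -/
def IsTranslationAnalytic (B F β : ℝ) (V : ℂ → ℝ → ℂ) : Prop :=
  (∀ y : ℝ, DifferentiableOn ℂ (fun z => V z y) {z | |z.im| < β}) ∧
    ∃ K : ℂ → L2 →L[ℂ] L2,
      DifferentiableOn ℂ K {z | |z.im| < β} ∧
      ∀ z : ℂ, |z.im| < β → IsCompactOperator (K z) ∧
        ∀ ψ : L2, K z ψ =ᵐ[volume]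
          fun p : ℝ × ℝ => V (p.1 + z) p.2 * (resolvent (crossedOp B F) (-Complex.I) ψ) p

/-- In a strip `|Im z| ≤ β₀`, the continued potential is bounded, has Gaussian decay in `x`
outside `[-a₀, a₀]` and vanishes for `y ∉ [-a₁, a₁]`. -/
def IsGaussianLocalised (β a₀ a₁ : ℝ) (V : ℂ → ℝ → ℂ) : Prop :=
  ∃ β₀ V₀ ν : ℝ, 0 < β₀ ∧ β₀ ≤ β ∧ 0 < ν ∧ ∀ z : ℂ, |z.im| ≤ β₀ → ∀ x y : ℝ,
    (x ∈ Set.Icc (-a₀ - z.re) (a₀ - z.re) → y ∈ Set.Icc (-a₁) a₁ → ‖V (x + z) y‖ ≤ V₀) ∧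
    (x ∉ Set.Icc (-a₀ - z.re) (a₀ - z.re) →
      ‖V (x + z) y‖ ≤ V₀ * Real.exp (-ν * (x + z.re) ^ 2)) ∧
    (y ∉ Set.Icc (-a₁) a₁ → V (x + z) y = 0)

/-! ### The local-field Hamiltonian -/

/-- `h_F(x) = ½ {tanh(γ_F (x + x̄)) - tanh(γ_F (x - x̄))}` with `γ_F = γ₀ / F^(1-ε)` and
`x̄ = C / F^(1-ε)`. -/
def cutoff (ε γ₀ C F x : ℝ) : ℝ :=
  (1 / 2) * (Real.tanh (γ₀ / F ^ (1 - ε) * (x + C / F ^ (1 - ε))) -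
    Real.tanh (γ₀ / F ^ (1 - ε) * (x - C / F ^ (1 - ε))))

/-- `ȳ = y₁ + F^(-τ)`, where `y₁ = y₀ + F^(-τ) + 1`, `y₀ = y₂ + F^(-τ) + 1`, `y₂ = a₁ + 1`. -/
def yBar (a₁ τ F : ℝ) : ℝ :=
  (((a₁ + 1) + 1 / F ^ τ + 1) + 1 / F ^ τ + 1) + 1 / F ^ τ

/-- `W_F(x, y) = -F x h_F(x) χ_A(y)` with `A = [-ȳ, ȳ]`. -/
def localField (ε γ₀ C a₁ τ F : ℝ) (p : ℝ × ℝ) : ℝ :=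
  -F * p.1 * cutoff ε γ₀ C F p.1 *
    (Set.Icc (-yBar a₁ τ F) (yBar a₁ τ F)).indicator (fun _ => (1 : ℝ)) p.2

/-- `H(0) = H_L + V`. -/
def impurityOp (B : ℝ) (V : ℂ → ℝ → ℂ) : L2 →ₗ.[ℂ] L2 :=
  landauOp B + mulOp (fun p => V p.1 p.2)

/-- `H₂(F) = H_L + V - F x h_F(x) χ_A(y)`. -/
def localFieldOp (B : ℝ) (V : ℂ → ℝ → ℂ) (ε γ₀ C a₁ τ F : ℝ) : L2 →ₗ.[ℂ] L2 :=
  landauOp B + mulOp (fun p => V p.1 p.2) + mulOp (fun p => (localField ε γ₀ C a₁ τ F p : ℂ))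

end

end MagneticStark

namespace MagneticStark

noncomputable section

/-! ### Resolvents of symmetric operators and bounded perturbations -/

section Resolvents

variable {H : Type*} [NormedAddCommGroup H] [InnerProductSpace ℂ H]
  {T : H →ₗ.[ℂ] H} {z w : ℂ} {R A U W : H →L[ℂ] H}

/-! Write W_F for the field term, so that H_2(F) = H(0) + W_F and H(0) = H_L + V. The closed form of
h_F gives |x h_F(x)| ≤ x̄ for all x (`abs_mul_cutoff_le`), hence ‖W_F‖ ≤ F x̄ = C F^ε
(`norm_localField_le`). Thus H_2(F) is a bounded perturbation of H(0) whose norm tends to zero at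
the rate claimed in part 4.

The convergence statements follow from this smallness. The second resolvent identity gives
norm-resolvent convergence (`tendsto_resolvent_perturb`). For self-adjoint operators the spectra of
T and T + W lie within ‖W‖ of each other (`exists_mem_spec_of_perturb`), which gives part 1 and, at
an isolated point, the window of part 4. For part 2, when the endpoints of the interval lie in gaps,
the spectral projection is a fixed continuous function of the bounded self-adjoint resolvent at a
real point, and continuous functional calculus is norm continuous (`tendsto_spectralProjection`).
Every operator involved has a real point in its resolvent set, so the unbounded theory is always
reduced to a bounded self-adjoint A = (T - μ)⁻¹ through t ↦ (t - μ)⁻¹.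

Part 3 is Weyl's theorem. For a self-adjoint operator, λ lies outside the essential spectrum exactly
when bounded sequences ψ_k with (T - λ)ψ_k convergent have convergent subsequences
(`IsResolventAt.mem_essSpec_iff`); this condition is visibly stable under relatively compact
perturbations (`hasSeqCompactKernel_vadd_iff`). Both V and W_F are bounded and vanish at infinity,
so it remains to show that such multipliers are relatively compact with respect to H_L
(`isRelativelyCompact_mulCLM`) and to find the essential spectrum of H_L.

Both rest on an explicit diagonalisation. Polynomials in ζ̄, ζ times a Gaussian carry two commuting
ladders, for H_L and for the guiding centre Hamiltonian K = (-i∂_x)² + (-i∂_y + Bx)². The joint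
eigenvectors form a Hilbert basis indexed by ℕ × ℕ, and the closure of H_L from test functions is
the diagonal operator in that basis (`graph_landauOp`), which settles self-adjointness and the
infinitely degenerate levels (2n+1)B. Relative compactness comes from H_L + K, whose eigenvalues
tend to infinity: K differs from H_L by coordinate multipliers in its first order factors, so after
a smooth compact cutoff its energy is controlled by that of H_L (`exists_energy_bound`).

Finally, a discrete eigenvalue e of H(0) is not a Landau level, so nearby spectrum of H_2(F) avoids
the essential spectrum and is discrete. -/

lemma IsResolventAt.mem (h : IsResolventAt T z R) (ψ : H) : R ψ ∈ T.domain := (h.1 ψ).1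

lemma IsResolventAt.apply_sub (h : IsResolventAt T z R) (ψ : H) :
    T ⟨R ψ, h.mem ψ⟩ - z • R ψ = ψ := (h.1 ψ).2

lemma IsResolventAt.apply (h : IsResolventAt T z R) (ψ : H) :
    T ⟨R ψ, h.mem ψ⟩ = ψ + z • R ψ := sub_eq_iff_eq_add.1 (h.apply_sub ψ)

lemma IsResolventAt.unique {R' : H →L[ℂ] H} (h : IsResolventAt T z R)
    (h' : IsResolventAt T z R') : R = R' := by
  ext ψ
  have := h.2 ⟨R' ψ, h'.mem ψ⟩
  rwa [h'.apply_sub] at this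

lemma isResolventAt_resolvent (h : z ∈ resolventSet T) : IsResolventAt T z (resolvent T z) := by
  have h' : ∃ R : H →L[ℂ] H, IsResolventAt T z R := h
  rw [resolvent, dif_pos h']
  exact h'.choose_spec

lemma IsResolventAt.mem_resolventSet (h : IsResolventAt T z R) : z ∈ resolventSet T := ⟨R, h⟩

lemma IsResolventAt.resolvent_eq (h : IsResolventAt T z R) : resolvent T z = R :=
  (isResolventAt_resolvent h.mem_resolventSet).unique h

/-- A resolvent at `μ` and an inverse of `1 - (w - μ) A` give a resolvent at `w`. -/
lemma IsResolventAt.of_inverse {μ : ℂ} (hA : IsResolventAt T μ A)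
    (h₁ : (1 - (w - μ) • A) * U = 1) (h₂ : U * (1 - (w - μ) • A) = 1) :
    IsResolventAt T w (A * U) := by
  -- The two halves of `IsResolventAt` need the inverse on opposite sides of `A`, so the factors
  -- must be shown to commute.
  have hc : A * U = U * A := by
    have : (1 - (w - μ) • A) * A = A * (1 - (w - μ) • A) := by
      simp [mul_sub, sub_mul]
    calc A * U = (U * (1 - (w - μ) • A)) * A * U := by rw [h₂, one_mul]
      _ = U * A * ((1 - (w - μ) • A) * U) := by rw [mul_assoc U, this]; simp only [mul_assoc]
      _ = U * A := by rw [h₁, mul_one]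
  refine ⟨fun ψ => ⟨hA.mem (U ψ), ?_⟩, fun ψ => ?_⟩
  · have h : U ψ - (w - μ) • A (U ψ) = ψ := DFunLike.congr_fun h₁ ψ
    change T ⟨A (U ψ), hA.mem (U ψ)⟩ - w • A (U ψ) = ψ
    rw [hA.apply]
    rw [sub_smul] at h
    refine Eq.trans ?_ h
    abel
  · have h : U ((ψ : H) - (w - μ) • A ψ) = ψ := DFunLike.congr_fun h₂ (ψ : H)
    rw [hc]
    change U (A (T ψ - w • (ψ : H))) = ψ
    have hψ := hA.2 ψ
    have : A (T ψ - w • (ψ : H)) = (ψ : H) - (w - μ) • A ψ := by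
      rw [show T ψ - w • (ψ : H) = (T ψ - μ • (ψ : H)) - (w - μ) • (ψ : H) by
        rw [sub_smul]; abel, map_sub, hψ, map_smul]
    rw [this, h]

/-- First resolvent identity: apply R(T - w) = 1 to vectors in the range of `A`. -/
lemma IsResolventAt.sub_eq (hA : IsResolventAt T z A) (hR : IsResolventAt T w R) :
    R - A = (w - z) • (R * A) := by
  ext ψ
  have := hR.2 ⟨A ψ, hA.mem ψ⟩
  rw [hA.apply] at this
  simp only [map_sub, map_add, map_smul] at this
  change R ψ - A ψ = (w - z) • R (A ψ)
  nth_rewrite 1 [← this]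
  rw [sub_smul]
  abel

/-- Spectral mapping for the resolvent. -/
lemma IsResolventAt.mem_resolventSet_iff {μ : ℂ} (hA : IsResolventAt T μ A) (hw : w ≠ μ) :
    w ∈ resolventSet T ↔ (w - μ)⁻¹ ∉ spectrum ℂ A := by
  have hw' : w - μ ≠ 0 := sub_ne_zero.2 hw
  have key : (algebraMap ℂ (H →L[ℂ] H) (w - μ)⁻¹ - A) = (w - μ)⁻¹ • (1 - (w - μ) • A) := by
    rw [smul_sub, smul_smul, inv_mul_cancel₀ hw', one_smul, Algebra.algebraMap_eq_smul_one]
  rw [spectrum.notMem_iff, key]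
  have hu : IsUnit ((w - μ)⁻¹ • (1 - (w - μ) • A)) ↔ IsUnit (1 - (w - μ) • A) := by
    have := isUnit_smul_iff (Units.mk0 _ (inv_ne_zero hw')) (1 - (w - μ) • A)
    rwa [Units.smul_def] at this
  rw [hu]
  constructor
  · rintro ⟨R, hR⟩
    have e1 := hA.sub_eq hR
    have e2 := hR.sub_eq hA
    -- The candidate inverse is suggested by (T - μ)(T - w)⁻¹ = 1 + (w - μ)R. The two orders of the
    -- resolvent identity verify the two products.
    refine ⟨⟨1 - (w - μ) • A, 1 + (w - μ) • R, ?_, ?_⟩, rfl⟩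
    · have : (w - μ) • (A * R) = R - A := by
        rw [← neg_sub A R, e2, ← neg_smul, neg_sub]
      calc (1 - (w - μ) • A) * (1 + (w - μ) • R)
          = 1 + (w - μ) • (R - A - (w - μ) • (A * R)) := by
            simp only [mul_add, sub_mul, one_mul, mul_one, smul_mul_smul_comm, smul_sub, smul_smul]
            abel
        _ = 1 := by rw [this, sub_self, smul_zero, add_zero]
    · calc (1 + (w - μ) • R) * (1 - (w - μ) • A)
          = 1 + (w - μ) • (R - A - (w - μ) • (R * A)) := by
            simp only [mul_sub, add_mul, one_mul, mul_one, smul_mul_smul_comm, smul_sub, smul_smul]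
            abel
        _ = 1 := by rw [← e1, sub_self, smul_zero, add_zero]
  · rintro ⟨u, hu⟩
    exact ⟨_, hA.of_inverse (U := (u⁻¹ : (H →L[ℂ] H)ˣ)) (by rw [← hu]; simp) (by rw [← hu]; simp)⟩

lemma IsResolventAt.inv_mem_spectrum_iff {μ : ℂ} (hA : IsResolventAt T μ A) {s : ℂ} (hs : s ≠ 0) :
    s ∈ spectrum ℂ A ↔ s⁻¹ + μ ∈ spec T := by
  have h := hA.mem_resolventSet_iff (w := s⁻¹ + μ) (by simp [hs])
  rw [spec, Set.mem_compl_iff, h, add_sub_cancel_right, inv_inv, not_not]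

/-! #### Perturbation by a bounded operator -/

/-- On the domain, T + W - μ = (1 + W A)(T - μ), so inverting the bounded factor is enough. -/
lemma IsResolventAt.perturb {μ : ℂ} (hA : IsResolventAt T μ A)
    (h₁ : (1 + W * A) * U = 1) (h₂ : U * (1 + W * A) = 1) :
    IsResolventAt ((W : H →ₗ[ℂ] H) +ᵥ T) μ (A * U) := by
  refine ⟨fun ψ => ⟨hA.mem (U ψ), ?_⟩, fun ψ => ?_⟩
  · have h : U ψ + W (A (U ψ)) = ψ := DFunLike.congr_fun h₁ ψ
    have e : ((W : H →ₗ[ℂ] H) +ᵥ T) ⟨(A * U) ψ, hA.mem (U ψ)⟩ =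
      W (A (U ψ)) + T ⟨A (U ψ), hA.mem (U ψ)⟩ := rfl
    rw [e, hA.apply]
    change W (A (U ψ)) + (U ψ + μ • A (U ψ)) - μ • A (U ψ) = ψ
    rw [← add_assoc, add_sub_cancel_right, add_comm, h]
  · obtain ⟨ψ, hψ⟩ := ψ
    replace hψ : ψ ∈ T.domain := hψ
    have e : ((W : H →ₗ[ℂ] H) +ᵥ T) ⟨ψ, hψ⟩ = W ψ + T ⟨ψ, hψ⟩ := rfl
    have h0 : A (T ⟨ψ, hψ⟩ - μ • ψ) = ψ := hA.2 ⟨ψ, hψ⟩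
    have h : U ((T ⟨ψ, hψ⟩ - μ • ψ) + W (A (T ⟨ψ, hψ⟩ - μ • ψ))) = T ⟨ψ, hψ⟩ - μ • ψ :=
      DFunLike.congr_fun h₂ (T ⟨ψ, hψ⟩ - μ • ψ)
    rw [e]
    change A (U (W ψ + T ⟨ψ, hψ⟩ - μ • ψ)) = ψ
    rw [h0] at h
    rw [show W ψ + T ⟨ψ, hψ⟩ - μ • ψ = T ⟨ψ, hψ⟩ - μ • ψ + W ψ by abel, h, h0]

lemma IsResolventAt.exists_perturb [CompleteSpace H] {μ : ℂ} (hA : IsResolventAt T μ A)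
    (h : ‖W‖ * ‖A‖ < 1) : ∃ R, IsResolventAt ((W : H →ₗ[ℂ] H) +ᵥ T) μ R := by
  have hlt : ‖-(W * A)‖ < 1 := by
    rw [norm_neg]; exact (norm_mul_le _ _).trans_lt h
  obtain ⟨u, hu⟩ := isUnit_one_sub_of_norm_lt_one hlt
  rw [sub_neg_eq_add] at hu
  exact ⟨_, hA.perturb (U := (u⁻¹ : (H →L[ℂ] H)ˣ)) (by rw [← hu]; simp) (by rw [← hu]; simp)⟩

/-- Second resolvent identity, which turns smallness of `W` into smallness of the resolvent
difference. -/
lemma IsResolventAt.perturb_sub (hA : IsResolventAt T z A)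
    (hR : IsResolventAt ((W : H →ₗ[ℂ] H) +ᵥ T) z R) : R - A = -(R * W * A) := by
  ext ψ
  have := hR.2 ⟨A ψ, hA.mem ψ⟩
  have e : ((W : H →ₗ[ℂ] H) +ᵥ T) ⟨A ψ, hA.mem ψ⟩ = W (A ψ) + T ⟨A ψ, hA.mem ψ⟩ := rfl
  rw [e, hA.apply] at this
  simp only [map_sub, map_add, map_smul] at this
  change R ψ - A ψ = -R (W (A ψ))
  nth_rewrite 1 [← this]
  abel

lemma symm_vadd (hT : T.IsFormalAdjoint T)
    (hW : (W : H →ₗ[ℂ] H).IsSymmetric) :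
    ((W : H →ₗ[ℂ] H) +ᵥ T).IsFormalAdjoint ((W : H →ₗ[ℂ] H) +ᵥ T) := by
  rintro ⟨x, hx⟩ ⟨y, hy⟩
  have e1 : ((W : H →ₗ[ℂ] H) +ᵥ T) ⟨x, hx⟩ = W x + T ⟨x, hx⟩ := rfl
  have e2 : ((W : H →ₗ[ℂ] H) +ᵥ T) ⟨y, hy⟩ = W y + T ⟨y, hy⟩ := rfl
  rw [e1, e2, inner_add_left, inner_add_right]
  congr 1
  · exact hW x y
  · exact hT ⟨x, hx⟩ ⟨y, hy⟩

/-! #### Symmetric operators -/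

lemma inner_self_im_eq_zero (hT : T.IsFormalAdjoint T) (x : T.domain) :
    (inner ℂ (x : H) (T x)).im = 0 := by
  have h := hT x x
  rw [← inner_conj_symm] at h
  exact Complex.conj_eq_iff_im.1 h

/-- Take the imaginary part of ⟨Rψ, (T - z)Rψ⟩: symmetry makes the contribution of `T` real, leaving
-Im z ‖Rψ‖². -/
lemma IsResolventAt.norm_apply_le (hT : T.IsFormalAdjoint T) (hR : IsResolventAt T z R) (ψ : H) :
    |z.im| * ‖R ψ‖ ≤ ‖ψ‖ := by
  rcases (norm_nonneg (R ψ)).eq_or_lt with h0 | h0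
  · rw [← h0, mul_zero]; exact norm_nonneg _
  have h1 : (inner ℂ (R ψ) ψ).im = -z.im * ‖R ψ‖ ^ 2 := by
    nth_rewrite 2 [← hR.apply_sub ψ]
    rw [inner_sub_right, inner_smul_right, Complex.sub_im,
      inner_self_im_eq_zero hT ⟨R ψ, hR.mem ψ⟩, inner_self_eq_norm_sq_to_K]
    norm_cast
    simp [Complex.mul_im, -Complex.ofReal_pow]
  have h2 : |(inner ℂ (R ψ) ψ).im| ≤ ‖R ψ‖ * ‖ψ‖ :=
    (Complex.abs_im_le_norm _).trans (norm_inner_le_norm _ _)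
  rw [h1, abs_mul, abs_neg, abs_of_nonneg (sq_nonneg ‖R ψ‖), sq] at h2
  nlinarith

lemma IsResolventAt.norm_le (hT : T.IsFormalAdjoint T) (hR : IsResolventAt T z R)
    (hz : z.im ≠ 0) : ‖R‖ ≤ |z.im|⁻¹ := by
  refine R.opNorm_le_bound (by positivity) fun ψ => ?_
  have := hR.norm_apply_le hT ψ
  rw [inv_mul_eq_div, le_div_iff₀ (abs_pos.2 hz)]
  linarith

variable [CompleteSpace H]

/-- Since μ is real, the shift terms cancel in the symmetry relation for the vectors Ax and Ay. This
opens the way to bounded functional calculus for `A`. -/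
lemma IsResolventAt.isSelfAdjoint {μ : ℝ} (hT : T.IsFormalAdjoint T)
    (hA : IsResolventAt T μ A) : IsSelfAdjoint A := by
  rw [ContinuousLinearMap.isSelfAdjoint_iff_isSymmetric]
  intro x y
  have h := hT ⟨A x, hA.mem x⟩ ⟨A y, hA.mem y⟩
  rw [hA.apply, hA.apply] at h
  simp only [inner_add_left, inner_add_right, inner_smul_left, inner_smul_right,
    Complex.conj_ofReal] at h
  exact (add_right_cancel h).symm

/-- A vector orthogonal to the range of the symmetric operator `A` is killed by `A`, and `A` is
injective. -/
lemma IsResolventAt.dense_domain {μ : ℝ} (hT : T.IsFormalAdjoint T)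
    (hA : IsResolventAt T μ A) : Dense (T.domain : Set H) := by
  have hs := (ContinuousLinearMap.isSelfAdjoint_iff_isSymmetric).1 (hA.isSelfAdjoint hT)
  rw [Submodule.dense_iff_topologicalClosure_eq_top, Submodule.topologicalClosure_eq_top_iff,
    eq_bot_iff]
  intro y hy
  have hAy : A y = 0 := by
    refine ext_inner_left ℂ fun x => ?_
    rw [inner_zero_right]
    have h1 : inner ℂ (A x) y = inner ℂ x (A y) := hs x y
    rw [← h1]
    exact (Submodule.mem_orthogonal _ _).1 hy _ (hA.mem x)
  have := hA.apply_sub y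
  have e : (⟨A y, hA.mem y⟩ : T.domain) = 0 := Subtype.ext hAy
  rw [e, hAy] at this
  simpa using this.symm

/-- Surjectivity of T - μ leaves no room for a larger adjoint: every x in the domain of the adjoint
T* satisfies x = A(T*x - μx), so it lies in the range of `A`, which is contained in the domain of T.
-/
lemma IsResolventAt.isSelfAdjoint_pmap {μ : ℝ} (hT : T.IsFormalAdjoint T)
    (hA : IsResolventAt T μ A) : IsSelfAdjoint T := by
  have hd := hA.dense_domain hT
  rw [LinearPMap.isSelfAdjoint_def]
  refine le_antisymm ?_ (hT.le_adjoint hd)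
  have hle := hT.le_adjoint hd
  have hfa := LinearPMap.adjoint_isFormalAdjoint hd
  have hdom : ∀ x : T.adjoint.domain, (x : H) = A (T.adjoint x - (μ : ℂ) • (x : H)) := by
    intro x
    refine ext_inner_left ℂ fun ψ => ?_
    have hs := (ContinuousLinearMap.isSelfAdjoint_iff_isSymmetric).1 (hA.isSelfAdjoint hT)
    have h1 : inner ℂ (A ψ) (T.adjoint x - (μ : ℂ) • (x : H)) =
      inner ℂ ψ (A (T.adjoint x - (μ : ℂ) • (x : H))) := hs _ _
    rw [← h1, inner_sub_right, inner_smul_right]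
    have h2 := hfa.symm ⟨A ψ, hA.mem ψ⟩ x
    rw [hA.apply] at h2
    simp only [inner_add_left, inner_smul_left, Complex.conj_ofReal] at h2
    rw [← h2]; ring
  refine ⟨fun x hx => ?_, fun x y hxy => ?_⟩
  · have h := hA.mem (T.adjoint ⟨x, hx⟩ - (μ : ℂ) • x)
    rwa [← hdom ⟨x, hx⟩] at h
  · exact (hle.2 hxy.symm).symm

/-- Inversion about a real point preserves non-reality, and the spectrum of the self-adjoint `A` is
real. -/
lemma IsResolventAt.mem_resolventSet_of_im_ne_zero {μ : ℝ} (hT : T.IsFormalAdjoint T)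
    (hA : IsResolventAt T μ A) (hz : z.im ≠ 0) : z ∈ resolventSet T := by
  have hne : z ≠ μ := by rintro rfl; simp at hz
  rw [hA.mem_resolventSet_iff hne]
  intro hmem
  have h := (hA.isSelfAdjoint hT).im_eq_zero_of_mem_spectrum hmem
  rw [Complex.inv_im, div_eq_zero_iff] at h
  rcases h with h | h
  · simp at h; exact hz h
  · rw [Complex.normSq_eq_zero] at h
    exact hne (sub_eq_zero.1 h)

lemma IsResolventAt.im_eq_zero_of_mem_spec {μ : ℝ} (hT : T.IsFormalAdjoint T)
    (hA : IsResolventAt T μ A) (hz : z ∈ spec T) : z.im = 0 := by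
  by_contra h
  exact hz (hA.mem_resolventSet_of_im_ne_zero hT h)

/-- If `lam` is in the spectrum of `T + W`, then `T` has spectrum within `‖W‖` of `lam`. -/
lemma exists_mem_spec_of_perturb (hT : T.IsFormalAdjoint T) {lam : ℝ}
    (h : (lam : ℂ) ∈ spec ((W : H →ₗ[ℂ] H) +ᵥ T)) :
    ∃ lam' : ℝ, (lam' : ℂ) ∈ spec T ∧ |lam - lam'| ≤ ‖W‖ := by
  by_cases hr : (lam : ℂ) ∈ spec T
  · exact ⟨lam, hr, by simp⟩
  obtain ⟨A, hA⟩ := not_not.1 hr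
  have h1 : 1 ≤ ‖W‖ * ‖A‖ := by
    by_contra hlt
    exact h (hA.exists_perturb (not_le.1 hlt))
  have hA0 : 0 < ‖A‖ := by
    rcases (norm_nonneg A).eq_or_lt with h0 | h0
    · rw [← h0] at h1; simp at h1; linarith
    · exact h0
  have : Nontrivial (H →L[ℂ] H) := ⟨A, 0, norm_pos_iff.1 hA0⟩
  -- For self-adjoint `A` the spectral radius is ‖A‖, so some s in the spectrum has |s| = ‖A‖. It
  -- corresponds to the point lam + 1/s of the spectrum of T, at distance 1/‖A‖ ≤ ‖W‖ from lam.
  obtain ⟨s, hs, hsn⟩ := spectrum.exists_nnnorm_eq_spectralRadius A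
  have hsa := hA.isSelfAdjoint hT
  rw [hsa.spectralRadius_eq_nnnorm] at hsn
  have hsn' : ‖s‖ = ‖A‖ := by
    have : ‖s‖₊ = ‖A‖₊ := by exact_mod_cast hsn
    exact congrArg NNReal.toReal this
  have hs0 : s ≠ 0 := by rw [← norm_pos_iff, hsn']; exact hA0
  have him := hsa.im_eq_zero_of_mem_spectrum hs
  have hsre : s = (s.re : ℂ) := Complex.ext rfl (by simpa using him)
  refine ⟨s.re⁻¹ + lam, ?_, ?_⟩
  · have := (hA.inv_mem_spectrum_iff hs0).1 hs
    rw [hsre] at this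
    push_cast at this ⊢
    exact this
  · have h2 : |s.re| = ‖A‖ := by
      rw [← hsn', hsre, Complex.norm_real, Complex.ofReal_re, Real.norm_eq_abs]
    rw [show lam - (s.re⁻¹ + lam) = -s.re⁻¹ by ring, abs_neg, abs_inv, h2, inv_le_iff_one_le_mul₀ hA0]
    exact h1

end Resolvents


/-! ### The essential spectrum -/

section EssentialSpectrum

variable {H : Type*} [NormedAddCommGroup H] [InnerProductSpace ℂ H]
  {T : H →ₗ.[ℂ] H} {A W : H →L[ℂ] H}

/-- Bounded sequences `ψ k` in the domain for which `(T - z) ψ k` converges have convergent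
subsequences. -/
def HasSeqCompactKernel (T : H →ₗ.[ℂ] H) (z : ℂ) : Prop :=
  ∀ (ψ : ℕ → T.domain) (η : H), (∃ C, ∀ k, ‖(ψ k : H)‖ ≤ C) →
    Tendsto (fun k => T (ψ k) - z • (ψ k : H)) atTop (𝓝 η) →
    ∃ φ : ℕ → ℕ, StrictMono φ ∧ ∃ x : H, Tendsto (fun k => (ψ (φ k) : H)) atTop (𝓝 x)

/-- `W` maps sequences bounded in the graph norm of `T` to sequences with convergent
subsequences. -/
def IsRelativelyCompact (T : H →ₗ.[ℂ] H) (W : H →L[ℂ] H) : Prop :=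
  ∀ (ψ : ℕ → T.domain), (∃ C, ∀ k, ‖(ψ k : H)‖ ≤ C) → (∃ C, ∀ k, ‖T (ψ k)‖ ≤ C) →
    ∃ φ : ℕ → ℕ, StrictMono φ ∧ ∃ x : H, Tendsto (fun k => W (ψ (φ k) : H)) atTop (𝓝 x)

/-- Weyl's argument in sequential form: the given sequence is bounded in the graph norm of T, so
Wψ_k converges along a subsequence and may be subtracted from (T + W - z)ψ_k. -/
lemma HasSeqCompactKernel.vadd {z : ℂ} (h : HasSeqCompactKernel T z)
    (hW : IsRelativelyCompact T W) : HasSeqCompactKernel ((W : H →ₗ[ℂ] H) +ᵥ T) z := by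
  intro ψ η hψ hη
  let ψ' : ℕ → T.domain := fun k => ⟨ψ k, (ψ k).2⟩
  have e : ∀ k, ((W : H →ₗ[ℂ] H) +ᵥ T) (ψ k) = W (ψ k : H) + T (ψ' k) := fun k => rfl
  obtain ⟨C, hC⟩ := hψ
  obtain ⟨D, hD⟩ := hη.norm.bddAbove_range
  have hT : ∀ k, ‖T (ψ' k)‖ ≤ D + ‖z‖ * C + ‖W‖ * C := by
    intro k
    have e1 : T (ψ' k) = (((W : H →ₗ[ℂ] H) +ᵥ T) (ψ k) - z • (ψ k : H)) + z • (ψ k : H)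
        - W (ψ k : H) := by rw [e]; abel
    rw [e1]
    refine (norm_sub_le _ _).trans (add_le_add ((norm_add_le _ _).trans
      (add_le_add (hD ⟨k, rfl⟩) ?_)) ?_)
    · rw [norm_smul]; exact mul_le_mul_of_nonneg_left (hC k) (norm_nonneg _)
    · exact (W.le_opNorm _).trans (mul_le_mul_of_nonneg_left (hC k) (norm_nonneg _))
  obtain ⟨φ, hφ, x, hx⟩ := hW ψ' ⟨C, hC⟩ ⟨_, hT⟩
  obtain ⟨φ', hφ', y, hy⟩ := h (ψ' ∘ φ) (η - x) ⟨C, fun k => hC (φ k)⟩ (by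
    refine ((hη.comp hφ.tendsto_atTop).sub hx).congr fun k => ?_
    simp only [Function.comp_apply]
    rw [e]
    change W (ψ (φ k) : H) + T (ψ' (φ k)) - z • (ψ (φ k) : H) - W (ψ (φ k) : H) =
      T (ψ' (φ k)) - z • (ψ (φ k) : H)
    abel)
  exact ⟨φ ∘ φ', hφ.comp hφ', y, hy⟩

/-- The graph norms of T and T + W are equivalent, so -W is relatively compact for T + W and the
forward implication can be reversed. -/
lemma hasSeqCompactKernel_vadd_iff {z : ℂ} (hW : IsRelativelyCompact T W) :
    HasSeqCompactKernel ((W : H →ₗ[ℂ] H) +ᵥ T) z ↔ HasSeqCompactKernel T z := by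
  refine ⟨fun h => ?_, fun h => h.vadd hW⟩
  have hW' : IsRelativelyCompact ((W : H →ₗ[ℂ] H) +ᵥ T) (-W) := by
    rintro ψ ⟨C, hC⟩ ⟨D, hD⟩
    let ψ' : ℕ → T.domain := fun k => ⟨ψ k, (ψ k).2⟩
    have e : ∀ k, ((W : H →ₗ[ℂ] H) +ᵥ T) (ψ k) = W (ψ k : H) + T (ψ' k) := fun k => rfl
    obtain ⟨φ, hφ, x, hx⟩ := hW ψ' ⟨C, hC⟩ ⟨D + ‖W‖ * C, fun k => by
      have e1 : T (ψ' k) = ((W : H →ₗ[ℂ] H) +ᵥ T) (ψ k) - W (ψ k : H) := by rw [e]; abel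
      rw [e1]
      exact (norm_sub_le _ _).trans (add_le_add (hD k)
        ((W.le_opNorm _).trans (mul_le_mul_of_nonneg_left (hC k) (norm_nonneg _))))⟩
    exact ⟨φ, hφ, -x, hx.neg⟩
  have h2 := h.vadd hW'
  have e : (((-W : H →L[ℂ] H) : H →ₗ[ℂ] H) +ᵥ ((W : H →ₗ[ℂ] H) +ᵥ T)) = T := by
    rw [ContinuousLinearMap.toLinearMap_neg, neg_vadd_vadd]
  rwa [e] at h2

lemma IsRelativelyCompact.vadd_left {V : H →L[ℂ] H} (h : IsRelativelyCompact T W) :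
    IsRelativelyCompact ((V : H →ₗ[ℂ] H) +ᵥ T) W := by
  rintro ψ ⟨C, hC⟩ ⟨D, hD⟩
  have hC0 : 0 ≤ C := (norm_nonneg _).trans (hC 0)
  let ψ' : ℕ → T.domain := fun k => ⟨ψ k, (ψ k).2⟩
  have e : ∀ k, ((V : H →ₗ[ℂ] H) +ᵥ T) (ψ k) = V (ψ k : H) + T (ψ' k) := fun k => rfl
  refine h ψ' ⟨C, hC⟩ ⟨D + ‖V‖ * C, fun k => ?_⟩
  have h1 : T (ψ' k) = ((V : H →ₗ[ℂ] H) +ᵥ T) (ψ k) - V (ψ k : H) := by rw [e, add_sub_cancel_left]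
  rw [h1]
  refine (norm_sub_le _ _).trans (add_le_add (hD k) ?_)
  exact (V.le_opNorm _).trans (mul_le_mul_of_nonneg_left (hC k) (norm_nonneg _))

lemma hasSeqCompactKernel_of_mem_resolventSet {z : ℂ} (hz : z ∈ resolventSet T) :
    HasSeqCompactKernel T z := by
  obtain ⟨R, hR⟩ := hz
  intro ψ η _ hη
  refine ⟨id, strictMono_id, R η, ((R.continuous.tendsto η).comp hη).congr fun k => ?_⟩
  exact hR.2 (ψ k)

lemma mem_eigenspace_iff {z : ℂ} {x : H} :
    x ∈ eigenspace T z ↔ ∃ h : x ∈ T.domain, T ⟨x, h⟩ = z • x := by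
  simp only [eigenspace, Submodule.mem_map, LinearMap.mem_ker, LinearMap.sub_apply,
    LinearMap.smul_apply, Submodule.subtype_apply, sub_eq_zero]
  constructor
  · rintro ⟨y, hy, rfl⟩
    exact ⟨y.2, hy⟩
  · rintro ⟨h, hx⟩
    exact ⟨⟨x, h⟩, hx, rfl⟩

lemma IsResolventAt.mem_eigenspace_iff {μ z : ℂ} (hA : IsResolventAt T μ A) (hz : z ≠ μ) {x : H} :
    x ∈ eigenspace T z ↔ A x = (z - μ)⁻¹ • x := by
  have hz' : z - μ ≠ 0 := sub_ne_zero.2 hz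
  rw [MagneticStark.mem_eigenspace_iff]
  constructor
  · rintro ⟨h, hx⟩
    have := hA.2 ⟨x, h⟩
    simp only [hx, ← sub_smul, map_smul] at this
    rw [eq_inv_smul_iff₀ hz', this]
  · intro hx
    have hx' : x = (z - μ) • A x := by rw [hx, smul_smul, mul_inv_cancel₀ hz', one_smul]
    have hmem : x ∈ T.domain := by rw [hx']; exact T.domain.smul_mem _ (hA.mem x)
    refine ⟨hmem, ?_⟩
    have e : (⟨x, hmem⟩ : T.domain) = (z - μ) • ⟨A x, hA.mem x⟩ := Subtype.ext hx'
    rw [e, LinearPMap.map_smul, hA.apply, hx, smul_add, smul_smul, smul_smul,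
      mul_right_comm, mul_inv_cancel₀ hz', one_mul, ← add_smul, sub_add_cancel]

/-- Put ψ = Ax: then (T - lam)Ax = -(lam - μ)(Ax - (lam - μ)⁻¹x), so the hypothesis applies to Ax_k.
Once Ax_k converges along a subsequence, x_k is recovered from Ax_k and the convergent difference.
-/
lemma IsResolventAt.subseq_of_hasSeqCompactKernel {μ lam : ℂ} (hA : IsResolventAt T μ A)
    (hne : lam ≠ μ) (h : HasSeqCompactKernel T lam) {x : ℕ → H} {C : ℝ} (hx : ∀ k, ‖x k‖ ≤ C)
    {η : H} (hη : Tendsto (fun k => A (x k) - (lam - μ)⁻¹ • x k) atTop (𝓝 η)) :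
    ∃ φ : ℕ → ℕ, StrictMono φ ∧ ∃ y : H, Tendsto (fun k => x (φ k)) atTop (𝓝 y) := by
  have hne' : lam - μ ≠ 0 := sub_ne_zero.2 hne
  obtain ⟨φ, hφ, y, hy⟩ := h (fun k => ⟨A (x k), hA.mem _⟩) (-((lam - μ) • η))
    ⟨‖A‖ * C, fun k => (A.le_opNorm _).trans (mul_le_mul_of_nonneg_left (hx k) (norm_nonneg _))⟩
    ((hη.const_smul (lam - μ)).neg.congr fun k => by
      rw [hA.apply, smul_sub, smul_smul, mul_inv_cancel₀ hne', one_smul]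
      simp only [sub_smul]; abel)
  refine ⟨φ, hφ, (lam - μ) • (y - η),
    ((hy.sub (hη.comp hφ.tendsto_atTop)).const_smul (lam - μ)).congr fun k => ?_⟩
  simp only [Function.comp_apply, sub_sub_cancel]
  rw [smul_smul, mul_inv_cancel₀ hne', one_smul]

/-- Riesz: sequences in the closed unit ball of the eigenspace have convergent subsequences, so that
ball is compact. -/
lemma IsResolventAt.finiteDimensional_eigenspace {μ lam : ℂ} (hA : IsResolventAt T μ A)
    (hne : lam ≠ μ) (h : HasSeqCompactKernel T lam) :
    FiniteDimensional ℂ (eigenspace T lam) := by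
  have hclosed : IsClosed (eigenspace T lam : Set H) := by
    have : (eigenspace T lam : Set H) = {x | A x = (lam - μ)⁻¹ • x} :=
      Set.ext fun x => hA.mem_eigenspace_iff hne
    rw [this]
    exact isClosed_eq A.continuous (continuous_const_smul _)
  have hcomp : IsCompact (Metric.closedBall (0 : eigenspace T lam) 1) := by
    rw [isCompact_iff_isSeqCompact]
    intro x hx
    obtain ⟨φ, hφ, y, hy⟩ := hA.subseq_of_hasSeqCompactKernel hne h
      (x := fun k => (x k : H)) (C := 1) (fun k => mem_closedBall_zero_iff.1 (hx k)) (η := 0)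
      (tendsto_const_nhds.congr fun k => by
        rw [(hA.mem_eigenspace_iff hne).1 (x k).2, sub_self])
    have hymem : y ∈ eigenspace T lam :=
      hclosed.mem_of_tendsto hy (Eventually.of_forall fun k => (x (φ k)).2)
    refine ⟨⟨y, hymem⟩, ?_, φ, hφ, ?_⟩
    · rw [mem_closedBall_zero_iff]
      exact le_of_tendsto hy.norm (Eventually.of_forall fun k => mem_closedBall_zero_iff.1 (hx _))
    · exact tendsto_subtype_rng.2 hy
  exact FiniteDimensional.of_isCompact_closedBall ℂ one_pos hcomp

variable [CompleteSpace H]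

/-- Isolation of α = (lam - μ)⁻¹ in the spectrum of `A` provides a reduced resolvent G = (A - α)⁻¹
off the eigenspace. Then x splits as Px + G(A - α)x: the first part lies in a finite-dimensional
space, and the second converges whenever (T - lam)x does. -/
lemma IsResolventAt.hasSeqCompactKernel_of_mem_discreteSpec {μ lam : ℝ} (hT : T.IsFormalAdjoint T)
    (hA : IsResolventAt T μ A) (h : (lam : ℂ) ∈ discreteSpec T) : HasSeqCompactKernel T lam := by
  obtain ⟨hspec, ⟨r, hr, hiso⟩, -, hfin⟩ := h
  have hne : (lam : ℂ) ≠ μ := by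
    intro he; rw [he] at hspec; exact hspec hA.mem_resolventSet
  have hne' : lam - μ ≠ 0 := by
    intro he; exact hne (by rw [sub_eq_zero.1 he])
  set α : ℝ := (lam - μ)⁻¹ with hα
  have hα0 : α ≠ 0 := inv_ne_zero hne'
  have hsa := hA.isSelfAdjoint hT
  have hisoA : ∀ᶠ s in 𝓝 α, s ∈ spectrum ℝ A → s = α := by
    have hc : Tendsto (fun s : ℝ => s⁻¹ + μ) (𝓝 α) (𝓝 lam) := by
      have : Tendsto (fun s : ℝ => s⁻¹ + μ) (𝓝 α) (𝓝 (α⁻¹ + μ)) :=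
        (tendsto_inv₀ hα0).add_const μ
      rwa [hα, inv_inv, sub_add_cancel] at this
    filter_upwards [hc (Metric.ball_mem_nhds lam hr), isOpen_ne.mem_nhds hα0] with s hs hs0 hmem
    have h1 : (s : ℂ) ∈ spectrum ℂ A := (spectrum.algebraMap_mem_iff ℂ).2 hmem
    rw [hA.inv_mem_spectrum_iff (by exact_mod_cast hs0)] at h1
    have h2 := hiso _ h1 (by
      rw [Set.mem_preimage, mem_ball_iff_norm] at hs
      have e : (s : ℂ)⁻¹ + μ - lam = ((s⁻¹ + μ - lam : ℝ) : ℂ) := by push_cast; ring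
      rw [e, Complex.norm_real]; exact hs)
    have h3 : s⁻¹ + μ = lam := by exact_mod_cast h2
    rw [hα, ← h3, add_sub_cancel_right, inv_inv]
  -- At s = α the convention 0⁻¹ = 0 assigns the value 0. Any value would be continuous there, since
  -- α is isolated in the spectrum.
  have hcont : ContinuousOn (fun s : ℝ => (s - α)⁻¹) (spectrum ℝ A) := by
    intro s hs
    by_cases hsα : s = α
    · subst hsα
      refine (continuousWithinAt_const (b := (0 : ℝ))).congr_of_eventuallyEq ?_ (by simp)
      filter_upwards [nhdsWithin_le_nhds hisoA, self_mem_nhdsWithin] with t ht hts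
      simp [ht hts]
    · exact ((continuousAt_id.sub continuousAt_const).inv₀
        (sub_ne_zero.2 hsα)).continuousWithinAt
  set G : H →L[ℂ] H := cfc (fun s : ℝ => (s - α)⁻¹) A
  have hAα : cfc (fun s : ℝ => s - α) A = A - algebraMap ℝ _ α := by
    rw [cfc_sub (fun s => s) (fun _ => α) A, cfc_id' ℝ A, cfc_const α A]
  set P : H →L[ℂ] H := 1 - G * (A - algebraMap ℝ _ α)
  have hP0 : (A - algebraMap ℝ _ α) * P = 0 := by
    have e1 : G * (A - algebraMap ℝ _ α) = cfc (fun s : ℝ => (s - α)⁻¹ * (s - α)) A := by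
      rw [← hAα, ← cfc_mul _ _ A hcont (by fun_prop)]
    have hc2 : ContinuousOn (fun s : ℝ => (s - α)⁻¹ * (s - α)) (spectrum ℝ A) :=
      hcont.mul (by fun_prop)
    have e2 : P = cfc (fun s : ℝ => 1 - (s - α)⁻¹ * (s - α)) A := by
      rw [cfc_sub (fun _ => 1) _ A (by fun_prop) hc2, cfc_const_one ℝ A, ← e1]
    have hc3 : ContinuousOn (fun s : ℝ => 1 - (s - α)⁻¹ * (s - α)) (spectrum ℝ A) :=
      continuousOn_const.sub hc2
    rw [← hAα, e2, ← cfc_mul _ _ A (by fun_prop) hc3]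
    rw [← cfc_const_zero ℝ A]
    refine cfc_congr fun s _ => ?_
    by_cases hs : s - α = 0
    · simp [hs]
    · simp [inv_mul_cancel₀ hs]
  have halg : ∀ x : H, (algebraMap ℝ (H →L[ℂ] H) α) x = (α : ℂ) • x := fun x => rfl
  have hPmem : ∀ x, P x ∈ eigenspace T lam := by
    intro x
    rw [hA.mem_eigenspace_iff hne]
    have : A (P x) - (algebraMap ℝ (H →L[ℂ] H) α) (P x) = 0 := DFunLike.congr_fun hP0 x
    rw [halg, sub_eq_zero] at this
    rw [this, hα]; push_cast; rfl
  rintro ψ η ⟨C, hC⟩ hη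
  have hproper : ProperSpace (eigenspace T lam) := FiniteDimensional.proper ℂ _
  obtain ⟨y, -, φ, hφ, hy⟩ := tendsto_subseq_of_bounded
    (Metric.isBounded_closedBall (x := (0 : eigenspace T lam)) (r := ‖P‖ * C))
    (x := fun k => ⟨P (ψ k), hPmem _⟩) (fun k => by
      rw [mem_closedBall_zero_iff]
      exact (P.le_opNorm _).trans (mul_le_mul_of_nonneg_left (hC k) (norm_nonneg _)))
  refine ⟨φ, hφ, y + -((α : ℂ) • G (A η)), ?_⟩
  have hy' : Tendsto (fun k => P (ψ (φ k) : H)) atTop (𝓝 (y : H)) :=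
    (continuous_subtype_val.tendsto y).comp hy
  have hη' : Tendsto (fun k => (α : ℂ) • G (A (T (ψ (φ k)) - (lam : ℂ) • (ψ (φ k) : H)))) atTop
      (𝓝 ((α : ℂ) • G (A η))) :=
    (((G.continuous.comp A.continuous).const_smul (α : ℂ)).tendsto η).comp
      (hη.comp hφ.tendsto_atTop)
  refine (hy'.add hη'.neg).congr fun k => ?_
  have h1 := hA.2 (ψ (φ k))
  have h2 : T (ψ (φ k)) - (μ : ℂ) • (ψ (φ k) : H) =
    (T (ψ (φ k)) - (lam : ℂ) • (ψ (φ k) : H)) + ((lam - μ : ℝ) : ℂ) • (ψ (φ k) : H) := by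
    push_cast; rw [sub_smul]; abel
  rw [h2, map_add, map_smul] at h1
  set x : H := (ψ (φ k) : H)
  set v := T (ψ (φ k)) - (lam : ℂ) • x
  have h3 : (α : ℂ) • A v = -(A x - (α : ℂ) • x) := by
    have : (α : ℂ) * ((lam - μ : ℝ) : ℂ) = 1 := by
      rw [← Complex.ofReal_mul, hα, inv_mul_cancel₀ hne', Complex.ofReal_one]
    have h5 := congrArg (fun y => (α : ℂ) • y) h1
    simp only [smul_add, smul_smul, this, one_smul] at h5
    rw [← h5]; abel
  have h4 : P x = x - G (A x - (α : ℂ) • x) := rfl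
  rw [← map_smul, h3, map_neg, h4]; abel

/-- Adding the orthogonal projection P onto the eigenspace repairs the kernel: D = A - α + P is
bounded below by sequential compactness, and being self-adjoint it is invertible. Invertibility
persists near α, which isolates lam. If P were 0, then A - α itself would be invertible and lam
would not be in the spectrum. -/
lemma IsResolventAt.mem_discreteSpec {μ lam : ℝ} (hT : T.IsFormalAdjoint T)
    (hA : IsResolventAt T μ A) (hspec : (lam : ℂ) ∈ spec T) (h : HasSeqCompactKernel T lam) :
    (lam : ℂ) ∈ discreteSpec T := by
  have hne : (lam : ℂ) ≠ μ := by
    intro he; rw [he] at hspec; exact hspec hA.mem_resolventSet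
  have hne' : (lam : ℂ) - μ ≠ 0 := sub_ne_zero.2 hne
  have hfin := hA.finiteDimensional_eigenspace hne h
  have hsa := hA.isSelfAdjoint hT
  set α : ℂ := ((lam : ℂ) - μ)⁻¹ with hα
  have hα0 : α ≠ 0 := inv_ne_zero hne'
  have hαsa : IsSelfAdjoint (algebraMap ℂ (H →L[ℂ] H) α) := by
    refine IsSelfAdjoint.algebraMap _ ?_
    rw [hα, ← Complex.ofReal_sub, ← Complex.ofReal_inv]
    exact Complex.conj_ofReal _
  set P : H →L[ℂ] H := (eigenspace T lam).starProjection with hP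
  have hPmem : ∀ x, P x ∈ eigenspace T lam := fun x => Submodule.starProjection_apply_mem _ x
  have hPsa : IsSelfAdjoint P := isSelfAdjoint_starProjection _
  have hPP : P * P = P := (Submodule.isIdempotentElem_starProjection _)
  have hAP : A * P = algebraMap ℂ _ α * P := by
    ext x
    exact (hA.mem_eigenspace_iff hne).1 (hPmem x)
  have hPA : P * A = algebraMap ℂ _ α * P := by
    have := congrArg star hAP
    rw [star_mul, star_mul, hPsa.star_eq, hsa.star_eq, hαsa.star_eq] at this
    rw [this, ← Algebra.commutes]
  set D : H →L[ℂ] H := A - algebraMap ℂ _ α + P with hD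
  have hPD : P * D = P := by
    rw [hD, mul_add, mul_sub, hPA, hPP, Algebra.commutes α P, sub_self, zero_add]
  have hDapp : ∀ x, D x = A x - α • x + P x := fun x => rfl
  -- Otherwise there are unit vectors with Dx_k → 0. From P D = P both Px_k and (A - α)x_k tend to
  -- 0, so a limit point is a unit eigenvector annihilated by P, which is impossible.
  have hbelow : ∃ c > 0, ∀ x, c * ‖x‖ ≤ ‖D x‖ := by
    by_contra! hcon
    have hseq : ∀ k : ℕ, ∃ x : H, ‖x‖ = 1 ∧ ‖D x‖ ≤ 1 / ((k : ℝ) + 1) := by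
      intro k
      obtain ⟨x, hx⟩ := hcon (1 / ((k : ℝ) + 1)) (by positivity)
      have hx0 : 0 < ‖x‖ := by
        rcases (norm_nonneg x).eq_or_lt with h0 | h0
        · rw [← h0, mul_zero] at hx; exact absurd hx (not_lt.2 (norm_nonneg _))
        · exact h0
      refine ⟨((‖x‖⁻¹ : ℝ) : ℂ) • x, ?_, ?_⟩
      · rw [norm_smul, Complex.norm_real, norm_inv, norm_norm, inv_mul_cancel₀ hx0.ne']
      · rw [map_smul, norm_smul, Complex.norm_real, norm_inv, norm_norm, inv_mul_le_iff₀ hx0]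
        linarith
    choose x hx1 hxD using hseq
    have hDx : Tendsto (fun k => D (x k)) atTop (𝓝 0) :=
      squeeze_zero_norm hxD tendsto_one_div_add_atTop_nhds_zero_nat
    have hPx : Tendsto (fun k => P (x k)) atTop (𝓝 0) := by
      have := (P.continuous.tendsto 0).comp hDx
      rw [map_zero] at this
      exact this.congr fun k => DFunLike.congr_fun hPD (x k)
    have hAx : Tendsto (fun k => A (x k) - α • x k) atTop (𝓝 0) := by
      have := hDx.sub hPx
      rw [sub_zero] at this
      exact this.congr fun k => by rw [hDapp]; abel
    obtain ⟨φ, hφ, y, hy⟩ := hA.subseq_of_hasSeqCompactKernel hne h (fun k => (hx1 k).le) hAx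
    have hy1 : ‖y‖ = 1 :=
      tendsto_nhds_unique hy.norm (tendsto_const_nhds.congr fun k => (hx1 _).symm)
    have hymem : y ∈ eigenspace T lam := by
      rw [hA.mem_eigenspace_iff hne]
      have h1 : Tendsto (fun k => A (x (φ k)) - α • x (φ k)) atTop (𝓝 (A y - α • y)) :=
        ((A.continuous.tendsto y).comp hy).sub (hy.const_smul α)
      exact sub_eq_zero.1 (tendsto_nhds_unique h1 (hAx.comp hφ.tendsto_atTop))
    have hPy : P y = y := Submodule.starProjection_eq_self_iff.2 hymem
    have hPy0 : P y = 0 :=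
      tendsto_nhds_unique ((P.continuous.tendsto y).comp hy) (hPx.comp hφ.tendsto_atTop)
    rw [← hPy, hPy0, norm_zero] at hy1
    exact zero_ne_one hy1
  have hDsa : IsSelfAdjoint D := (hsa.sub hαsa).add hPsa
  have hDunit : IsUnit D := by
    obtain ⟨c, hc, hcD⟩ := hbelow
    -- The square is coercive, because ⟨D²x, x⟩ = ‖Dx‖² ≥ c²‖x‖².
    have hsq : IsUnit (D * D) := by
      refine ContinuousLinearMap.isUnit_of_forall_le_norm_inner_map (D * D)
        (c := ⟨c ^ 2, sq_nonneg c⟩) (by exact_mod_cast pow_pos hc 2) fun x => ?_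
      have hs := (ContinuousLinearMap.isSelfAdjoint_iff_isSymmetric).1 hDsa
      have e : inner ℂ ((D * D) x) x = inner ℂ (D x) (D x) := hs (D x) x
      rw [e, inner_self_eq_norm_sq_to_K]
      have h1 := hcD x
      have h2 : (c * ‖x‖) ^ 2 ≤ ‖D x‖ ^ 2 := by gcongr
      simp only [norm_pow, Complex.coe_algebraMap, Complex.norm_real, norm_norm]
      change ‖x‖ ^ 2 * c ^ 2 ≤ _
      linarith [mul_pow c ‖x‖ 2]
    rw [← sq] at hsq
    exact (isUnit_pow_iff two_ne_zero).1 hsq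
  refine ⟨hspec, ?_, ?_, hfin⟩
  · have hnear : ∀ᶠ s in 𝓝 α, IsUnit (D - algebraMap ℂ _ (s - α)) := by
      have hc : ContinuousAt (fun s : ℂ => D - algebraMap ℂ (H →L[ℂ] H) (s - α)) α :=
        (continuous_const.sub ((continuous_algebraMap ℂ (H →L[ℂ] H)).comp
          (continuous_id.sub continuous_const))).continuousAt
      refine hc (Units.isOpen.mem_nhds ?_)
      simpa using hDunit
    have hnear' : ∀ᶠ s in 𝓝 α, s ∈ spectrum ℂ A → s = α := by
      filter_upwards [hnear] with s hs hmem
      by_contra hsα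
      refine hmem ?_
      obtain ⟨u, hu⟩ := hs
      have hsα' : s - α ≠ 0 := sub_ne_zero.2 hsα
      have hDs : (u : H →L[ℂ] H) = A - algebraMap ℂ _ s + P := by
        rw [hu, hD, map_sub]; abel
      have c1 : Commute (u : H →L[ℂ] H) P := by
        rw [hDs]
        refine Commute.add_left (Commute.sub_left ?_ (Algebra.commute_algebraMap_left _ _))
          (Commute.refl _)
        exact hAP.trans hPA.symm
      have c2 : Commute ((u⁻¹ : (H →L[ℂ] H)ˣ) : H →L[ℂ] H) P := c1.units_inv_left
      have hsA : algebraMap ℂ (H →L[ℂ] H) s - A = P - u := by rw [hDs]; abel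
      have hsAP : (algebraMap ℂ (H →L[ℂ] H) s - A) * P = (s - α) • P := by
        rw [sub_mul, hAP, ← sub_mul, ← map_sub, Algebra.smul_def]
      have hPsA : P * (algebraMap ℂ (H →L[ℂ] H) s - A) = (s - α) • P := by
        rw [mul_sub, hPA, ← Algebra.commutes, ← sub_mul, ← map_sub, Algebra.smul_def]
      -- On the eigenspace s - A acts as s - α, and on its orthogonal complement as -u. The inverse
      -- is assembled from the two blocks.
      refine ⟨⟨algebraMap ℂ (H →L[ℂ] H) s - A,
        -((u⁻¹ : (H →L[ℂ] H)ˣ) : H →L[ℂ] H) * (1 - P) + (s - α)⁻¹ • P, ?_, ?_⟩, rfl⟩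
      · rw [mul_add, mul_smul_comm, hsAP, smul_smul, inv_mul_cancel₀ hsα', one_smul, hsA]
        have : (P - (u : H →L[ℂ] H)) * (-((u⁻¹ : (H →L[ℂ] H)ˣ) : H →L[ℂ] H) * (1 - P)) =
            (1 - ((u⁻¹ : (H →L[ℂ] H)ˣ) : H →L[ℂ] H) * P) * (1 - P) := by
          rw [← mul_assoc, c2.eq]
          congr 1
          rw [mul_neg, sub_mul, Units.mul_inv]; abel
        rw [this, sub_mul, one_mul, mul_assoc, mul_sub, mul_one, hPP, sub_self, mul_zero]
        abel
      · rw [add_mul, smul_mul_assoc, hPsA, smul_smul, inv_mul_cancel₀ hsα', one_smul, hsA]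
        have c3 : (1 - P) * (P - (u : H →L[ℂ] H)) = -(u * (1 - P)) := by
          rw [sub_mul, one_mul, mul_sub, hPP, mul_sub, mul_one, c1.eq]; abel
        rw [mul_assoc, c3, neg_mul_neg, ← mul_assoc, Units.inv_mul, one_mul]; abel
    have hcinv : Tendsto (fun w : ℂ => (w - μ)⁻¹) (𝓝 (lam : ℂ)) (𝓝 α) :=
      (tendsto_id.sub_const _).inv₀ hne'
    have hev := (hcinv.eventually hnear').and (isOpen_ne.mem_nhds hne)
    obtain ⟨r, hr, hball⟩ := Metric.eventually_nhds_iff.1 hev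
    refine ⟨r, hr, fun w hw hwr => ?_⟩
    obtain ⟨h1, h2⟩ := hball (by rwa [dist_eq_norm])
    have h3 : (w - μ)⁻¹ ∈ spectrum ℂ A := by
      by_contra h4
      exact hw ((hA.mem_resolventSet_iff h2).2 h4)
    have h4 := inv_injective (h1 h3)
    exact sub_left_injective h4
  · intro hbot
    have hP0 : P = 0 := by
      ext x
      have := hPmem x
      rw [hbot, Submodule.mem_bot] at this
      exact this
    rw [hD, hP0, add_zero] at hDunit
    refine hspec ((hA.mem_resolventSet_iff hne).2 ?_)
    rw [spectrum.notMem_iff, ← neg_sub, IsUnit.neg_iff]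
    exact hDunit

/-- For a self-adjoint operator, the complement of the essential spectrum is characterised by
sequential compactness. -/
lemma IsResolventAt.mem_essSpec_iff {μ lam : ℝ} (hT : T.IsFormalAdjoint T)
    (hA : IsResolventAt T μ A) : (lam : ℂ) ∈ essSpec T ↔ ¬ HasSeqCompactKernel T lam := by
  constructor
  · rintro ⟨h1, h2⟩ h3
    exact h2 (hA.mem_discreteSpec hT h1 h3)
  · intro h
    refine ⟨fun h1 => h (hasSeqCompactKernel_of_mem_resolventSet h1), fun h1 => h ?_⟩
    exact hA.hasSeqCompactKernel_of_mem_discreteSpec hT h1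

end EssentialSpectrum


/-! ### Spectral projections -/

section SpectralProjections

variable {H : Type*} [NormedAddCommGroup H] [InnerProductSpace ℂ H] [CompleteSpace H]
  {T : H →ₗ.[ℂ] H} {A : H →L[ℂ] H}

lemma inner_cfcHom_nonneg (hA : IsSelfAdjoint A) (ψ : H) {f : C(spectrum ℝ A, ℝ)} (hf : 0 ≤ f) :
    0 ≤ (inner ℂ ψ (cfcHom hA f ψ)).re := by
  have h1 : 0 ≤ cfcHom hA f := (cfcHom_nonneg_iff hA).2 hf
  exact ((ContinuousLinearMap.nonneg_iff_isPositive _).1 h1).re_inner_nonneg_right ψ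

open scoped CompactlySupported in
/-- The positive functional `f ↦ ⟨ψ, f(A) ψ⟩` of a bounded self-adjoint operator. -/
def spectralFunctional (hA : IsSelfAdjoint A) (ψ : H) : C_c(spectrum ℝ A, ℝ) →ₚ[ℝ] ℝ :=
  PositiveLinearMap.mk₀
    { toFun := fun f => (inner ℂ ψ (cfcHom hA (f : C(spectrum ℝ A, ℝ)) ψ)).re
      map_add' := fun f g => by
        have e : ((f + g : C_c(spectrum ℝ A, ℝ)) : C(spectrum ℝ A, ℝ)) =
          (f : C(spectrum ℝ A, ℝ)) + (g : C(spectrum ℝ A, ℝ)) := rfl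
        rw [e, map_add, add_apply, inner_add_right, Complex.add_re]
      map_smul' := fun c f => by
        have e : ((c • f : C_c(spectrum ℝ A, ℝ)) : C(spectrum ℝ A, ℝ)) =
          c • (f : C(spectrum ℝ A, ℝ)) := rfl
        rw [e, map_smul]
        change (inner ℂ ψ ((c : ℂ) • _)).re = _
        rw [inner_smul_right, Complex.re_ofReal_mul]
        rfl }
    fun f hf => inner_cfcHom_nonneg hA ψ hf

/-- The spectral measure of a bounded self-adjoint operator at a vector. -/
lemma exists_spectralMeasure (hA : IsSelfAdjoint A) (ψ : H) :
    ∃ ν : Measure (spectrum ℝ A), IsFiniteMeasure ν ∧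
      ∀ f : ℝ → ℝ, ContinuousOn f (spectrum ℝ A) →
        inner ℂ ψ (cfc f A ψ) = ((∫ x, f x ∂ν : ℝ) : ℂ) := by
  refine ⟨RealRMK.rieszMeasure (spectralFunctional hA ψ), inferInstance, fun f hf => ?_⟩
  let f' : C(spectrum ℝ A, ℝ) := ⟨_, hf.domRestrict⟩
  have h := RealRMK.integral_rieszMeasure (spectralFunctional hA ψ)
    (CompactlySupportedContinuousMap.continuousMapEquiv f')
  have h' : ∫ x : spectrum ℝ A, f x ∂(RealRMK.rieszMeasure (spectralFunctional hA ψ)) =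
    (inner ℂ ψ (cfcHom hA f' ψ)).re := h
  rw [h', cfc_apply f A hA hf]
  have hs := (ContinuousLinearMap.isSelfAdjoint_iff_isSymmetric).1
    (cfcHom_predicate hA f')
  exact (hs.coe_re_inner_self_apply ψ).symm

lemma one_sub_mul_ofReal_ne_zero {z : ℂ} (hz : z.im ≠ 0) (μ x : ℝ) : 1 - (z - μ) * x ≠ 0 := by
  intro h
  have h1 := congrArg Complex.im h
  have h2 := congrArg Complex.re h
  simp [Complex.mul_im, Complex.mul_re] at h1 h2
  rcases h1 with h1 | h1
  · exact hz h1
  · rw [h1] at h2; simp at h2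

/-- The resolvent at a non-real point as a function of the resolvent at a real point. -/
lemma IsResolventAt.resolvent_eq_cfc {μ : ℝ} (hT : T.IsFormalAdjoint T)
    (hA : IsResolventAt T μ A) {z : ℂ} (hz : z.im ≠ 0) :
    resolvent T z = cfc (fun x : ℝ => ((x : ℂ) * (1 - (z - μ) * x)⁻¹).re) A +
      Complex.I • cfc (fun x : ℝ => ((x : ℂ) * (1 - (z - μ) * x)⁻¹).im) A := by
  have hsa := hA.isSelfAdjoint hT
  have hreal : ∀ x ∈ spectrum ℂ A, x = (x.re : ℂ) := fun x hx =>
    Complex.ext rfl (by simpa using hsa.im_eq_zero_of_mem_spectrum hx)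
  have hne : ∀ x ∈ spectrum ℂ A, 1 - (z - μ) * x ≠ 0 := fun x hx => by
    rw [hreal x hx]; exact one_sub_mul_ofReal_ne_zero hz μ _
  have hinv : ContinuousOn (fun x : ℂ => (1 - (z - μ) * x)⁻¹) (spectrum ℂ A) :=
    ContinuousOn.inv₀ (by fun_prop) hne
  have hnormal : IsStarNormal A := hsa.isStarNormal
  have e1 : 1 - (z - μ) • A = cfc (fun x : ℂ => 1 - (z - μ) * x) A := by
    rw [cfc_sub (fun _ => 1) (fun x => (z - μ) * x) A, cfc_const_one ℂ A,
      cfc_const_mul (z - μ) (fun x => x) A, cfc_id' ℂ A]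
  have hg : ContinuousOn (fun x : ℂ => x * (1 - (z - μ) * x)⁻¹) (spectrum ℂ A) :=
    continuousOn_id.mul hinv
  have hR := hA.of_inverse (w := z) (U := cfc (fun x : ℂ => (1 - (z - μ) * x)⁻¹) A)
    (by
      rw [e1, ← cfc_mul _ _ A (by fun_prop) hinv, ← cfc_const_one ℂ A]
      exact cfc_congr fun x hx => mul_inv_cancel₀ (hne x hx))
    (by
      rw [e1, ← cfc_mul _ _ A hinv (by fun_prop), ← cfc_const_one ℂ A]
      exact cfc_congr fun x hx => inv_mul_cancel₀ (hne x hx))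
  have e2 : A * cfc (fun x : ℂ => (1 - (z - μ) * x)⁻¹) A =
      cfc (fun x : ℂ => x * (1 - (z - μ) * x)⁻¹) A := by
    rw [cfc_mul (fun x => x) _ A continuousOn_id hinv, cfc_id' ℂ A]
  -- The real calculus, from which the spectral measure is built, is compared with the complex one
  -- by evaluating at `x.re`. On the real spectrum this changes nothing.
  rw [hR.resolvent_eq, e2, cfc_real_eq_complex _ hsa, cfc_real_eq_complex _ hsa]
  have hc : ∀ L : ℂ → ℝ, Continuous L → ContinuousOn
      (fun x : ℂ => ((L ((x.re : ℂ) * (1 - (z - μ) * (x.re : ℂ))⁻¹) : ℝ) : ℂ)) (spectrum ℂ A) := by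
    intro L hL
    refine (Complex.continuous_ofReal.comp hL).comp_continuousOn
      (hg.congr fun x hx => ?_)
    rw [← hreal x hx]
  have hcI : ContinuousOn (fun x : ℂ => Complex.I *
      ((((x.re : ℂ) * (1 - (z - μ) * (x.re : ℂ))⁻¹).im : ℝ) : ℂ)) (spectrum ℂ A) :=
    continuousOn_const.mul (hc _ Complex.continuous_im)
  rw [← cfc_const_mul Complex.I _ A (hc _ Complex.continuous_im),
    ← cfc_add A _ _ (hc _ Complex.continuous_re) hcI]
  refine cfc_congr fun x hx => ?_
  rw [← hreal x hx, mul_comm Complex.I, Complex.re_add_im]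

/-- Under t = s⁻¹ + μ the point s = 0 stands for t = ∞ and carries no spectrum of T. This is why f
is required to vanish at 0 and to be the indicator only at nonzero s. -/
lemma IsResolventAt.isSpectralProjection_cfc {μ : ℝ} (hT : T.IsFormalAdjoint T)
    (hA : IsResolventAt T μ A) {Δ : Set ℝ} (hΔ : MeasurableSet Δ) {f : ℝ → ℝ}
    (hf : ContinuousOn f (spectrum ℝ A)) (hf0 : f 0 = 0)
    (hf1 : ∀ s ∈ spectrum ℝ A, s ≠ 0 → f s = Δ.indicator (fun _ => 1) (s⁻¹ + μ)) :
    IsSpectralProjection T Δ (cfc f A) := by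
  have hsa := hA.isSelfAdjoint hT
  refine ⟨⟨?_, cfc_predicate f A⟩, fun ψ => ?_⟩
  · rw [IsIdempotentElem, ← cfc_mul f f A hf hf]
    refine cfc_congr fun s hs => ?_
    by_cases h0 : s = 0
    · simp [h0, hf0]
    · rw [hf1 s hs h0]
      by_cases hΔ' : s⁻¹ + μ ∈ Δ <;> simp [hΔ']
  obtain ⟨ν, hν, hint⟩ := exists_spectralMeasure hsa ψ
  have hmeas : Measurable fun x : spectrum ℝ A => (x : ℝ)⁻¹ + μ :=
    measurable_subtype_coe.inv.add_const μ
  have hset : MeasurableSet {x : spectrum ℝ A | (x : ℝ) ≠ 0} :=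
    measurable_subtype_coe (measurableSet_singleton (0 : ℝ)).compl
  -- The spectral measure of T is the image of that of `A` with any mass at s = 0 discarded. The
  -- discarded mass is invisible to the resolvent integral, as (t - z)⁻¹ becomes s(1 - (z - μ)s)⁻¹,
  -- which vanishes at 0.
  refine ⟨(ν.restrict {x | (x : ℝ) ≠ 0}).map fun x : spectrum ℝ A => (x : ℝ)⁻¹ + μ, inferInstance,
    fun z hz => ?_, ?_⟩
  · set g : ℝ → ℂ := fun x => (x : ℂ) * (1 - (z - μ) * x)⁻¹ with hg
    have hgc : Continuous g :=
      Complex.continuous_ofReal.mul ((continuous_const.sub (continuous_const.mul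
        Complex.continuous_ofReal)).inv₀ (one_sub_mul_ofReal_ne_zero hz μ))
    have hgre : Continuous fun x => (g x).re := Complex.continuous_re.comp hgc
    have hgim : Continuous fun x => (g x).im := Complex.continuous_im.comp hgc
    rw [integral_map hmeas.aemeasurable (by
      apply Measurable.aestronglyMeasurable
      exact ((Complex.measurable_ofReal).sub_const z).inv)]
    have e1 : ∫ x : spectrum ℝ A in {x | (x : ℝ) ≠ 0}, ((((x : ℝ)⁻¹ + μ : ℝ) : ℂ) - z)⁻¹ ∂ν =
        ∫ x : spectrum ℝ A, g x ∂ν := by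
      rw [← setIntegral_eq_integral_of_forall_compl_eq_zero
        (s := {x : spectrum ℝ A | (x : ℝ) ≠ 0}) (f := fun x : spectrum ℝ A => g x)]
      · refine setIntegral_congr_fun hset fun x hx => ?_
        have hx' : ((x : ℝ) : ℂ) ≠ 0 := by exact_mod_cast hx
        simp only [hg]
        push_cast
        rw [← div_eq_mul_inv, inv_eq_one_div, div_eq_div_iff _ (one_sub_mul_ofReal_ne_zero hz μ _)]
        · field_simp; ring
        · intro h
          have := congrArg Complex.im h
          rw [← Complex.ofReal_inv] at this
          simp at this
          exact hz this
      · intro x hx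
        have : (x : ℝ) = 0 := not_not.1 hx
        simp [hg, this]
    rw [e1, hA.resolvent_eq_cfc hT hz]
    have hgi : Integrable (fun x : spectrum ℝ A => g x) ν :=
      (hgc.comp continuous_subtype_val).integrable_of_hasCompactSupport
        (HasCompactSupport.of_compactSpace _)
    rw [add_apply, smul_apply, inner_add_right, inner_smul_right, hint _ hgre.continuousOn,
      hint _ hgim.continuousOn, ← integral_re_add_im hgi]
    simp only [Complex.coe_algebraMap, RCLike.re_to_complex, RCLike.im_to_complex, RCLike.I_to_complex]
    rw [mul_comm]
  · rw [hint f hf]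
    congr 1
    rw [measureReal_def, Measure.map_apply hmeas hΔ, Measure.restrict_apply (hmeas hΔ),
      ← measureReal_def, ← integral_indicator_one ((hmeas hΔ).inter hset)]
    refine integral_congr_ae (Eventually.of_forall fun x => ?_)
    by_cases h0 : (x : ℝ) = 0
    · simp [h0, hf0]
    · refine (hf1 x x.2 h0).trans ?_
      by_cases hx : (x : ℝ)⁻¹ + μ ∈ Δ
      · have hx' : x ∈ (fun x : spectrum ℝ A => (x : ℝ)⁻¹ + μ) ⁻¹' Δ ∩ {x | (x : ℝ) ≠ 0} := ⟨hx, h0⟩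
        rw [Set.indicator_of_mem hx, Set.indicator_of_mem hx', Pi.one_apply]
      · have hx' : x ∉ (fun x : spectrum ℝ A => (x : ℝ)⁻¹ + μ) ⁻¹' Δ ∩ {x | (x : ℝ) ≠ 0} :=
          fun h => hx h.1
        rw [Set.indicator_of_notMem hx, Set.indicator_of_notMem hx']

/-- A trapezoidal function which is `1` on `[a, b]` and `0` outside `(a - δ, b + δ)`. -/
def trapezoid (a b δ t : ℝ) : ℝ := max 0 (1 - max 0 (max (a - t) (t - b)) / δ)

lemma continuous_trapezoid (a b δ : ℝ) : Continuous (trapezoid a b δ) := by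
  unfold trapezoid; fun_prop

lemma trapezoid_eq_one {a b δ t : ℝ} (ha : a ≤ t) (hb : t ≤ b) : trapezoid a b δ t = 1 := by
  have : max 0 (max (a - t) (t - b)) = 0 := by
    rw [max_eq_left]; exact max_le (by linarith) (by linarith)
  simp [trapezoid, this]

lemma trapezoid_eq_zero {a b δ t : ℝ} (hδ : 0 < δ) (h : t ≤ a - δ ∨ b + δ ≤ t) :
    trapezoid a b δ t = 0 := by
  have h1 : δ ≤ max 0 (max (a - t) (t - b)) := by
    rcases h with h | h
    · exact le_max_of_le_right (le_max_of_le_left (by linarith))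
    · exact le_max_of_le_right (le_max_of_le_right (by linarith))
  rw [trapezoid, max_eq_left]
  have := (one_le_div hδ).2 h1
  linarith

open Classical in
/-- The trapezoidal function in the variable `s = (t - μ)⁻¹`. -/
def resolventTrapezoid (a b δ μ s : ℝ) : ℝ := if s = 0 then 0 else trapezoid a b δ (s⁻¹ + μ)

/-- Only s = 0 needs care: small |s| makes |s⁻¹| so large that s⁻¹ + μ leaves the bounded support of
the trapezoid. -/
lemma continuous_resolventTrapezoid {a b δ : ℝ} (hδ : 0 < δ) (μ : ℝ) :
    Continuous (resolventTrapezoid a b δ μ) := by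
  rw [continuous_iff_continuousAt]
  intro s
  by_cases hs : s = 0
  · subst hs
    have hM : 0 < |μ| + |a| + |b| + δ := by positivity
    refine (continuousAt_const (y := (0 : ℝ))).congr ?_
    filter_upwards [Metric.ball_mem_nhds (0 : ℝ) (inv_pos.2 hM)] with t ht
    by_cases h0 : t = 0
    · simp [resolventTrapezoid, h0]
    rw [resolventTrapezoid, if_neg h0]
    refine (trapezoid_eq_zero hδ ?_).symm
    rw [mem_ball_zero_iff, Real.norm_eq_abs, lt_inv_comm₀ (abs_pos.2 h0) hM, ← abs_inv] at ht
    rcases lt_abs.1 ht with h | h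
    · right; linarith [neg_abs_le μ, le_abs_self b, abs_nonneg a]
    · left; linarith [le_abs_self μ, neg_abs_le a, abs_nonneg b]
  · have h1 : ContinuousAt (fun t : ℝ => trapezoid a b δ (t⁻¹ + μ)) s :=
      (continuous_trapezoid a b δ).continuousAt.comp
        ((continuousAt_inv₀ hs).add continuousAt_const)
    refine h1.congr ?_
    filter_upwards [isOpen_ne.mem_nhds hs] with t ht
    rw [resolventTrapezoid, if_neg ht]

/-- With no spectrum within δ of either endpoint, the sloping parts and the endpoints themselves
carry no spectrum. The trapezoid is then an exact indicator there, whichever endpoints belong to Δ.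
-/
lemma IsResolventAt.isSpectralProjection_resolventTrapezoid {μ : ℝ} (hT : T.IsFormalAdjoint T)
    (hA : IsResolventAt T μ A) {a b δ : ℝ} (hδ : 0 < δ)
    (hgap : ∀ t : ℝ, (t : ℂ) ∈ spec T → δ ≤ |t - a| ∧ δ ≤ |t - b|) {Δ : Set ℝ}
    (h₁ : Set.Ioo a b ⊆ Δ) (h₂ : Δ ⊆ Set.Icc a b) :
    IsSpectralProjection T Δ (cfc (resolventTrapezoid a b δ μ) A) := by
  have hΔ : MeasurableSet Δ := by
    have : Δ = Set.Ioo a b ∪ (Δ ∩ {a, b}) := by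
      ext t
      constructor
      · intro ht
        have := h₂ ht
        by_cases ha : t = a
        · exact Or.inr ⟨ht, Or.inl ha⟩
        by_cases hb : t = b
        · exact Or.inr ⟨ht, Or.inr hb⟩
        exact Or.inl ⟨lt_of_le_of_ne this.1 (Ne.symm ha), lt_of_le_of_ne this.2 hb⟩
      · rintro (ht | ht)
        · exact h₁ ht
        · exact ht.1
    rw [this]
    exact measurableSet_Ioo.union ((Set.toFinite _).subset Set.inter_subset_right).measurableSet
  refine hA.isSpectralProjection_cfc hT hΔ (continuous_resolventTrapezoid hδ μ).continuousOn
    (by simp [resolventTrapezoid]) fun s hs h0 => ?_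
  rw [resolventTrapezoid, if_neg h0]
  have hspec : ((s⁻¹ + μ : ℝ) : ℂ) ∈ spec T := by
    have h1 : (s : ℂ) ∈ spectrum ℂ A := (spectrum.algebraMap_mem_iff ℂ).2 hs
    rw [hA.inv_mem_spectrum_iff (by exact_mod_cast h0)] at h1
    push_cast; exact h1
  obtain ⟨g1, g2⟩ := hgap _ hspec
  by_cases ht : s⁻¹ + μ ∈ Δ
  · rw [Set.indicator_of_mem ht, trapezoid_eq_one (h₂ ht).1 (h₂ ht).2]
  · rw [Set.indicator_of_notMem ht, trapezoid_eq_zero hδ]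
    by_contra! hcon
    refine ht (h₁ ⟨?_, ?_⟩)
    · rcases le_abs.1 g1 with h | h <;> linarith
    · rcases le_abs.1 g2 with h | h <;> linarith

/-- Norm continuity of the functional calculus for one fixed continuous function. Eventually the
norms are below ‖A‖ + 1, so all spectra lie in a common compact ball. -/
lemma tendsto_cfc_resolventTrapezoid {ι : Type*} {l : Filter ι} {R : ι → H →L[ℂ] H}
    (hR : Tendsto R l (𝓝 A)) (hsa : IsSelfAdjoint A) (hRsa : ∀ᶠ i in l, IsSelfAdjoint (R i))
    {a b δ : ℝ} (hδ : 0 < δ) (μ : ℝ) :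
    Tendsto (fun i => cfc (resolventTrapezoid a b δ μ) (R i)) l
      (𝓝 (cfc (resolventTrapezoid a b δ μ) A)) := by
  have hsub : ∀ S : H →L[ℂ] H, ‖S‖ ≤ ‖A‖ + 1 → spectrum ℝ S ⊆
      Metric.closedBall 0 ((‖A‖ + 1) * ‖(1 : H →L[ℂ] H)‖) := fun S hS =>
    (spectrum.subset_closedBall_norm_mul S).trans
      (Metric.closedBall_subset_closedBall (by gcongr))
  refine Filter.Tendsto.cfc (isCompact_closedBall 0 ((‖A‖ + 1) * ‖(1 : H →L[ℂ] H)‖)) _ hR ?_ hRsa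
    (hsub A (by linarith)) hsa (continuous_resolventTrapezoid hδ μ).continuousOn
  filter_upwards [hR.norm.eventually (gt_mem_nhds (lt_add_one ‖A‖))] with i hi
  exact hsub _ hi.le

end SpectralProjections


/-! ### Multiplication operators -/

section Multiplication

variable {v : ℝ × ℝ → ℂ} {M : ℝ}

lemma mem_mulOp_domain (hv : AEStronglyMeasurable v volume) (hM : ∀ p, ‖v p‖ ≤ M) (ψ : L2) :
    ψ ∈ (mulOp v).domain := by
  change MemLp (fun p => v p * ψ p) 2 volume
  refine MemLp.of_le_mul (Lp.memLp ψ) (hv.mul (Lp.aestronglyMeasurable ψ))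
    (c := M) (Eventually.of_forall fun p => ?_)
  rw [norm_mul]
  exact mul_le_mul_of_nonneg_right (hM p) (norm_nonneg _)

/-- Multiplication by a bounded function, as a bounded operator. -/
def mulCLM (v : ℝ × ℝ → ℂ) (M : ℝ) (hv : AEStronglyMeasurable v volume) (hM : ∀ p, ‖v p‖ ≤ M) :
    L2 →L[ℂ] L2 :=
  LinearMap.mkContinuous
    { toFun := fun ψ => mulOp v ⟨ψ, mem_mulOp_domain hv hM ψ⟩
      map_add' := fun ψ χ => (mulOp v).map_add ⟨ψ, mem_mulOp_domain hv hM ψ⟩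
        ⟨χ, mem_mulOp_domain hv hM χ⟩
      map_smul' := fun c ψ => (mulOp v).map_smul c ⟨ψ, mem_mulOp_domain hv hM ψ⟩ } M
    fun ψ => by
      refine Lp.norm_le_mul_norm_of_ae_le_mul ?_
      filter_upwards [MemLp.coeFn_toLp (mem_mulOp_domain hv hM ψ)] with p hp
      change ‖(MemLp.toLp (fun p => v p * ψ p) (mem_mulOp_domain hv hM ψ)) p‖ ≤ M * ‖ψ p‖
      rw [hp, norm_mul]
      exact mul_le_mul_of_nonneg_right (hM p) (norm_nonneg _)

variable (hv : AEStronglyMeasurable v volume) (hM : ∀ p, ‖v p‖ ≤ M)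

lemma mulCLM_ae (ψ : L2) : mulCLM v M hv hM ψ =ᵐ[volume] fun p => v p * ψ p :=
  MemLp.coeFn_toLp (mem_mulOp_domain hv hM ψ)

lemma norm_mulCLM_le : ‖mulCLM v M hv hM‖ ≤ M :=
  LinearMap.mkContinuous_norm_le _ ((norm_nonneg _).trans (hM 0)) _

lemma isSymmetric_mulCLM (hreal : ∀ p, (v p).im = 0) :
    (mulCLM v M hv hM : L2 →ₗ[ℂ] L2).IsSymmetric := by
  intro ψ χ
  change inner ℂ (mulCLM v M hv hM ψ) χ = inner ℂ ψ (mulCLM v M hv hM χ)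
  rw [L2.inner_def, L2.inner_def]
  refine integral_congr_ae ?_
  filter_upwards [mulCLM_ae hv hM ψ, mulCLM_ae hv hM χ] with p h1 h2
  rw [h1, h2, ← smul_eq_mul, ← smul_eq_mul, inner_smul_left, inner_smul_right,
    Complex.conj_eq_iff_im.2 (hreal p)]

/-- A bounded multiplier is defined everywhere, so the domain intersection in the sum of partial
operators is the domain of T. -/
lemma add_mulOp (T : L2 →ₗ.[ℂ] L2) :
    T + mulOp v = (mulCLM v M hv hM : L2 →ₗ[ℂ] L2) +ᵥ T := by
  refine LinearPMap.ext ?_ ?_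
  · rw [LinearPMap.add_domain, LinearPMap.vadd_domain]
    exact inf_eq_left.2 fun ψ _ => mem_mulOp_domain hv hM ψ
  · intro ψ h1 h2
    exact add_comm _ _

lemma mulCLM_mul_mulCLM {w u : ℝ × ℝ → ℂ} {N K : ℝ} (hw : AEStronglyMeasurable w volume)
    (hN : ∀ p, ‖w p‖ ≤ N) (hu : AEStronglyMeasurable u volume) (hK : ∀ p, ‖u p‖ ≤ K)
    (h : ∀ p, v p * w p = u p) :
    mulCLM v M hv hM * mulCLM w N hw hN = mulCLM u K hu hK := by
  ext1 ψ
  refine Lp.ext ?_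
  filter_upwards [mulCLM_ae hu hK ψ, mulCLM_ae hw hN ψ,
    mulCLM_ae hv hM (mulCLM w N hw hN ψ)] with p h1 h2 h3
  change mulCLM v M hv hM (mulCLM w N hw hN ψ) p = _
  rw [h3, h2, h1, ← mul_assoc, h]

lemma mulCLM_sub_mulCLM {w u : ℝ × ℝ → ℂ} {N K : ℝ} (hw : AEStronglyMeasurable w volume)
    (hN : ∀ p, ‖w p‖ ≤ N) (hu : AEStronglyMeasurable u volume) (hK : ∀ p, ‖u p‖ ≤ K)
    (h : ∀ p, v p - w p = u p) :
    mulCLM v M hv hM - mulCLM w N hw hN = mulCLM u K hu hK := by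
  ext1 ψ
  refine Lp.ext ?_
  rw [sub_apply]
  filter_upwards [mulCLM_ae hu hK ψ, mulCLM_ae hw hN ψ, mulCLM_ae hv hM ψ,
    Lp.coeFn_sub (mulCLM v M hv hM ψ) (mulCLM w N hw hN ψ)] with p h1 h2 h3 h4
  rw [h4, Pi.sub_apply, h3, h2, h1, ← sub_mul, h]

end Multiplication

/-! ### The cutoff field -/

/-- A function on the plane which tends to zero uniformly at infinity. -/
def VanishesAtInfinity (v : ℝ × ℝ → ℂ) : Prop := ∀ δ > 0, ∃ r, ∀ p : ℝ × ℝ, r < ‖p‖ → ‖v p‖ ≤ δ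

lemma sinh_le_mul_cosh {s : ℝ} (hs : 0 ≤ s) : Real.sinh s ≤ s * Real.cosh s := by
  have hm : MonotoneOn (fun s => s * Real.cosh s - Real.sinh s) (Set.Ici 0) := by
    refine monotoneOn_of_deriv_nonneg (convex_Ici 0)
      (by fun_prop) (by fun_prop) fun x hx => ?_
    have h : HasDerivAt (fun s => s * Real.cosh s - Real.sinh s)
        (1 * Real.cosh x + x * Real.sinh x - Real.cosh x) x :=
      ((hasDerivAt_id x).mul (Real.hasDerivAt_cosh x)).sub (Real.hasDerivAt_sinh x)
    rw [h.deriv]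
    rw [interior_Ici] at hx
    have := Real.sinh_nonneg_iff.2 (le_of_lt hx)
    have hx' : (0 : ℝ) < x := hx
    nlinarith
  have := hm (Set.mem_Ici.2 le_rfl) (Set.mem_Ici.2 hs) hs
  simp at this
  linarith

/-- Monotonicity of sinh t / t with denominators cleared. -/
lemma mul_sinh_le_mul_sinh {s t : ℝ} (hs : 0 ≤ s) (hst : s ≤ t) :
    t * Real.sinh s ≤ s * Real.sinh t := by
  have hm : MonotoneOn (fun t => s * Real.sinh t - t * Real.sinh s) (Set.Ici s) := by
    refine monotoneOn_of_deriv_nonneg (convex_Ici s)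
      (by fun_prop) (by fun_prop) fun x hx => ?_
    have h : HasDerivAt (fun t => s * Real.sinh t - t * Real.sinh s)
        (s * Real.cosh x - 1 * Real.sinh s) x :=
      ((Real.hasDerivAt_sinh x).const_mul s).sub ((hasDerivAt_id x).mul_const _)
    rw [h.deriv]
    rw [interior_Ici] at hx
    have h1 : Real.cosh s ≤ Real.cosh x := by
      rw [Real.cosh_le_cosh, abs_of_nonneg hs, abs_of_nonneg (hs.trans (le_of_lt hx))]
      exact le_of_lt hx
    have h2 := sinh_le_mul_cosh hs
    nlinarith
  have := hm (Set.mem_Ici.2 le_rfl) (Set.mem_Ici.2 hst) hst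
  simp only at this
  linarith

/-- For t ≤ s, sinh s ≤ cosh s suffices; for t ≥ s, monotonicity of sinh t / t transfers the
estimate to sinh t ≤ cosh t. With t = 2γ|x| and s = 2γX this is the bound on x times the cutoff. -/
lemma mul_sinh_le (s t : ℝ) (hs : 0 ≤ s) :
    t * Real.sinh s ≤ s * (Real.cosh t + Real.cosh s) := by
  rcases le_total t s with h | h
  · have h1 : Real.sinh s ≤ Real.cosh s := (Real.sinh_lt_cosh s).le
    have h2 := Real.sinh_nonneg_iff.2 hs
    have h3 := Real.cosh_pos t
    nlinarith
  · have h1 : Real.sinh t ≤ Real.cosh t := (Real.sinh_lt_cosh t).le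
    have h2 := mul_sinh_le_mul_sinh hs h
    have h3 := Real.cosh_pos s
    nlinarith

lemma sq_le_two_mul_cosh (t : ℝ) : t ^ 2 ≤ 2 * Real.cosh t := by
  have h := Real.cosh_sq (t / 2)
  have h2 : Real.cosh t = 1 + 2 * Real.sinh (t / 2) ^ 2 := by
    have := Real.cosh_two_mul (t / 2)
    rw [mul_div_cancel₀ t two_ne_zero] at this
    linarith
  have h3 : (t / 2) ^ 2 ≤ Real.sinh (t / 2) ^ 2 := by
    rw [sq_le_sq, Real.abs_sinh]
    exact Real.self_le_sinh_iff.2 (abs_nonneg _)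
  nlinarith

/-- Addition formulas put the cutoff in a form where its positivity and exponential decay are
explicit. -/
lemma tanh_sub_tanh (γ X x : ℝ) :
    (1 / 2) * (Real.tanh (γ * (x + X)) - Real.tanh (γ * (x - X))) =
      Real.sinh (2 * γ * X) / (Real.cosh (2 * γ * x) + Real.cosh (2 * γ * X)) := by
  have h1 := Real.cosh_pos (γ * (x + X))
  have h2 := Real.cosh_pos (γ * (x - X))
  have e1 : Real.sinh (2 * γ * X) = Real.sinh (γ * (x + X)) * Real.cosh (γ * (x - X)) -
      Real.cosh (γ * (x + X)) * Real.sinh (γ * (x - X)) := by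
    rw [← Real.sinh_sub]; ring_nf
  have e2 : Real.cosh (2 * γ * x) + Real.cosh (2 * γ * X) =
      2 * (Real.cosh (γ * (x + X)) * Real.cosh (γ * (x - X))) := by
    rw [show 2 * γ * x = γ * (x + X) + γ * (x - X) by ring,
      show 2 * γ * X = γ * (x + X) - γ * (x - X) by ring, Real.cosh_add, Real.cosh_sub]
    ring
  rw [Real.tanh_eq_sinh_div_cosh, Real.tanh_eq_sinh_div_cosh, e1, e2]
  field_simp

lemma abs_mul_cutoff_le {ε γ₀ C F : ℝ} (hγ₀ : 0 < γ₀) (hC : 0 < C) (hF : 0 < F) (x : ℝ) :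
    |x * cutoff ε γ₀ C F x| ≤ C / F ^ (1 - ε) := by
  have hG : 0 < F ^ (1 - ε) := Real.rpow_pos_of_pos hF _
  rw [cutoff, tanh_sub_tanh]
  set γ := γ₀ / F ^ (1 - ε)
  set X := C / F ^ (1 - ε)
  have hγ : 0 < γ := div_pos hγ₀ hG
  have hX : 0 < X := div_pos hC hG
  have hs : 0 ≤ Real.sinh (2 * γ * X) := Real.sinh_nonneg_iff.2 (by positivity)
  have hd : 0 < Real.cosh (2 * γ * x) + Real.cosh (2 * γ * X) :=
    add_pos (Real.cosh_pos _) (Real.cosh_pos _)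
  rw [abs_mul, abs_of_nonneg (div_nonneg hs hd.le), ← mul_div_assoc, div_le_iff₀ hd]
  have h := mul_sinh_le (2 * γ * X) |2 * γ * x| (by positivity)
  rw [Real.cosh_abs, abs_mul, abs_of_pos (by positivity : 0 < 2 * γ)] at h
  have h2 : 0 < 2 * γ := by positivity
  refine le_of_mul_le_mul_left ?_ h2
  linarith

/-- The denominator cosh(2γx) dominates x², one power more than boundedness of x h_F needs. The
spare power gives decay at infinity for fixed F. -/
lemma exists_sq_mul_cutoff_le {ε γ₀ C F : ℝ} (hγ₀ : 0 < γ₀) (hC : 0 < C) (hF : 0 < F) :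
    ∃ K, ∀ x, |x| * |x * cutoff ε γ₀ C F x| ≤ K := by
  have hG : 0 < F ^ (1 - ε) := Real.rpow_pos_of_pos hF _
  set γ := γ₀ / F ^ (1 - ε) with hγdef
  set X := C / F ^ (1 - ε) with hXdef
  have hγ : 0 < γ := div_pos hγ₀ hG
  have hX : 0 < X := div_pos hC hG
  refine ⟨2 * Real.sinh (2 * γ * X) / (2 * γ) ^ 2, fun x => ?_⟩
  rw [cutoff, tanh_sub_tanh, ← hγdef, ← hXdef]
  have hs : 0 ≤ Real.sinh (2 * γ * X) := Real.sinh_nonneg_iff.2 (by positivity)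
  have hd : 0 < Real.cosh (2 * γ * x) + Real.cosh (2 * γ * X) :=
    add_pos (Real.cosh_pos _) (Real.cosh_pos _)
  rw [abs_mul, abs_of_nonneg (div_nonneg hs hd.le), ← mul_assoc, ← sq, sq_abs, ← mul_div_assoc,
    div_le_div_iff₀ hd (by positivity)]
  have h := sq_le_two_mul_cosh (2 * γ * x)
  have h3 := Real.cosh_pos (2 * γ * X)
  have : (2 * γ * x) ^ 2 * Real.sinh (2 * γ * X) ≤
      2 * (Real.cosh (2 * γ * x) + Real.cosh (2 * γ * X)) * Real.sinh (2 * γ * X) :=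
    mul_le_mul_of_nonneg_right (by linarith) hs
  nlinarith

/-! ### Size and decay of the field term -/

section LocalField

variable {ε γ₀ C a₁ τ F : ℝ}

lemma measurable_cutoff : Measurable (cutoff ε γ₀ C F) := by
  have : Measurable Real.tanh := by
    have h : Real.tanh = fun x => Real.sinh x / Real.cosh x :=
      funext Real.tanh_eq_sinh_div_cosh
    rw [h]
    exact Real.measurable_sinh.div Real.measurable_cosh
  unfold cutoff
  exact ((this.comp (by fun_prop)).sub (this.comp (by fun_prop))).const_mul _

lemma measurable_localField : Measurable (localField ε γ₀ C a₁ τ F) := by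
  unfold localField
  refine ((measurable_const.mul measurable_fst).mul (measurable_cutoff.comp measurable_fst)).mul ?_
  exact (measurable_const.indicator measurableSet_Icc).comp measurable_snd

lemma abs_localField_le_mul (p : ℝ × ℝ) (hF : 0 < F) :
    |localField ε γ₀ C a₁ τ F p| ≤ F * |p.1 * cutoff ε γ₀ C F p.1| := by
  rw [localField]
  rw [show -F * p.1 * cutoff ε γ₀ C F p.1 = -F * (p.1 * cutoff ε γ₀ C F p.1) by ring, abs_mul,
    abs_mul, abs_neg, abs_of_pos hF]
  refine mul_le_of_le_one_right (by positivity) ?_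
  by_cases h : p.2 ∈ Set.Icc (-yBar a₁ τ F) (yBar a₁ τ F) <;> simp [h]

/-- The factor F against x̄ = C F^(-(1-ε)) leaves C F^ε; this is the small parameter of the whole
argument. -/
lemma norm_localField_le (hγ₀ : 0 < γ₀) (hC : 0 < C) (hF : 0 < F) (p : ℝ × ℝ) :
    ‖(localField ε γ₀ C a₁ τ F p : ℂ)‖ ≤ C * F ^ ε := by
  rw [Complex.norm_real, Real.norm_eq_abs]
  refine (abs_localField_le_mul p hF).trans ?_
  refine (mul_le_mul_of_nonneg_left (abs_mul_cutoff_le hγ₀ hC hF p.1) hF.le).trans_eq ?_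
  have : F ^ ε = F / F ^ (1 - ε) := by
    rw [show ε = 1 - (1 - ε) by ring, Real.rpow_sub hF, Real.rpow_one]; ring_nf
  rw [this]; ring

/-- In the sup norm, a distant point either lies outside the strip, where the term is zero, or has
|x| = ‖p‖, where the bound on x² h_F applies. -/
lemma vanishesAtInfinity_localField (hγ₀ : 0 < γ₀) (hC : 0 < C) (hF : 0 < F) :
    VanishesAtInfinity fun p => (localField ε γ₀ C a₁ τ F p : ℂ) := by
  intro δ hδ
  obtain ⟨K, hK⟩ := exists_sq_mul_cutoff_le (ε := ε) hγ₀ hC hF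
  refine ⟨max (max (yBar a₁ τ F) (F * K / δ)) 0, fun p hp => ?_⟩
  have hy : yBar a₁ τ F < ‖p‖ := ((le_max_left _ _).trans (le_max_left _ _)).trans_lt hp
  have hx : F * K / δ < ‖p‖ := ((le_max_right _ _).trans (le_max_left _ _)).trans_lt hp
  have hp0 : 0 < ‖p‖ := (le_max_right _ _).trans_lt hp
  rw [Complex.norm_real, Real.norm_eq_abs]
  by_cases h : p.2 ∈ Set.Icc (-yBar a₁ τ F) (yBar a₁ τ F)
  · have hp1 : ‖p‖ = |p.1| := by
      have h2 : |p.2| ≤ yBar a₁ τ F := abs_le.2 h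
      rw [Prod.norm_def, Real.norm_eq_abs, Real.norm_eq_abs] at hy ⊢
      rcases max_cases |p.1| |p.2| with h3 | h3 <;> linarith
    rw [hp1] at hx hp0
    refine (abs_localField_le_mul p hF).trans ?_
    rw [div_lt_iff₀ hδ] at hx
    refine le_of_mul_le_mul_left ?_ hp0
    have := mul_le_mul_of_nonneg_left (hK p.1) hF.le
    linarith
  · rw [localField, Set.indicator_of_notMem h, mul_zero, abs_zero]
    exact hδ.le

end LocalField

/-! ### The impurity potential -/

lemma IsGaussianLocalised.exists_bound {β a₀ a₁ : ℝ} {V : ℂ → ℝ → ℂ}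
    (h : IsGaussianLocalised β a₀ a₁ V) :
    (∃ M, ∀ p : ℝ × ℝ, ‖V p.1 p.2‖ ≤ M) ∧ VanishesAtInfinity fun p => V p.1 p.2 := by
  obtain ⟨β₀, V₀, ν, hβ₀, -, hν, h⟩ := h
  have h0 : ∀ x y : ℝ, (x ∈ Set.Icc (-a₀) a₀ → y ∈ Set.Icc (-a₁) a₁ → ‖V x y‖ ≤ V₀) ∧
      (x ∉ Set.Icc (-a₀) a₀ → ‖V x y‖ ≤ V₀ * Real.exp (-ν * x ^ 2)) ∧
      (y ∉ Set.Icc (-a₁) a₁ → V x y = 0) := by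
    intro x y
    have := h 0 (by simpa using hβ₀.le) x y
    simpa using this
  -- The sign of V₀ is not part of `IsGaussianLocalised`, so |V₀| serves as the uniform constant.
  have hout : ∀ x y : ℝ, x ∉ Set.Icc (-a₀) a₀ → ‖V x y‖ ≤ |V₀| * Real.exp (-ν * x ^ 2) :=
    fun x y hx => ((h0 x y).2.1 hx).trans
      (mul_le_mul_of_nonneg_right (le_abs_self _) (Real.exp_pos _).le)
  refine ⟨⟨|V₀|, fun p => ?_⟩, fun δ hδ => ?_⟩
  · by_cases hx : p.1 ∈ Set.Icc (-a₀) a₀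
    · by_cases hy : p.2 ∈ Set.Icc (-a₁) a₁
      · exact ((h0 _ _).1 hx hy).trans (le_abs_self _)
      · rw [(h0 _ _).2.2 hy, norm_zero]; exact abs_nonneg _
    · refine (hout _ _ hx).trans (mul_le_of_le_one_right (abs_nonneg _) ?_)
      rw [Real.exp_le_one_iff]
      nlinarith [sq_nonneg p.1]
  · have ht : Tendsto (fun x : ℝ => |V₀| * Real.exp (-ν * x ^ 2)) atTop (𝓝 0) := by
      have h1 : Tendsto (fun x : ℝ => ν * x ^ 2) atTop atTop :=
        (tendsto_pow_atTop two_ne_zero).const_mul_atTop hν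
      have h2 := (Real.tendsto_exp_neg_atTop_nhds_zero.comp h1).const_mul |V₀|
      rw [mul_zero] at h2
      refine h2.congr fun x => ?_
      simp [Function.comp_apply]
    obtain ⟨r, hr⟩ := eventually_atTop.1 (ht.eventually (gt_mem_nhds hδ))
    refine ⟨max (max a₁ a₀) r, fun p hp => ?_⟩
    have h1 : a₁ < ‖p‖ := ((le_max_left _ _).trans (le_max_left _ _)).trans_lt hp
    have h2 : a₀ < ‖p‖ := ((le_max_right _ _).trans (le_max_left _ _)).trans_lt hp
    have h3 : r < ‖p‖ := (le_max_right _ _).trans_lt hp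
    by_cases hy : p.2 ∈ Set.Icc (-a₁) a₁
    · have hp1 : ‖p‖ = |p.1| := by
        have h4 : |p.2| ≤ a₁ := abs_le.2 hy
        rw [Prod.norm_def, Real.norm_eq_abs, Real.norm_eq_abs] at h1 ⊢
        rcases max_cases |p.1| |p.2| with h3 | h3 <;> linarith
      rw [hp1] at h2 h3
      have hx : p.1 ∉ Set.Icc (-a₀) a₀ := fun hx => absurd (abs_le.2 hx) (not_le.2 h2)
      refine (hout _ _ hx).trans ?_
      have := hr |p.1| h3.le
      rw [sq_abs] at this
      exact this.le
    · simp only [(h0 p.1 p.2).2.2 hy, norm_zero]; exact hδ.le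


/-! ### Ladder operators on polynomials in `ζ̄` and `ζ` -/

section Ladder

set_option linter.unusedSimpArgs false

open MvPolynomial

/-- Polynomials in the two variables `X 0 = ζ̄`, `X 1 = ζ`. -/
abbrev Pol : Type := MvPolynomial (Fin 2) ℂ

/-- The action of `-i ∂ₓ + B y` on polynomials times the ground state. -/
def polPiX (B : ℝ) (P : Pol) : Pol :=
  -(C Complex.I * (pderiv 0 P + pderiv 1 P)) + C Complex.I * C (B / 2 : ℂ) * X 0 * P

/-- The action of `-i ∂_y` on polynomials times the ground state. -/
def polPiY (B : ℝ) (P : Pol) : Pol :=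
  -pderiv 0 P + pderiv 1 P - C (B / 2 : ℂ) * X 0 * P

/-- The action of `-i ∂ₓ` on polynomials times the ground state. -/
def polKX (B : ℝ) (P : Pol) : Pol :=
  -(C Complex.I * (pderiv 0 P + pderiv 1 P)) + C Complex.I * C (B / 2 : ℂ) * X 1 * P

/-- The action of `-i ∂_y + B x` on polynomials times the ground state. -/
def polKY (B : ℝ) (P : Pol) : Pol :=
  -pderiv 0 P + pderiv 1 P + C (B / 2 : ℂ) * X 1 * P

/-- The creation operator of the Landau level. -/
def raise₀ (B : ℝ) (P : Pol) : Pol :=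
  2 * C Complex.I * C (B / 2 : ℂ) * X 0 * P - 2 * C Complex.I * pderiv 1 P

/-- The creation operator of the guiding centre. -/
def raise₁ (B : ℝ) (P : Pol) : Pol :=
  2 * C Complex.I * C (B / 2 : ℂ) * X 1 * P - 2 * C Complex.I * pderiv 0 P

/-- The action of the Landau Hamiltonian. -/
def polH (B : ℝ) (P : Pol) : Pol := polPiX B (polPiX B P) + polPiY B (polPiY B P)

/-- The action of the guiding centre Hamiltonian. -/
def polK (B : ℝ) (P : Pol) : Pol := polKX B (polKX B P) + polKY B (polKY B P)

lemma C_I_mul_C_I : (C Complex.I : Pol) * C Complex.I = -1 := by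
  rw [← C_mul, Complex.I_mul_I, C_neg, C_1]

lemma pderiv_one_pderiv_zero (P : Pol) : pderiv 1 (pderiv 0 P) = pderiv 0 (pderiv 1 P) := by
  induction P using MvPolynomial.induction_on with
  | C a => simp
  | add p q hp hq => simp [hp, hq]
  | mul_X p i hp =>
    fin_cases i <;> simp [pderiv_mul, pderiv_X, hp, Pi.single_apply]
    all_goals ring

lemma pderiv_zero_X_zero : pderiv 0 (X 0 : Pol) = 1 := pderiv_X_self 0
lemma pderiv_one_X_one : pderiv 1 (X 1 : Pol) = 1 := pderiv_X_self 1
lemma pderiv_zero_X_one : pderiv 0 (X 1 : Pol) = 0 := pderiv_X_of_ne (by decide)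
lemma pderiv_one_X_zero : pderiv 1 (X 0 : Pol) = 0 := pderiv_X_of_ne (by decide)

lemma pderiv_two (i : Fin 2) : pderiv i (2 : Pol) = 0 := by
  rw [show (2 : Pol) = C 2 from rfl, pderiv_C]

lemma pderiv_four (i : Fin 2) : pderiv i (4 : Pol) = 0 := by
  rw [show (4 : Pol) = C 4 from (map_ofNat C 4).symm, pderiv_C]

/-- The pure second derivatives and the quadratic terms cancel between the two squares. In this
normal form the commutation relations become polynomial identities; the guiding centre version
exchanges the two variables. -/
lemma polH_eq (B : ℝ) (P : Pol) : polH B P = 4 * C (B / 2 : ℂ) * X 0 * pderiv 0 P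
    - 4 * pderiv 0 (pderiv 1 P) + 2 * C (B / 2 : ℂ) * P := by
  simp only [polH, polPiX, polPiY, map_add, map_sub, map_neg, pderiv_mul, pderiv_C,
    pderiv_zero_X_zero, pderiv_one_X_one, pderiv_zero_X_one, pderiv_one_X_zero,
    pderiv_one_pderiv_zero]
  linear_combination (pderiv 0 (pderiv 0 P) + 2 * pderiv 0 (pderiv 1 P) + pderiv 1 (pderiv 1 P)
    - C (B / 2 : ℂ) * P - 2 * C (B / 2 : ℂ) * X 0 * pderiv 0 P
    - 2 * C (B / 2 : ℂ) * X 0 * pderiv 1 P + (C (B / 2 : ℂ)) ^ 2 * X 0 ^ 2 * P) * C_I_mul_C_I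

lemma polK_eq (B : ℝ) (P : Pol) : polK B P = 4 * C (B / 2 : ℂ) * X 1 * pderiv 1 P
    - 4 * pderiv 0 (pderiv 1 P) + 2 * C (B / 2 : ℂ) * P := by
  simp only [polK, polKX, polKY, map_add, map_neg, pderiv_mul, pderiv_C,
    pderiv_zero_X_zero, pderiv_one_X_one, pderiv_zero_X_one, pderiv_one_X_zero,
    pderiv_one_pderiv_zero]
  linear_combination (pderiv 0 (pderiv 0 P) + 2 * pderiv 0 (pderiv 1 P) + pderiv 1 (pderiv 1 P)
    - C (B / 2 : ℂ) * P - 2 * C (B / 2 : ℂ) * X 1 * pderiv 0 P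
    - 2 * C (B / 2 : ℂ) * X 1 * pderiv 1 P + (C (B / 2 : ℂ)) ^ 2 * X 1 ^ 2 * P) * C_I_mul_C_I

/-- The added coefficient 4(B/2) = 2B is the spacing of the Landau levels. -/
lemma polH_raise₀ (B : ℝ) (P : Pol) :
    polH B (raise₀ B P) = raise₀ B (polH B P) + 4 * C (B / 2 : ℂ) * raise₀ B P := by
  simp only [polH_eq, raise₀, map_add, map_sub, pderiv_mul, pderiv_C, pderiv_two, pderiv_four,
    pderiv_zero_X_zero, pderiv_one_X_one, pderiv_zero_X_one, pderiv_one_X_zero,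
    pderiv_one_pderiv_zero, map_zero, pderiv_one]
  ring

/-- The guiding centre ladder moves inside a Landau level, which is the source of its infinite
degeneracy. -/
lemma polH_raise₁ (B : ℝ) (P : Pol) : polH B (raise₁ B P) = raise₁ B (polH B P) := by
  simp only [polH_eq, raise₁, map_add, map_sub, pderiv_mul, pderiv_C, pderiv_two, pderiv_four,
    pderiv_zero_X_zero, pderiv_one_X_one, pderiv_zero_X_one, pderiv_one_X_zero,
    pderiv_one_pderiv_zero, map_zero, pderiv_one]
  ring

lemma polK_raise₁ (B : ℝ) (P : Pol) :
    polK B (raise₁ B P) = raise₁ B (polK B P) + 4 * C (B / 2 : ℂ) * raise₁ B P := by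
  simp only [polK_eq, raise₁, map_add, map_sub, pderiv_mul, pderiv_C, pderiv_two, pderiv_four,
    pderiv_zero_X_zero, pderiv_one_X_one, pderiv_zero_X_one, pderiv_one_X_zero,
    pderiv_one_pderiv_zero, map_zero, pderiv_one]
  ring

lemma polK_raise₀ (B : ℝ) (P : Pol) : polK B (raise₀ B P) = raise₀ B (polK B P) := by
  simp only [polK_eq, raise₀, map_add, map_sub, pderiv_mul, pderiv_C, pderiv_two, pderiv_four,
    pderiv_zero_X_zero, pderiv_one_X_one, pderiv_zero_X_one, pderiv_one_X_zero,
    pderiv_one_pderiv_zero, map_zero, pderiv_one]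
  ring

/-- The annihilation operator of the Landau level in terms of `polPiX` and `polPiY`. -/
lemma polPiX_add_polPiY_raise₀ (B : ℝ) (P : Pol) :
    polPiX B (raise₀ B P) + C Complex.I * polPiY B (raise₀ B P) =
      polH B P + 2 * C (B / 2 : ℂ) * P := by
  simp only [polH_eq, polPiX, polPiY, raise₀, map_sub, pderiv_mul, pderiv_C, pderiv_two,
    pderiv_zero_X_zero, pderiv_one_X_one, pderiv_zero_X_one, pderiv_one_X_zero,
    pderiv_one_pderiv_zero]
  linear_combination (-4 * C (B / 2 : ℂ) * P - 4 * C (B / 2 : ℂ) * X 0 * pderiv 0 P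
    + 4 * pderiv 0 (pderiv 1 P)) * C_I_mul_C_I

/-- The annihilation operator of the guiding centre in terms of `polKX` and `polKY`. -/
lemma polKX_sub_polKY_raise₁ (B : ℝ) (P : Pol) :
    polKX B (raise₁ B P) - C Complex.I * polKY B (raise₁ B P) =
      polK B P + 2 * C (B / 2 : ℂ) * P := by
  simp only [polK_eq, polKX, polKY, raise₁, map_sub, pderiv_mul, pderiv_C, pderiv_two,
    pderiv_zero_X_zero, pderiv_one_X_one, pderiv_zero_X_one, pderiv_one_X_zero,
    pderiv_one_pderiv_zero]
  linear_combination (-4 * C (B / 2 : ℂ) * P - 4 * C (B / 2 : ℂ) * X 1 * pderiv 1 P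
    + 4 * pderiv 0 (pderiv 1 P)) * C_I_mul_C_I

lemma raise₀_C_mul (B : ℝ) (c : ℂ) (P : Pol) : raise₀ B (C c * P) = C c * raise₀ B P := by
  simp only [raise₀, pderiv_mul, pderiv_C]; ring

lemma raise₁_C_mul (B : ℝ) (c : ℂ) (P : Pol) : raise₁ B (C c * P) = C c * raise₁ B P := by
  simp only [raise₁, pderiv_mul, pderiv_C]; ring

/-- The joint eigenvector for Landau level `n` and guiding centre level `m`. -/
def levelPol (B : ℝ) (n m : ℕ) : Pol := (raise₀ B)^[n] ((raise₁ B)^[m] 1)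

lemma levelPol_succ_left (B : ℝ) (n m : ℕ) :
    levelPol B (n + 1) m = raise₀ B (levelPol B n m) := Function.iterate_succ_apply' _ _ _

lemma levelPol_zero_succ (B : ℝ) (m : ℕ) :
    levelPol B 0 (m + 1) = raise₁ B (levelPol B 0 m) := by
  rw [levelPol, levelPol, Function.iterate_zero, id, id, Function.iterate_succ_apply']

lemma levelPol_zero_zero (B : ℝ) : levelPol B 0 0 = 1 := rfl

lemma polH_levelPol (B : ℝ) (n m : ℕ) :
    polH B (levelPol B n m) = C (((2 * n + 1) * B : ℝ) : ℂ) * levelPol B n m := by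
  induction n with
  | zero =>
    induction m with
    | zero =>
      rw [levelPol_zero_zero, polH_eq]
      have : (C (((2 * (0 : ℕ) + 1) * B : ℝ) : ℂ) : Pol) = 2 * C (B / 2 : ℂ) := by
        rw [show (2 : Pol) = C 2 from (map_ofNat C 2).symm, ← C_mul]
        congr 1; push_cast; ring
      rw [this]
      simp
    | succ m ih => rw [levelPol_zero_succ, polH_raise₁, ih, raise₁_C_mul]
  | succ n ih =>
    rw [levelPol_succ_left, polH_raise₀, ih, raise₀_C_mul, ← add_mul]
    congr 1
    rw [show (4 : Pol) = C 4 from (map_ofNat C 4).symm, ← C_mul, ← C_add]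
    congr 1; push_cast; ring

lemma polK_levelPol (B : ℝ) (n m : ℕ) :
    polK B (levelPol B n m) = C (((2 * m + 1) * B : ℝ) : ℂ) * levelPol B n m := by
  induction n with
  | zero =>
    induction m with
    | zero =>
      rw [levelPol_zero_zero, polK_eq]
      have : (C (((2 * (0 : ℕ) + 1) * B : ℝ) : ℂ) : Pol) = 2 * C (B / 2 : ℂ) := by
        rw [show (2 : Pol) = C 2 from (map_ofNat C 2).symm, ← C_mul]
        congr 1; push_cast; ring
      rw [this]
      simp
    | succ m ih =>
      rw [levelPol_zero_succ, polK_raise₁, ih, raise₁_C_mul, ← add_mul]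
      congr 1
      rw [show (4 : Pol) = C 4 from (map_ofNat C 4).symm, ← C_mul, ← C_add]
      congr 1; push_cast; ring
  | succ n ih => rw [levelPol_succ_left, polK_raise₀, ih, raise₀_C_mul]

lemma raise₀_mem_span {B : ℝ} {P : Pol}
    (hP : P ∈ Submodule.span ℂ (Set.range fun i : ℕ × ℕ => levelPol B i.1 i.2)) :
    raise₀ B P ∈ Submodule.span ℂ (Set.range fun i : ℕ × ℕ => levelPol B i.1 i.2) := by
  induction hP using Submodule.span_induction with
  | mem x hx =>
    obtain ⟨i, rfl⟩ := hx
    exact Submodule.subset_span ⟨(i.1 + 1, i.2), levelPol_succ_left B i.1 i.2⟩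
  | zero => simp [raise₀]
  | add x y _ _ hx hy =>
    have : raise₀ B (x + y) = raise₀ B x + raise₀ B y := by simp only [raise₀, map_add]; ring
    rw [this]; exact Submodule.add_mem _ hx hy
  | smul c x _ hx =>
    rw [smul_eq_C_mul, raise₀_C_mul, ← smul_eq_C_mul]; exact Submodule.smul_mem _ _ hx

lemma pderiv_zero_X_one_pow (k : ℕ) : pderiv 0 (X 1 ^ k : Pol) = 0 := by
  rw [pderiv_pow, pderiv_zero_X_one, mul_zero]

/-- The joint eigenvectors span all polynomials. -/
lemma span_levelPol {B : ℝ} (hB : B ≠ 0) :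
    Submodule.span ℂ (Set.range fun i : ℕ × ℕ => levelPol B i.1 i.2) = ⊤ := by
  set S := Submodule.span ℂ (Set.range fun i : ℕ × ℕ => levelPol B i.1 i.2) with hS
  have hIB : Complex.I * B ≠ 0 := mul_ne_zero Complex.I_ne_zero (by exact_mod_cast hB)
  have hcoef : (2 * C Complex.I * C (B / 2 : ℂ) : Pol) = C (Complex.I * B) := by
    rw [show (2 : Pol) = C 2 from (map_ofNat C 2).symm, ← C_mul, ← C_mul]
    congr 1; ring
  -- A power of ζ alone has no ζ̄-derivative, so each guiding centre step just multiplies by iBζ.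
  have hzero : ∀ k, levelPol B 0 k = (Complex.I * B) ^ k • (X 1 ^ k : Pol) := by
    intro k
    induction k with
    | zero => simp [levelPol_zero_zero]
    | succ k ih =>
      rw [levelPol_zero_succ, ih, smul_eq_C_mul, raise₁_C_mul, raise₁, pderiv_zero_X_one_pow,
        hcoef, smul_eq_C_mul, pow_succ (Complex.I * B)]
      generalize Complex.I * (B : ℂ) = w
      rw [C_mul]
      ring
  have hmon : ∀ j k, (X 0 ^ j * X 1 ^ k : Pol) ∈ S := by
    intro j
    induction j with
    | zero =>
      intro k
      rw [pow_zero, one_mul]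
      have : (X 1 ^ k : Pol) = ((Complex.I * B) ^ k)⁻¹ • levelPol B 0 k := by
        rw [hzero, smul_smul, inv_mul_cancel₀ (pow_ne_zero _ hIB), one_smul]
      rw [this]
      exact S.smul_mem _ (Submodule.subset_span ⟨(0, k), rfl⟩)
    | succ j ih =>
      intro k
      have h1 := raise₀_mem_span (ih k)
      have h2 : (pderiv 1 (X 0 ^ j * X 1 ^ k : Pol)) = (k : ℂ) • (X 0 ^ j * X 1 ^ (k - 1) : Pol) := by
        rw [pderiv_mul, pderiv_pow, pderiv_pow, pderiv_one_X_zero, pderiv_one_X_one,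
          smul_eq_C_mul, map_natCast]
        ring
      -- Raising the Landau level multiplies by iBζ̄ up to a term of the same ζ̄-degree already in
      -- the span. For k = 0 the truncated exponent k - 1 is harmless, as its coefficient vanishes.
      have h3 : (X 0 ^ (j + 1) * X 1 ^ k : Pol) = (Complex.I * B)⁻¹ •
          (raise₀ B (X 0 ^ j * X 1 ^ k) +
            (2 * Complex.I * k) • (X 0 ^ j * X 1 ^ (k - 1) : Pol)) := by
        rw [eq_inv_smul_iff₀ hIB, raise₀, h2, hcoef]
        simp only [smul_eq_C_mul, C_mul]
        rw [show (C (2 : ℂ) : Pol) = 2 from map_ofNat C 2]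
        ring
      rw [h3]
      exact S.smul_mem _ (S.add_mem h1 (S.smul_mem _ (ih _)))
  rw [eq_top_iff]
  rintro P -
  -- The strengthened claim lets induction on P move a variable into the monomial factor.
  suffices h : ∀ j k, P * (X 0 ^ j * X 1 ^ k) ∈ S by simpa using h 0 0
  induction P using MvPolynomial.induction_on with
  | C a => intro j k; rw [← smul_eq_C_mul]; exact S.smul_mem _ (hmon j k)
  | add p q hp hq => intro j k; rw [add_mul]; exact S.add_mem (hp j k) (hq j k)
  | mul_X p i hp =>
    intro j k
    fin_cases i
    · have := hp (j + 1) k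
      rw [pow_succ'] at this
      convert this using 1
      simp only [Fin.zero_eta, Fin.isValue]; ring
    · have := hp j (k + 1)
      rw [pow_succ' (X 1)] at this
      convert this using 1
      simp only [Fin.mk_one, Fin.isValue]; ring

end Ladder


/-! ### Polynomials times the ground state -/

section GroundState

open MvPolynomial ComplexConjugate

/-- The complex coordinate `ζ = x + i y`. -/
def zetaL : ℝ × ℝ →L[ℝ] ℂ :=
  Complex.ofRealCLM.comp (ContinuousLinearMap.fst ℝ ℝ ℝ) +
    Complex.I • Complex.ofRealCLM.comp (ContinuousLinearMap.snd ℝ ℝ ℝ)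

/-- The complex coordinate `ζ̄ = x - i y`. -/
def zetaBarL : ℝ × ℝ →L[ℝ] ℂ :=
  Complex.ofRealCLM.comp (ContinuousLinearMap.fst ℝ ℝ ℝ) -
    Complex.I • Complex.ofRealCLM.comp (ContinuousLinearMap.snd ℝ ℝ ℝ)

lemma zetaL_apply (p : ℝ × ℝ) : zetaL p = p.1 + Complex.I * p.2 := rfl

lemma zetaBarL_apply (p : ℝ × ℝ) : zetaBarL p = p.1 - Complex.I * p.2 := rfl

/-- Evaluation of a polynomial at `(ζ̄, ζ)`. -/
def polEval (P : Pol) (p : ℝ × ℝ) : ℂ := eval ![zetaBarL p, zetaL p] P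

lemma polEval_add (P Q : Pol) (p : ℝ × ℝ) : polEval (P + Q) p = polEval P p + polEval Q p :=
  map_add _ _ _

lemma polEval_sub (P Q : Pol) (p : ℝ × ℝ) : polEval (P - Q) p = polEval P p - polEval Q p :=
  map_sub _ _ _

lemma polEval_neg (P : Pol) (p : ℝ × ℝ) : polEval (-P) p = -polEval P p := map_neg _ _

lemma polEval_mul (P Q : Pol) (p : ℝ × ℝ) : polEval (P * Q) p = polEval P p * polEval Q p :=
  map_mul _ _ _

lemma polEval_C (c : ℂ) (p : ℝ × ℝ) : polEval (C c) p = c := eval_C _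

lemma polEval_X_zero (p : ℝ × ℝ) : polEval (X 0) p = zetaBarL p := by simp [polEval]

lemma polEval_X_one (p : ℝ × ℝ) : polEval (X 1) p = zetaL p := by simp [polEval]

lemma hasFDerivAt_polEval (P : Pol) (p : ℝ × ℝ) : HasFDerivAt (polEval P)
    (polEval (pderiv 0 P) p • zetaBarL + polEval (pderiv 1 P) p • zetaL) p := by
  induction P using MvPolynomial.induction_on with
  | C a =>
    have : polEval (C a) = fun _ => a := by funext q; rw [polEval_C]
    rw [this, pderiv_C, pderiv_C]
    refine (hasFDerivAt_const (𝕜 := ℝ) a p).congr_fderiv ?_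
    have h0 : polEval 0 p = 0 := map_zero _
    rw [h0]
    ext <;> simp
  | add P Q hP hQ =>
    have : polEval (P + Q) = polEval P + polEval Q := by
      funext q; rw [Pi.add_apply, polEval_add]
    rw [this]
    refine (hP.add hQ).congr_fderiv ?_
    simp only [map_add, polEval_add]
    module
  | mul_X P i hP =>
    fin_cases i
    · have : polEval (P * X 0) = fun q => polEval P q * zetaBarL q :=
        by funext q; rw [polEval_mul, polEval_X_zero]
      simp only [Fin.zero_eta, Fin.isValue]
      rw [this]
      refine (hP.mul zetaBarL.hasFDerivAt).congr_fderiv ?_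
      simp only [pderiv_mul, pderiv_zero_X_zero, pderiv_one_X_zero, polEval_add, polEval_mul,
        polEval_X_zero, mul_one, mul_zero, add_zero]
      module
    · have : polEval (P * X 1) = fun q => polEval P q * zetaL q :=
        by funext q; rw [polEval_mul, polEval_X_one]
      simp only [Fin.mk_one, Fin.isValue]
      rw [this]
      refine (hP.mul zetaL.hasFDerivAt).congr_fderiv ?_
      simp only [pderiv_mul, pderiv_one_X_one, pderiv_zero_X_one, polEval_add, polEval_mul,
        polEval_X_one, mul_one, mul_zero, add_zero]
      module

lemma contDiff_polEval (P : Pol) : ContDiff ℝ ∞ (polEval P) := by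
  induction P using MvPolynomial.induction_on with
  | C a =>
    have : polEval (C a) = fun _ => a := by funext q; rw [polEval_C]
    rw [this]
    exact contDiff_const
  | add P Q hP hQ =>
    have : polEval (P + Q) = polEval P + polEval Q := by
      funext q; rw [Pi.add_apply, polEval_add]
    rw [this]
    exact hP.add hQ
  | mul_X P i hP =>
    fin_cases i
    · have : polEval (P * X 0) = fun q => polEval P q * zetaBarL q :=
        by funext q; rw [polEval_mul, polEval_X_zero]
      simp only [Fin.zero_eta, Fin.isValue]
      rw [this]
      exact hP.mul zetaBarL.contDiff
    · have : polEval (P * X 1) = fun q => polEval P q * zetaL q :=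
        by funext q; rw [polEval_mul, polEval_X_one]
      simp only [Fin.mk_one, Fin.isValue]
      rw [this]
      exact hP.mul zetaL.contDiff

/-- The ground state. -/
def ground (B : ℝ) (p : ℝ × ℝ) : ℂ :=
  Complex.exp (-(B / 4 : ℂ) * ((p.1 : ℂ) ^ 2 + (p.2 : ℂ) ^ 2) -
    Complex.I * (B / 2 : ℂ) * (p.1 * p.2))

lemma contDiff_ground (B : ℝ) : ContDiff ℝ ∞ (ground B) := by
  have h1 : ContDiff ℝ ∞ fun p : ℝ × ℝ => (p.1 : ℂ) :=
    Complex.ofRealCLM.contDiff.comp contDiff_fst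
  have h2 : ContDiff ℝ ∞ fun p : ℝ × ℝ => (p.2 : ℂ) :=
    Complex.ofRealCLM.contDiff.comp contDiff_snd
  exact ((contDiff_const.mul ((h1.pow 2).add (h2.pow 2))).sub
    (contDiff_const.mul (h1.mul h2))).cexp

/-- The phase exp(-iBxy/2) passes from the symmetric gauge to the present one. The partial
derivatives of the exponent are -(B/2)ζ and -(B/2)iζ̄, so the momenta act on the polynomial factor
alone. -/
lemma hasFDerivAt_ground (B : ℝ) (p : ℝ × ℝ) : HasFDerivAt (ground B)
    (ground B p • (-(B / 2 : ℂ)) • (zetaL p • Complex.ofRealCLM.comp (ContinuousLinearMap.fst ℝ ℝ ℝ)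
      + (Complex.I * zetaBarL p) • Complex.ofRealCLM.comp (ContinuousLinearMap.snd ℝ ℝ ℝ))) p := by
  have h1 : HasFDerivAt (fun p : ℝ × ℝ => (p.1 : ℂ))
    (Complex.ofRealCLM.comp (ContinuousLinearMap.fst ℝ ℝ ℝ)) p :=
    (Complex.ofRealCLM.comp (ContinuousLinearMap.fst ℝ ℝ ℝ)).hasFDerivAt
  have h2 : HasFDerivAt (fun p : ℝ × ℝ => (p.2 : ℂ))
    (Complex.ofRealCLM.comp (ContinuousLinearMap.snd ℝ ℝ ℝ)) p :=
    (Complex.ofRealCLM.comp (ContinuousLinearMap.snd ℝ ℝ ℝ)).hasFDerivAt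
  have h := ((((h1.pow 2).add (h2.pow 2)).const_mul (-(B / 4 : ℂ))).sub
    ((h1.mul h2).const_mul (Complex.I * (B / 2 : ℂ)))).cexp
  refine h.congr_fderiv ?_
  ext
  · simp [zetaL_apply, ground]
    ring
  · simp [zetaBarL_apply, ground]
    linear_combination (-Complex.exp (-(B / 4 * ((p.1 : ℂ) ^ 2 + (p.2 : ℂ) ^ 2)) -
      Complex.I * (B / 2 : ℂ) * (p.1 * p.2)) * (B / 2) * p.2) * Complex.I_mul_I

lemma norm_ground (B : ℝ) (p : ℝ × ℝ) :
    ‖ground B p‖ = Real.exp (-(B / 4) * (p.1 ^ 2 + p.2 ^ 2)) := by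
  rw [ground, Complex.norm_exp]
  congr 1
  rw [show (-(B / 4 : ℂ) * ((p.1 : ℂ) ^ 2 + (p.2 : ℂ) ^ 2) - Complex.I * (B / 2 : ℂ) * (p.1 * p.2))
    = ((-(B / 4) * (p.1 ^ 2 + p.2 ^ 2) : ℝ) : ℂ) + ((-(B / 2) * (p.1 * p.2) : ℝ) : ℂ) * Complex.I by
    push_cast; ring]
  rw [Complex.add_re, Complex.ofReal_re, Complex.re_ofReal_mul, Complex.I_re, mul_zero, add_zero]

/-- A polynomial in `ζ̄`, `ζ` times the ground state. -/
def polyFun (B : ℝ) (P : Pol) (p : ℝ × ℝ) : ℂ := polEval P p * ground B p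

lemma contDiff_polyFun (B : ℝ) (P : Pol) : ContDiff ℝ ∞ (polyFun B P) :=
  (contDiff_polEval P).mul (contDiff_ground B)

lemma fderiv_polyFun_fst (B : ℝ) (P : Pol) (p : ℝ × ℝ) : fderiv ℝ (polyFun B P) p (1, 0) =
    (polEval (pderiv 0 P) p + polEval (pderiv 1 P) p - B / 2 * zetaL p * polEval P p) *
      ground B p := by
  have h : HasFDerivAt (polyFun B P) _ p := (hasFDerivAt_polEval P p).mul (hasFDerivAt_ground B p)
  rw [h.fderiv]
  simp [zetaL_apply, zetaBarL_apply]
  ring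

lemma fderiv_polyFun_snd (B : ℝ) (P : Pol) (p : ℝ × ℝ) : fderiv ℝ (polyFun B P) p (0, 1) =
    Complex.I * (-polEval (pderiv 0 P) p + polEval (pderiv 1 P) p
      - B / 2 * zetaBarL p * polEval P p) * ground B p := by
  have h : HasFDerivAt (polyFun B P) _ p := (hasFDerivAt_polEval P p).mul (hasFDerivAt_ground B p)
  rw [h.fderiv]
  simp [zetaL_apply, zetaBarL_apply]
  ring

/-- The first order operator `-i ∂_v + ℓ`. -/
def mom (v : ℝ × ℝ) (l : ℝ × ℝ → ℝ) (φ : ℝ × ℝ → ℂ) (p : ℝ × ℝ) : ℂ :=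
  -Complex.I * fderiv ℝ φ p v + (l p : ℂ) * φ p

lemma momX_eq_mom (B : ℝ) : momX B = mom (1, 0) fun p => B * p.2 := rfl

lemma momY_eq_mom : momY = mom (0, 1) fun _ => 0 := by
  funext φ p; simp [momY, mom]

/-- `-i ∂ₓ`. -/
abbrev guideX : (ℝ × ℝ → ℂ) → ℝ × ℝ → ℂ := mom (1, 0) fun _ => 0

/-- `-i ∂_y + B x`. -/
abbrev guideY (B : ℝ) : (ℝ × ℝ → ℂ) → ℝ × ℝ → ℂ := mom (0, 1) fun p => B * p.1

lemma momX_polyFun (B : ℝ) (P : Pol) : momX B (polyFun B P) = polyFun B (polPiX B P) := by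
  funext p
  rw [momX, fderiv_polyFun_fst]
  simp only [polyFun, polPiX, polEval_add, polEval_neg, polEval_mul, polEval_C,
    polEval_X_zero, zetaL_apply, zetaBarL_apply]
  push_cast
  linear_combination (B * p.2 * polEval P p * ground B p) * Complex.I_mul_I

lemma momY_polyFun (B : ℝ) (P : Pol) : momY (polyFun B P) = polyFun B (polPiY B P) := by
  funext p
  rw [momY, fderiv_polyFun_snd]
  simp only [polyFun, polPiY, polEval_add, polEval_sub, polEval_neg, polEval_mul, polEval_C,
    polEval_X_zero, zetaBarL_apply]
  linear_combination (-(-polEval (pderiv 0 P) p + polEval (pderiv 1 P) p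
      - B / 2 * (p.1 - Complex.I * p.2) * polEval P p) * ground B p) * Complex.I_mul_I

lemma guideX_polyFun (B : ℝ) (P : Pol) : guideX (polyFun B P) = polyFun B (polKX B P) := by
  funext p
  rw [guideX, mom, fderiv_polyFun_fst]
  simp only [polyFun, polKX, polEval_add, polEval_neg, polEval_mul, polEval_C,
    polEval_X_one, zetaL_apply]
  push_cast
  ring

lemma guideY_polyFun (B : ℝ) (P : Pol) : guideY B (polyFun B P) = polyFun B (polKY B P) := by
  funext p
  rw [guideY, mom, fderiv_polyFun_snd]
  simp only [polyFun, polKY, polEval_add, polEval_neg, polEval_mul, polEval_C,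
    polEval_X_one, zetaL_apply, zetaBarL_apply]
  push_cast
  linear_combination (-(-polEval (pderiv 0 P) p + polEval (pderiv 1 P) p
      - B / 2 * (p.1 - Complex.I * p.2) * polEval P p) * ground B p) * Complex.I_mul_I

/-! #### Decay -/

lemma norm_zetaL_sq (p : ℝ × ℝ) : ‖zetaL p‖ ^ 2 = p.1 ^ 2 + p.2 ^ 2 := by
  rw [zetaL_apply, ← Complex.normSq_eq_norm_sq, mul_comm, Complex.normSq_add_mul_I]

lemma conj_zetaL (p : ℝ × ℝ) : conj (zetaL p) = zetaBarL p := by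
  simp [zetaL_apply, zetaBarL_apply, sub_eq_add_neg]

lemma norm_zetaBarL (p : ℝ × ℝ) : ‖zetaBarL p‖ = ‖zetaL p‖ := by
  rw [← conj_zetaL, RCLike.norm_conj]

lemma exists_norm_zetaL_le {δ : ℝ} (hδ : 0 < δ) :
    ∃ K, 0 ≤ K ∧ ∀ p, ‖zetaL p‖ ≤ K * Real.exp (δ * (p.1 ^ 2 + p.2 ^ 2)) := by
  refine ⟨1 + δ⁻¹, by positivity, fun p => ?_⟩
  have h1 := Real.add_one_le_exp (δ * (p.1 ^ 2 + p.2 ^ 2))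
  have h2 := norm_zetaL_sq p
  have h3 : ‖zetaL p‖ ≤ 1 + (p.1 ^ 2 + p.2 ^ 2) := by
    rw [← h2]; nlinarith [sq_nonneg (‖zetaL p‖ - 1), norm_nonneg (zetaL p)]
  have h4 : 1 + (p.1 ^ 2 + p.2 ^ 2) ≤ (1 + δ⁻¹) * (δ * (p.1 ^ 2 + p.2 ^ 2) + 1) := by
    have : δ⁻¹ * δ = 1 := inv_mul_cancel₀ hδ.ne'
    have h5 : 0 ≤ δ * (p.1 ^ 2 + p.2 ^ 2) := by positivity
    have h6 : 0 < δ⁻¹ := by positivity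
    calc 1 + (p.1 ^ 2 + p.2 ^ 2) = 1 + (δ⁻¹ * δ) * (p.1 ^ 2 + p.2 ^ 2) := by rw [this, one_mul]
      _ ≤ _ := by nlinarith
  exact h3.trans (h4.trans (mul_le_mul_of_nonneg_left h1 (by positivity)))

/-- Polynomial growth is dominated by a Gaussian of arbitrarily small exponent. Each multiplication
by a coordinate spends half of the allowed δ. -/
lemma exists_norm_polEval_le (P : Pol) :
    ∀ δ > 0, ∃ K, 0 ≤ K ∧ ∀ p, ‖polEval P p‖ ≤ K * Real.exp (δ * (p.1 ^ 2 + p.2 ^ 2)) := by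
  have hstep : ∀ (P : Pol) (L : ℝ × ℝ → ℂ), (∀ p, ‖L p‖ = ‖zetaL p‖) →
      (∀ δ > 0, ∃ K, 0 ≤ K ∧ ∀ p, ‖polEval P p‖ ≤ K * Real.exp (δ * (p.1 ^ 2 + p.2 ^ 2))) →
      ∀ δ > 0, ∃ K, 0 ≤ K ∧
        ∀ p, ‖polEval P p * L p‖ ≤ K * Real.exp (δ * (p.1 ^ 2 + p.2 ^ 2)) := by
    intro P L hL hP δ hδ
    obtain ⟨K, hK, h⟩ := hP (δ / 2) (by positivity)
    obtain ⟨K', hK', h'⟩ := exists_norm_zetaL_le (δ := δ / 2) (by positivity)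
    refine ⟨K * K', by positivity, fun p => ?_⟩
    rw [norm_mul, hL]
    refine (mul_le_mul (h p) (h' p) (norm_nonneg _) (by positivity)).trans_eq ?_
    rw [show δ * (p.1 ^ 2 + p.2 ^ 2) = δ / 2 * (p.1 ^ 2 + p.2 ^ 2) + δ / 2 * (p.1 ^ 2 + p.2 ^ 2) by
      ring, Real.exp_add]
    ring
  induction P using MvPolynomial.induction_on with
  | C a =>
    intro δ hδ
    refine ⟨‖a‖, norm_nonneg _, fun p => ?_⟩
    rw [polEval_C]
    exact le_mul_of_one_le_right (norm_nonneg _) (Real.one_le_exp (by positivity))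
  | add P Q hP hQ =>
    intro δ hδ
    obtain ⟨K, hK, h⟩ := hP δ hδ
    obtain ⟨K', hK', h'⟩ := hQ δ hδ
    refine ⟨K + K', by positivity, fun p => ?_⟩
    rw [polEval_add, add_mul]
    exact (norm_add_le _ _).trans (add_le_add (h p) (h' p))
  | mul_X P i hP =>
    fin_cases i
    · intro δ hδ
      obtain ⟨K, hK, h⟩ := hstep P zetaBarL norm_zetaBarL hP δ hδ
      exact ⟨K, hK, fun p => by
        simp only [Fin.zero_eta, Fin.isValue]; rw [polEval_mul, polEval_X_zero]; exact h p⟩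
    · intro δ hδ
      obtain ⟨K, hK, h⟩ := hstep P zetaL (fun _ => rfl) hP δ hδ
      exact ⟨K, hK, fun p => by
        simp only [Fin.mk_one, Fin.isValue]; rw [polEval_mul, polEval_X_one]; exact h p⟩

lemma integrable_gaussian {c : ℝ} (hc : 0 < c) :
    Integrable (fun p : ℝ × ℝ => Real.exp (-c * (p.1 ^ 2 + p.2 ^ 2))) volume := by
  have h := (integrable_exp_neg_mul_sq hc).mul_prod (integrable_exp_neg_mul_sq hc)
  refine h.congr (Eventually.of_forall fun p => ?_)
  simp only
  rw [← Real.exp_add]; ring_nf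

lemma memLp_gaussian {c : ℝ} (hc : 0 < c) :
    MemLp (fun p : ℝ × ℝ => Real.exp (-c * (p.1 ^ 2 + p.2 ^ 2))) 2 volume := by
  have hm : AEStronglyMeasurable (fun p : ℝ × ℝ => Real.exp (-c * (p.1 ^ 2 + p.2 ^ 2))) volume :=
    (by fun_prop : Continuous _).aestronglyMeasurable
  rw [memLp_two_iff_integrable_sq_norm hm]
  refine (integrable_gaussian (c := 2 * c) (by positivity)).congr (Eventually.of_forall fun p => ?_)
  simp only
  rw [Real.norm_eq_abs, Real.abs_exp, ← Real.exp_nat_mul]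
  push_cast; ring_nf

lemma memLp_polyFun {B : ℝ} (hB : 0 < B) (P : Pol) : MemLp (polyFun B P) 2 volume := by
  -- Half of the decay rate B/4 of the ground state is given to the polynomial, the other half gives
  -- integrability.
  obtain ⟨K, hK, h⟩ := exists_norm_polEval_le P (B / 8) (by positivity)
  refine MemLp.of_le_mul (memLp_gaussian (c := B / 8) (by positivity))
    (contDiff_polyFun B P).continuous.aestronglyMeasurable (c := K)
    (Eventually.of_forall fun p => ?_)
  rw [polyFun, norm_mul, norm_ground, Real.norm_eq_abs, Real.abs_exp]
  refine (mul_le_mul_of_nonneg_right (h p) (Real.exp_pos _).le).trans_eq ?_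
  rw [mul_assoc, ← Real.exp_add]; ring_nf

end GroundState


/-! ### Symmetry of the first order operators -/

section Symmetry

open MvPolynomial ComplexConjugate

lemma integrable_conj_mul {f g : ℝ × ℝ → ℂ} (hf : MemLp f 2 volume) (hg : MemLp g 2 volume) :
    Integrable (fun p => conj (f p) * g p) volume :=
  (hf.star).integrable_mul hg

lemma fderiv_conj_comp {f : ℝ × ℝ → ℂ} {p : ℝ × ℝ} (hf : DifferentiableAt ℝ f p) (v : ℝ × ℝ) :
    fderiv ℝ (fun q => conj (f q)) p v = conj (fderiv ℝ f p v) := by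
  have h : HasFDerivAt (fun q => conj (f q)) _ p :=
    (Complex.conjCLE.toContinuousLinearMap.hasFDerivAt).comp p hf.hasFDerivAt
  rw [h.fderiv]
  rfl

/-- Integration by parts without boundary terms: the factor -i absorbs the sign, and the multiplier
is real. -/
lemma integral_conj_mom_mul {v : ℝ × ℝ} {l : ℝ × ℝ → ℝ} {f g : ℝ × ℝ → ℂ}
    (hf : Differentiable ℝ f) (hg : Differentiable ℝ g)
    (hf₀ : MemLp f 2 volume) (hg₀ : MemLp g 2 volume)
    (hf₁ : MemLp (fun p => fderiv ℝ f p v) 2 volume)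
    (hg₁ : MemLp (fun p => fderiv ℝ g p v) 2 volume)
    (hf₂ : MemLp (mom v l f) 2 volume) (hg₂ : MemLp (mom v l g) 2 volume) :
    ∫ p, conj (mom v l f p) * g p = ∫ p, conj (f p) * mom v l g p := by
  have hconj : ∀ p, fderiv ℝ (fun q => conj (f q)) p v = conj (fderiv ℝ f p v) :=
    fun p => fderiv_conj_comp (hf p) v
  have hibp := integral_mul_fderiv_eq_neg_fderiv_mul_of_integrable (μ := volume)
    (f := fun q => conj (f q)) (g := g) (v := v)
    (by simp only [hconj]; exact integrable_conj_mul hf₁ hg₀)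
    (integrable_conj_mul hf₀ hg₁) (integrable_conj_mul hf₀ hg₀)
    (fun x _ => Complex.conjCLE.toContinuousLinearMap.differentiableAt.comp x (hf x))
    (fun x _ => hg x)
  simp only [hconj] at hibp
  rw [← sub_eq_zero, ← integral_sub (integrable_conj_mul hf₂ hg₀) (integrable_conj_mul hf₀ hg₂)]
  have e : ∀ p, conj (mom v l f p) * g p - conj (f p) * mom v l g p =
      Complex.I * (conj (fderiv ℝ f p v) * g p + conj (f p) * fderiv ℝ g p v) := by
    intro p
    simp only [mom, map_add, map_mul, map_neg, Complex.conj_I, Complex.conj_ofReal]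
    ring
  simp only [e]
  rw [integral_const_mul, integral_add (integrable_conj_mul hf₁ hg₀) (integrable_conj_mul hf₀ hg₁),
    hibp, add_neg_cancel, mul_zero]

/-- Functions which are either a polynomial times the ground state or a test function. -/
def IsNice (B : ℝ) (f : ℝ × ℝ → ℂ) : Prop :=
  (∃ P, f = polyFun B P) ∨ (ContDiff ℝ ∞ f ∧ HasCompactSupport f)

variable {B : ℝ} {f g : ℝ × ℝ → ℂ}

lemma contDiff_mom (v : ℝ × ℝ) {l : ℝ × ℝ → ℝ} (hl : ContDiff ℝ ∞ l) (hf : ContDiff ℝ ∞ f) :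
    ContDiff ℝ ∞ (mom v l f) :=
  (contDiff_const.mul ((hf.fderiv_right (m := ∞) (by simp)).clm_apply contDiff_const)).add
    ((Complex.ofRealCLM.contDiff.comp hl).mul hf)

lemma hasCompactSupport_mom (v : ℝ × ℝ) (l : ℝ × ℝ → ℝ) (hf : HasCompactSupport f) :
    HasCompactSupport (mom v l f) := by
  have h1 : HasCompactSupport fun p => fderiv ℝ f p v :=
    (hf.fderiv (𝕜 := ℝ)).comp_left (g := fun L : ℝ × ℝ →L[ℝ] ℂ => L v) rfl
  exact (h1.mul_left (f := fun _ => -Complex.I)).add (hf.mul_left (f := fun p => (l p : ℂ)))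

lemma IsNice.contDiff (hf : IsNice B f) : ContDiff ℝ ∞ f := by
  rcases hf with ⟨P, rfl⟩ | hf
  · exact contDiff_polyFun B P
  · exact hf.1

lemma IsNice.differentiable (hf : IsNice B f) : Differentiable ℝ f :=
  hf.contDiff.differentiable (by simp)

lemma IsNice.memLp (hB : 0 < B) (hf : IsNice B f) : MemLp f 2 volume := by
  rcases hf with ⟨P, rfl⟩ | hf
  · exact memLp_polyFun hB P
  · exact hf.1.continuous.memLp_of_hasCompactSupport hf.2

lemma IsNice.momX (hf : IsNice B f) : IsNice B (momX B f) := by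
  rcases hf with ⟨P, rfl⟩ | hf
  · exact Or.inl ⟨_, momX_polyFun B P⟩
  · exact Or.inr ⟨contDiff_momX B hf.1, hasCompactSupport_mom _ _ hf.2⟩

lemma IsNice.momY (hf : IsNice B f) : IsNice B (momY f) := by
  rcases hf with ⟨P, rfl⟩ | hf
  · exact Or.inl ⟨_, momY_polyFun B P⟩
  · refine Or.inr ⟨contDiff_momY hf.1, ?_⟩
    rw [momY_eq_mom]; exact hasCompactSupport_mom _ _ hf.2

lemma IsNice.guideX (hf : IsNice B f) : IsNice B (guideX f) := by
  rcases hf with ⟨P, rfl⟩ | hf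
  · exact Or.inl ⟨_, guideX_polyFun B P⟩
  · exact Or.inr ⟨contDiff_mom _ contDiff_const hf.1, hasCompactSupport_mom _ _ hf.2⟩

lemma IsNice.guideY (hf : IsNice B f) : IsNice B (guideY B f) := by
  rcases hf with ⟨P, rfl⟩ | hf
  · exact Or.inl ⟨_, guideY_polyFun B P⟩
  · exact Or.inr ⟨contDiff_mom _ (contDiff_const.mul contDiff_fst) hf.1,
      hasCompactSupport_mom _ _ hf.2⟩

lemma IsNice.memLp_fderiv_fst (hB : 0 < B) (hf : IsNice B f) :
    MemLp (fun p => fderiv ℝ f p (1, 0)) 2 volume := by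
  have h := (hf.guideX.memLp hB).const_mul Complex.I
  refine (memLp_congr_ae (Eventually.of_forall fun p => ?_)).1 h
  simp only [mom, Complex.ofReal_zero, zero_mul, add_zero]
  rw [← mul_assoc, mul_neg, Complex.I_mul_I, neg_neg, one_mul]

lemma IsNice.memLp_fderiv_snd (hB : 0 < B) (hf : IsNice B f) :
    MemLp (fun p => fderiv ℝ f p (0, 1)) 2 volume := by
  have h := (hf.momY.memLp hB).const_mul Complex.I
  refine (memLp_congr_ae (Eventually.of_forall fun p => ?_)).1 h
  simp only [MagneticStark.momY]
  rw [← mul_assoc, mul_neg, Complex.I_mul_I, neg_neg, one_mul]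

lemma integral_conj_momX_mul (hB : 0 < B) (hf : IsNice B f) (hg : IsNice B g) :
    ∫ p, conj (momX B f p) * g p = ∫ p, conj (f p) * momX B g p :=
  integral_conj_mom_mul hf.differentiable hg.differentiable (hf.memLp hB) (hg.memLp hB)
    (hf.memLp_fderiv_fst hB) (hg.memLp_fderiv_fst hB) (hf.momX.memLp hB) (hg.momX.memLp hB)

lemma integral_conj_momY_mul (hB : 0 < B) (hf : IsNice B f) (hg : IsNice B g) :
    ∫ p, conj (momY f p) * g p = ∫ p, conj (f p) * momY g p := by
  have h1 := hf.momY.memLp hB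
  have h2 := hg.momY.memLp hB
  rw [momY_eq_mom] at *
  exact integral_conj_mom_mul hf.differentiable hg.differentiable (hf.memLp hB) (hg.memLp hB)
    (hf.memLp_fderiv_snd hB) (hg.memLp_fderiv_snd hB) h1 h2

lemma integral_conj_guideX_mul (hB : 0 < B) (hf : IsNice B f) (hg : IsNice B g) :
    ∫ p, conj (guideX f p) * g p = ∫ p, conj (f p) * guideX g p :=
  integral_conj_mom_mul hf.differentiable hg.differentiable (hf.memLp hB) (hg.memLp hB)
    (hf.memLp_fderiv_fst hB) (hg.memLp_fderiv_fst hB) (hf.guideX.memLp hB) (hg.guideX.memLp hB)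

lemma integral_conj_guideY_mul (hB : 0 < B) (hf : IsNice B f) (hg : IsNice B g) :
    ∫ p, conj (guideY B f p) * g p = ∫ p, conj (f p) * guideY B g p :=
  integral_conj_mom_mul hf.differentiable hg.differentiable (hf.memLp hB) (hg.memLp hB)
    (hf.memLp_fderiv_snd hB) (hg.memLp_fderiv_snd hB) (hf.guideY.memLp hB) (hg.guideY.memLp hB)

/-- The guiding centre Hamiltonian. -/
def guideExpr (B : ℝ) (f : ℝ × ℝ → ℂ) (p : ℝ × ℝ) : ℂ :=
  guideX (guideX f) p + guideY B (guideY B f) p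

lemma landauExpr_apply (B : ℝ) (f : ℝ × ℝ → ℂ) (p : ℝ × ℝ) :
    magneticExpr B 0 f p = momX B (momX B f) p + momY (momY f) p := by
  simp [magneticExpr]

lemma IsNice.landauExpr (hf : IsNice B f) : IsNice B (magneticExpr B 0 f) := by
  have e : magneticExpr B 0 f = fun p => MagneticStark.momX B (MagneticStark.momX B f) p +
    MagneticStark.momY (MagneticStark.momY f) p := funext (landauExpr_apply B f)
  rw [e]
  rcases hf with ⟨P, rfl⟩ | hf
  · refine Or.inl ⟨polH B P, funext fun p => ?_⟩
    rw [momX_polyFun, momX_polyFun, momY_polyFun, momY_polyFun, polyFun, polyFun, polyFun, polH,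
      polEval_add, add_mul]
  · have h1 : IsNice B f := Or.inr hf
    refine Or.inr ⟨(contDiff_momX B (contDiff_momX B hf.1)).add
      (contDiff_momY (contDiff_momY hf.1)), ?_⟩
    rw [momY_eq_mom]
    exact (hasCompactSupport_mom _ _ (hasCompactSupport_mom _ _ hf.2)).add
      (hasCompactSupport_mom _ _ (hasCompactSupport_mom _ _ hf.2))

lemma IsNice.guideExpr (hf : IsNice B f) : IsNice B (guideExpr B f) := by
  rcases hf with ⟨P, rfl⟩ | hf
  · refine Or.inl ⟨polK B P, funext fun p => ?_⟩
    rw [MagneticStark.guideExpr, guideX_polyFun, guideX_polyFun, guideY_polyFun, guideY_polyFun,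
      polyFun, polyFun, polyFun, polK, polEval_add, add_mul]
  · refine Or.inr ⟨(contDiff_mom _ contDiff_const (contDiff_mom _ contDiff_const hf.1)).add
      (contDiff_mom _ (contDiff_const.mul contDiff_fst)
        (contDiff_mom _ (contDiff_const.mul contDiff_fst) hf.1)), ?_⟩
    exact (hasCompactSupport_mom _ _ (hasCompactSupport_mom _ _ hf.2)).add
      (hasCompactSupport_mom _ _ (hasCompactSupport_mom _ _ hf.2))

/-- The quadratic form as a sum of momentum pairings; on the diagonal it is the energy used in the
compactness estimate. -/
lemma integral_conj_mul_landauExpr (hB : 0 < B) (hf : IsNice B f) (hg : IsNice B g) :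
    ∫ p, conj (f p) * magneticExpr B 0 g p =
      (∫ p, conj (momX B f p) * momX B g p) + ∫ p, conj (momY f p) * momY g p := by
  rw [integral_conj_momX_mul hB hf hg.momX, integral_conj_momY_mul hB hf hg.momY,
    ← integral_add (integrable_conj_mul (hf.memLp hB) (hg.momX.momX.memLp hB))
      (integrable_conj_mul (hf.memLp hB) (hg.momY.momY.memLp hB))]
  exact integral_congr_ae (Eventually.of_forall fun p => by
    simp only [landauExpr_apply, mul_add])

lemma integral_conj_landauExpr_mul (hB : 0 < B) (hf : IsNice B f) (hg : IsNice B g) :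
    ∫ p, conj (magneticExpr B 0 f p) * g p = ∫ p, conj (f p) * magneticExpr B 0 g p := by
  rw [integral_conj_mul_landauExpr hB hf hg, ← integral_conj_momX_mul hB hf.momX hg,
    ← integral_conj_momY_mul hB hf.momY hg,
    ← integral_add (integrable_conj_mul (hf.momX.momX.memLp hB) (hg.memLp hB))
      (integrable_conj_mul (hf.momY.momY.memLp hB) (hg.memLp hB))]
  exact integral_congr_ae (Eventually.of_forall fun p => by
    simp only [landauExpr_apply, map_add, add_mul])

lemma integral_conj_mul_guideExpr (hB : 0 < B) (hf : IsNice B f) (hg : IsNice B g) :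
    ∫ p, conj (f p) * guideExpr B g p =
      (∫ p, conj (guideX f p) * guideX g p) + ∫ p, conj (guideY B f p) * guideY B g p := by
  rw [integral_conj_guideX_mul hB hf hg.guideX, integral_conj_guideY_mul hB hf hg.guideY,
    ← integral_add (integrable_conj_mul (hf.memLp hB) (hg.guideX.guideX.memLp hB))
      (integrable_conj_mul (hf.memLp hB) (hg.guideY.guideY.memLp hB))]
  exact integral_congr_ae (Eventually.of_forall fun p => by
    simp only [guideExpr, mul_add])

lemma integral_conj_guideExpr_mul (hB : 0 < B) (hf : IsNice B f) (hg : IsNice B g) :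
    ∫ p, conj (guideExpr B f p) * g p = ∫ p, conj (f p) * guideExpr B g p := by
  rw [integral_conj_mul_guideExpr hB hf hg, ← integral_conj_guideX_mul hB hf.guideX hg,
    ← integral_conj_guideY_mul hB hf.guideY hg,
    ← integral_add (integrable_conj_mul (hf.guideX.guideX.memLp hB) (hg.memLp hB))
      (integrable_conj_mul (hf.guideY.guideY.memLp hB) (hg.memLp hB))]
  exact integral_congr_ae (Eventually.of_forall fun p => by
    simp only [guideExpr, map_add, add_mul])

/-- The inner product of `L²` in terms of representatives. -/
lemma inner_eq_integral {u w : L2} (hu : u =ᵐ[volume] f) (hw : w =ᵐ[volume] g) :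
    inner ℂ u w = ∫ p, conj (f p) * g p := by
  rw [L2.inner_def]
  refine integral_congr_ae ?_
  filter_upwards [hu, hw] with p h1 h2
  rw [h1, h2, RCLike.inner_apply, mul_comm]

end Symmetry


/-! ### Completeness of the joint eigenvectors -/

section Completeness

open MvPolynomial ComplexConjugate

/-- The positive and negative parts of h are densities of finite measures with equal characteristic
functions, so they agree almost everywhere. As one of them vanishes at each point, both are zero. -/
lemma ae_eq_zero_of_integral_char_real {h : ℝ × ℝ → ℝ} (hh : Integrable h volume)
    (h0 : ∀ L : StrongDual ℝ (ℝ × ℝ), ∫ p, (h p : ℂ) * Complex.exp (L p * Complex.I) = 0) :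
    h =ᵐ[volume] 0 := by
  have hfin : ∀ k : ℝ × ℝ → ℝ, Integrable k volume →
      IsFiniteMeasure ((volume : Measure (ℝ × ℝ)).withDensity fun p => ENNReal.ofReal (k p)) :=
    fun k hk => isFiniteMeasure_withDensity_ofReal hk.2
  have hchar : ∀ k : ℝ × ℝ → ℝ, Integrable k volume → ∀ L : StrongDual ℝ (ℝ × ℝ),
      charFunDual ((volume : Measure (ℝ × ℝ)).withDensity fun p => ENNReal.ofReal (k p)) L =
        ∫ p, ((max (k p) 0 : ℝ) : ℂ) * Complex.exp (L p * Complex.I) := by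
    intro k hk L
    rw [charFunDual_apply, integral_withDensity_eq_integral_toReal_smul₀
      hk.aestronglyMeasurable.aemeasurable.ennreal_ofReal
      (Eventually.of_forall fun p => ENNReal.ofReal_lt_top)]
    refine integral_congr_ae (Eventually.of_forall fun p => ?_)
    simp only [ENNReal.toReal_ofReal', Complex.real_smul]
  have := hfin h hh
  have := hfin (fun p => -h p) hh.neg
  have hint : ∀ k : ℝ × ℝ → ℝ, Integrable k volume → ∀ L : StrongDual ℝ (ℝ × ℝ),
      Integrable (fun p => ((max (k p) 0 : ℝ) : ℂ) * Complex.exp (L p * Complex.I)) volume := by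
    intro k hk L
    refine hk.pos_part.ofReal.mul_bdd (c := 1) ?_ (Eventually.of_forall fun p => ?_)
    · exact (by fun_prop : Continuous fun p => Complex.exp (L p * Complex.I)).aestronglyMeasurable
    · rw [Complex.norm_exp_ofReal_mul_I]
  have heq := Measure.ext_of_charFunDual (μ := (volume : Measure (ℝ × ℝ)).withDensity
      fun p => ENNReal.ofReal (h p))
    (ν := (volume : Measure (ℝ × ℝ)).withDensity fun p => ENNReal.ofReal (-h p)) (by
      funext L
      rw [hchar h hh, hchar (fun p => -h p) hh.neg, ← sub_eq_zero, ← integral_sub (hint h hh L)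
        (hint (fun p => -h p) hh.neg L), ← h0 L]
      refine integral_congr_ae (Eventually.of_forall fun p => ?_)
      simp only
      rw [← sub_mul, ← Complex.ofReal_sub]
      congr 2
      rcases le_total (h p) 0 with hp | hp
      · rw [max_eq_right hp, max_eq_left (by linarith)]; ring
      · rw [max_eq_left hp, max_eq_right (by linarith)]; ring)
  have hae := (withDensity_eq_iff_of_sigmaFinite
    hh.aestronglyMeasurable.aemeasurable.ennreal_ofReal
    hh.neg.aestronglyMeasurable.aemeasurable.ennreal_ofReal).1 heq
  filter_upwards [hae] with p hp
  rcases lt_trichotomy (h p) 0 with h1 | h1 | h1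
  · rw [ENNReal.ofReal_of_nonpos h1.le] at hp
    have := ENNReal.ofReal_eq_zero.1 hp.symm
    simp only [Pi.neg_apply] at this
    linarith
  · exact h1
  · rw [eq_comm] at hp
    simp only [Pi.neg_apply] at hp
    rw [ENNReal.ofReal_of_nonpos (by linarith : -h p ≤ 0)] at hp
    have := ENNReal.ofReal_eq_zero.1 hp.symm
    linarith

lemma ae_eq_zero_of_integral_char {g : ℝ × ℝ → ℂ} (hg : Integrable g volume)
    (h0 : ∀ L : StrongDual ℝ (ℝ × ℝ), ∫ p, g p * Complex.exp (L p * Complex.I) = 0) :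
    g =ᵐ[volume] 0 := by
  have hconj : ∀ L : StrongDual ℝ (ℝ × ℝ),
      ∫ p, conj (g p) * Complex.exp (L p * Complex.I) = 0 := by
    intro L
    have h1 := congrArg conj (h0 (-L))
    rw [map_zero, ← integral_conj] at h1
    rw [← h1]
    refine integral_congr_ae (Eventually.of_forall fun p => ?_)
    simp [← Complex.exp_conj]
  have hint : ∀ L : StrongDual ℝ (ℝ × ℝ), ∀ k : ℝ × ℝ → ℂ, Integrable k volume →
      Integrable (fun p => k p * Complex.exp (L p * Complex.I)) volume := by
    intro L k hk
    refine hk.mul_bdd (c := 1) ?_ (Eventually.of_forall fun p => ?_)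
    · exact (by fun_prop : Continuous fun p => Complex.exp (L p * Complex.I)).aestronglyMeasurable
    · rw [Complex.norm_exp_ofReal_mul_I]
  have hgc : Integrable (fun p => conj (g p)) volume :=
    Complex.conjCLE.toContinuousLinearMap.integrable_comp hg
  have hre := ae_eq_zero_of_integral_char_real hg.re fun L => by
    have h1 := integral_add (hint L g hg) (hint L _ hgc)
    rw [h0 L, hconj L, add_zero] at h1
    have h2 : ∀ p, ((RCLike.re (g p) : ℝ) : ℂ) * Complex.exp (L p * Complex.I) = (1 / 2) *
        (g p * Complex.exp (L p * Complex.I) + conj (g p) * Complex.exp (L p * Complex.I)) := by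
      intro p
      rw [RCLike.re_to_complex, Complex.re_eq_add_conj]; ring
    simp only [h2]
    rw [integral_const_mul, h1, mul_zero]
  have him := ae_eq_zero_of_integral_char_real hg.im fun L => by
    have h1 := integral_sub (hint L g hg) (hint L _ hgc)
    rw [h0 L, hconj L, sub_zero] at h1
    have h2 : ∀ p, ((RCLike.im (g p) : ℝ) : ℂ) * Complex.exp (L p * Complex.I) =
        (1 / (2 * Complex.I)) *
        (g p * Complex.exp (L p * Complex.I) - conj (g p) * Complex.exp (L p * Complex.I)) := by
      intro p
      rw [RCLike.im_to_complex, Complex.im_eq_sub_conj]; ring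
    simp only [h2]
    rw [integral_const_mul, h1, mul_zero]
  filter_upwards [hre, him] with p h1 h2
  exact Complex.ext h1 h2

/-- A polynomial times the ground state, as a vector in `L²`. -/
def polyVec {B : ℝ} (hB : 0 < B) (P : Pol) : L2 := (memLp_polyFun hB P).toLp _

variable {B : ℝ} (hB : 0 < B)

lemma polyVec_ae (P : Pol) : polyVec hB P =ᵐ[volume] polyFun B P := MemLp.coeFn_toLp _

lemma polyVec_add (P Q : Pol) : polyVec hB (P + Q) = polyVec hB P + polyVec hB Q := by
  refine Lp.ext ?_
  filter_upwards [polyVec_ae hB (P + Q), polyVec_ae hB P, polyVec_ae hB Q,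
    Lp.coeFn_add (polyVec hB P) (polyVec hB Q)] with p h1 h2 h3 h4
  rw [h1, h4, Pi.add_apply, h2, h3, polyFun, polyFun, polyFun, polEval_add, add_mul]

lemma polyVec_C_mul (c : ℂ) (P : Pol) : polyVec hB (C c * P) = c • polyVec hB P := by
  refine Lp.ext ?_
  filter_upwards [polyVec_ae hB (C c * P), polyVec_ae hB P,
    Lp.coeFn_smul c (polyVec hB P)] with p h1 h2 h3
  rw [h1, h3, Pi.smul_apply, h2, polyFun, polyFun, polEval_mul, polEval_C, mul_assoc, smul_eq_mul]

/-- `polyVec` as a linear map. -/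
def polyVecL : Pol →ₗ[ℂ] L2 where
  toFun := polyVec hB
  map_add' := polyVec_add hB
  map_smul' c P := by rw [smul_eq_C_mul, polyVec_C_mul, RingHom.id_apply]

lemma ground_ne_zero (p : ℝ × ℝ) : ground B p ≠ 0 := Complex.exp_ne_zero _

/-- Completing the square, |ax + by| costs at most (B/8)(x² + y²) plus a constant, leaving a
Gaussian of rate B/8 to pair with u in L². -/
lemma integrable_exp_mul_ground {B : ℝ} (hB : 0 < B) {u : L2} (a b : ℝ) :
    Integrable (fun p : ℝ × ℝ => ‖conj (ground B p) * u p‖ * Real.exp |a * p.1 + b * p.2|)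
      volume := by
  have h1 : Integrable (fun p : ℝ × ℝ => Real.exp (2 / B * (a ^ 2 + b ^ 2)) *
      (Real.exp (-(B / 8) * (p.1 ^ 2 + p.2 ^ 2)) * ‖u p‖)) volume :=
    ((memLp_gaussian (c := B / 8) (by positivity)).integrable_mul (Lp.memLp u).norm).const_mul _
  have hm : AEStronglyMeasurable (fun p : ℝ × ℝ => ‖conj (ground B p) * u p‖ *
      Real.exp |a * p.1 + b * p.2|) volume := by
    refine AEStronglyMeasurable.mul (AEStronglyMeasurable.norm ?_) ?_
    · exact (Complex.continuous_conj.comp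
        (contDiff_ground B).continuous).aestronglyMeasurable.mul (Lp.aestronglyMeasurable u)
    · exact (by fun_prop : Continuous fun p : ℝ × ℝ =>
        Real.exp |a * p.1 + b * p.2|).aestronglyMeasurable
  refine h1.mono' hm (Eventually.of_forall fun p => ?_)
  rw [norm_mul, norm_norm, norm_mul, RCLike.norm_conj, norm_ground, Real.norm_eq_abs, Real.abs_exp]
  have h2 : |a * p.1 + b * p.2| ≤ B / 8 * (p.1 ^ 2 + p.2 ^ 2) + 2 / B * (a ^ 2 + b ^ 2) := by
    have key : ∀ s t : ℝ, |s * t| ≤ B / 8 * t ^ 2 + 2 / B * s ^ 2 := by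
      intro s t
      rw [abs_le]
      have e : B / 8 * t ^ 2 + 2 / B * s ^ 2 = (8 * B)⁻¹ * ((B * t) ^ 2 + 16 * s ^ 2) := by
        field_simp
        ring
      have e2 : s * t = (8 * B)⁻¹ * (8 * (B * t) * s) := by field_simp
      rw [e, e2]
      constructor
      · rw [← mul_neg]
        exact mul_le_mul_of_nonneg_left (by nlinarith [sq_nonneg (B * t + 4 * s)]) (by positivity)
      · exact mul_le_mul_of_nonneg_left (by nlinarith [sq_nonneg (B * t - 4 * s)]) (by positivity)
    have := key a p.1
    have := key b p.2
    have := abs_add_le (a * p.1) (b * p.2)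
    linarith
  calc Real.exp (-(B / 4) * (p.1 ^ 2 + p.2 ^ 2)) * ‖u p‖ * Real.exp |a * p.1 + b * p.2|
      ≤ Real.exp (-(B / 4) * (p.1 ^ 2 + p.2 ^ 2)) * ‖u p‖ *
        Real.exp (B / 8 * (p.1 ^ 2 + p.2 ^ 2) + 2 / B * (a ^ 2 + b ^ 2)) := by gcongr
    _ = Real.exp (2 / B * (a ^ 2 + b ^ 2)) *
        ((Real.exp (-(B / 4) * (p.1 ^ 2 + p.2 ^ 2)) * Real.exp (B / 8 * (p.1 ^ 2 + p.2 ^ 2)))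
          * ‖u p‖) := by
        rw [Real.exp_add]; ring
    _ = _ := by
        rw [← Real.exp_add]
        congr 3
        ring_nf

/-- Orthogonality to all polynomials kills every term in the power series of the Fourier transform
of g, the conjugate ground state times u. Exponential integrability of g justifies summing under the
integral, and a nowhere vanishing ground state then forces u = 0. -/
lemma eq_zero_of_inner_polyVec {u : L2} (h : ∀ P, inner ℂ (polyVec hB P) u = 0) : u = 0 := by
  set g : ℝ × ℝ → ℂ := fun p => conj (ground B p) * u p with hg
  have hgint : Integrable g volume := by
    have := integrable_exp_mul_ground hB (u := u) 0 0
    refine (integrable_norm_iff ?_).1 (this.congr (Eventually.of_forall fun p => by simp [hg]))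
    exact (Complex.continuous_conj.comp
        (contDiff_ground B).continuous).aestronglyMeasurable.mul (Lp.aestronglyMeasurable u)
  have hP : ∀ P, ∫ p, conj (polEval P p) * g p = 0 := by
    intro P
    rw [← h P, inner_eq_integral (polyVec_ae hB P) (ae_eq_refl _)]
    refine integral_congr_ae (Eventually.of_forall fun p => ?_)
    simp only [polyFun, map_mul, hg]; ring
  have hg0 : g =ᵐ[volume] 0 := by
    refine ae_eq_zero_of_integral_char hgint fun L => ?_
    set a := L (1, 0)
    set b := L (0, 1)
    have hL : ∀ p : ℝ × ℝ, L p = a * p.1 + b * p.2 := by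
      intro p
      have : p = p.1 • ((1, 0) : ℝ × ℝ) + p.2 • ((0, 1) : ℝ × ℝ) := by ext <;> simp
      conv_lhs => rw [this]
      rw [map_add, map_smul, map_smul, smul_eq_mul, smul_eq_mul]; ring
    -- Here ζ̄ + ζ = 2x and ζ - ζ̄ = 2iy. The coefficients are chosen so that the conjugate of Q
    -- evaluates to i(ax + by).
    set Q : Pol := C (-(Complex.I * a / 2)) * (X 0 + X 1) - C (b / 2 : ℂ) * (X 1 - X 0) with hQ
    have hQe : ∀ p, conj (polEval Q p) = (L p : ℂ) * Complex.I := by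
      intro p
      rw [hL, hQ, polEval_sub, polEval_mul, polEval_mul, polEval_add, polEval_sub, polEval_C,
        polEval_C, polEval_X_zero, polEval_X_one, zetaL_apply, zetaBarL_apply]
      simp only [map_sub, map_mul, map_neg, map_add, map_div₀, Complex.conj_I, Complex.conj_ofReal]
      rw [show conj (2 : ℂ) = 2 from Complex.conj_ofNat 2]
      push_cast
      ring
    have hpow : ∀ n : ℕ, ∫ p, ((n.factorial : ℂ)⁻¹ * ((L p : ℂ) * Complex.I) ^ n) * g p = 0 := by
      intro n
      have h1 := hP (Q ^ n)
      have h2 : ∀ p, conj (polEval (Q ^ n) p) = ((L p : ℂ) * Complex.I) ^ n := by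
        intro p
        rw [← hQe, ← map_pow]
        congr 1
        exact map_pow _ _ _
      simp only [h2] at h1
      simp only [mul_assoc]
      rw [integral_const_mul, h1, mul_zero]
    have hsum := hasSum_integral_of_dominated_convergence (μ := (volume : Measure (ℝ × ℝ)))
      (F := fun (n : ℕ) p => ((n.factorial : ℂ)⁻¹ * ((L p : ℂ) * Complex.I) ^ n) * g p)
      (f := fun p => g p * Complex.exp (L p * Complex.I))
      (fun n p => ‖g p‖ * ((n.factorial : ℝ)⁻¹ * |a * p.1 + b * p.2| ^ n))
      (fun n => by
        refine AEStronglyMeasurable.mul ?_ hgint.aestronglyMeasurable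
        exact (by fun_prop : Continuous fun p : ℝ × ℝ =>
          (n.factorial : ℂ)⁻¹ * ((L p : ℂ) * Complex.I) ^ n).aestronglyMeasurable)
      (fun n => Eventually.of_forall fun p => by
        rw [norm_mul, norm_mul, norm_pow, norm_mul, Complex.norm_I, mul_one, Complex.norm_real,
          hL, norm_inv, Complex.norm_natCast, Real.norm_eq_abs, mul_comm])
      (Eventually.of_forall fun p => by
        have := Real.summable_pow_div_factorial |a * p.1 + b * p.2|
        simp only [div_eq_inv_mul] at this
        exact this.mul_left _)
      (by
        refine (integrable_exp_mul_ground hB (u := u) a b).congr (Eventually.of_forall fun p => ?_)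
        simp only [tsum_mul_left]
        congr 1
        rw [Real.exp_eq_exp_ℝ, NormedSpace.exp_eq_tsum_div]
        simp only [div_eq_inv_mul])
      (Eventually.of_forall fun p => by
        have := NormedSpace.expSeries_div_hasSum_exp ((L p : ℂ) * Complex.I)
        rw [← Complex.exp_eq_exp_ℂ] at this
        simp only [div_eq_inv_mul] at this
        have h2 := this.mul_right (g p)
        rwa [mul_comm (Complex.exp _)] at h2)
    simp only [hpow] at hsum
    exact (hasSum_zero.unique hsum).symm
  refine (Lp.eq_zero_iff_ae_eq_zero).2 ?_
  filter_upwards [hg0] with p hp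
  have : conj (ground B p) ≠ 0 := (map_ne_zero _).2 (ground_ne_zero p)
  exact (mul_eq_zero.1 hp).resolve_left this

end Completeness


/-! ### The basis of joint eigenvectors -/

section Basis

open MvPolynomial ComplexConjugate

lemma landauExpr_polyFun (B : ℝ) (P : Pol) :
    magneticExpr B 0 (polyFun B P) = polyFun B (polH B P) := by
  funext p
  rw [landauExpr_apply, momX_polyFun, momX_polyFun, momY_polyFun, momY_polyFun, polyFun, polyFun,
    polyFun, polH, polEval_add, add_mul]

lemma guideExpr_polyFun (B : ℝ) (P : Pol) : guideExpr B (polyFun B P) = polyFun B (polK B P) := by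
  funext p
  rw [guideExpr, guideX_polyFun, guideX_polyFun, guideY_polyFun, guideY_polyFun,
    polyFun, polyFun, polyFun, polK, polEval_add, add_mul]

lemma mom_zero (v : ℝ × ℝ) (l : ℝ × ℝ → ℝ) : mom v l 0 = 0 := by
  funext p
  simp [mom]

lemma polyFun_one_ne_zero (B : ℝ) : polyFun B 1 ≠ 0 := by
  intro h
  have h1 := congrFun h 0
  rw [polyFun, show (1 : Pol) = C 1 from rfl, polEval_C, one_mul] at h1
  exact ground_ne_zero 0 h1

/-- Lowering after raising returns (c + B)P, and c + B > 0, so raising cannot annihilate an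
eigenvector. -/
lemma polyFun_raise₀_ne_zero {B : ℝ} {P : Pol} {c : ℝ} (hc : 0 ≤ c) (hB : 0 < B)
    (hP : polyFun B P ≠ 0) (hH : polH B P = C (c : ℂ) * P) : polyFun B (raise₀ B P) ≠ 0 := by
  intro h
  have h1 := momX_polyFun B (raise₀ B P)
  have h2 := momY_polyFun B (raise₀ B P)
  rw [h, momX_eq_mom, mom_zero] at h1
  rw [h, momY_eq_mom, mom_zero] at h2
  apply hP
  funext p
  have h3 := congrArg (fun Q => polEval Q p * ground B p) (polPiX_add_polPiY_raise₀ B P)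
  rw [hH] at h3
  simp only [polEval_add, polEval_mul, polEval_C, add_mul, mul_assoc] at h3
  have h4 : polEval (polPiX B (raise₀ B P)) p * ground B p = 0 := (congrFun h1 p).symm
  have h5 : polEval (polPiY B (raise₀ B P)) p * ground B p = 0 := (congrFun h2 p).symm
  rw [h4, h5, mul_zero, add_zero, show (2 : Pol) = C 2 from (map_ofNat C 2).symm, polEval_C] at h3
  have h6 : ((c + B : ℝ) : ℂ) * (polEval P p * ground B p) = 0 := by
    rw [h3]; push_cast; ring
  exact (mul_eq_zero.1 h6).resolve_left (by exact_mod_cast (by positivity : c + B ≠ 0))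

lemma polyFun_raise₁_ne_zero {B : ℝ} {P : Pol} {c : ℝ} (hc : 0 ≤ c) (hB : 0 < B)
    (hP : polyFun B P ≠ 0) (hK : polK B P = C (c : ℂ) * P) : polyFun B (raise₁ B P) ≠ 0 := by
  intro h
  have h1 := guideX_polyFun B (raise₁ B P)
  have h2 := guideY_polyFun B (raise₁ B P)
  rw [h, guideX, mom_zero] at h1
  rw [h, guideY, mom_zero] at h2
  apply hP
  funext p
  have h3 := congrArg (fun Q => polEval Q p * ground B p) (polKX_sub_polKY_raise₁ B P)
  rw [hK] at h3
  simp only [polEval_add, polEval_sub, polEval_mul, polEval_C, add_mul, sub_mul, mul_assoc] at h3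
  have h4 : polEval (polKX B (raise₁ B P)) p * ground B p = 0 := (congrFun h1 p).symm
  have h5 : polEval (polKY B (raise₁ B P)) p * ground B p = 0 := (congrFun h2 p).symm
  rw [h4, h5, mul_zero, sub_zero, show (2 : Pol) = C 2 from (map_ofNat C 2).symm, polEval_C] at h3
  have h6 : ((c + B : ℝ) : ℂ) * (polEval P p * ground B p) = 0 := by
    rw [h3]; push_cast; ring
  exact (mul_eq_zero.1 h6).resolve_left (by exact_mod_cast (by positivity : c + B ≠ 0))

lemma polyFun_levelPol_ne_zero {B : ℝ} (hB : 0 < B) (n m : ℕ) :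
    polyFun B (levelPol B n m) ≠ 0 := by
  induction n with
  | zero =>
    induction m with
    | zero => exact polyFun_one_ne_zero B
    | succ m ih =>
      rw [levelPol_zero_succ]
      exact polyFun_raise₁_ne_zero (by positivity) hB ih (polK_levelPol B 0 m)
  | succ n ih =>
    rw [levelPol_succ_left]
    exact polyFun_raise₀_ne_zero (by positivity) hB ih (polH_levelPol B n m)

variable {B : ℝ} (hB : 0 < B)

lemma polyVec_levelPol_ne_zero (n m : ℕ) : polyVec hB (levelPol B n m) ≠ 0 := by
  intro h
  refine polyFun_levelPol_ne_zero hB n m ?_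
  refine (Continuous.ae_eq_iff_eq volume (contDiff_polyFun B _).continuous
    (continuous_const (y := (0 : ℂ)))).1 ?_
  have h1 := polyVec_ae hB (levelPol B n m)
  rw [h] at h1
  exact h1.symm.trans (Lp.coeFn_zero _ _ _)

lemma inner_polyVec_landauExpr {P : Pol} {c : ℝ} (hP : polH B P = C (c : ℂ) * P)
    {f : ℝ × ℝ → ℂ} (hf : IsNice B f) {u w : L2} (hu : u =ᵐ[volume] f)
    (hw : w =ᵐ[volume] magneticExpr B 0 f) :
    inner ℂ (polyVec hB P) w = c * inner ℂ (polyVec hB P) u := by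
  rw [inner_eq_integral (polyVec_ae hB P) hw, inner_eq_integral (polyVec_ae hB P) hu,
    ← integral_conj_landauExpr_mul hB (Or.inl ⟨P, rfl⟩) hf, landauExpr_polyFun, hP,
    ← integral_const_mul]
  refine integral_congr_ae (Eventually.of_forall fun p => ?_)
  simp only [polyFun, polEval_mul, polEval_C, map_mul, Complex.conj_ofReal, mul_assoc]

lemma inner_polyVec_guideExpr {P : Pol} {c : ℝ} (hP : polK B P = C (c : ℂ) * P)
    {f : ℝ × ℝ → ℂ} (hf : IsNice B f) {u w : L2} (hu : u =ᵐ[volume] f)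
    (hw : w =ᵐ[volume] guideExpr B f) :
    inner ℂ (polyVec hB P) w = c * inner ℂ (polyVec hB P) u := by
  rw [inner_eq_integral (polyVec_ae hB P) hw, inner_eq_integral (polyVec_ae hB P) hu,
    ← integral_conj_guideExpr_mul hB (Or.inl ⟨P, rfl⟩) hf, guideExpr_polyFun, hP,
    ← integral_const_mul]
  refine integral_congr_ae (Eventually.of_forall fun p => ?_)
  simp only [polyFun, polEval_mul, polEval_C, map_mul, Complex.conj_ofReal, mul_assoc]

/-- The Landau levels. -/
def level (B : ℝ) (n : ℕ) : ℝ := (2 * n + 1) * B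

lemma level_pos {B : ℝ} (hB : 0 < B) (n : ℕ) : 0 < level B n := by
  unfold level; positivity

lemma level_injective {B : ℝ} (hB : 0 < B) : Function.Injective (level B) := by
  intro n m h
  have h1 := mul_right_cancel₀ hB.ne' h
  have h2 : (n : ℝ) = m := by linarith
  exact_mod_cast h2

/-- The normalising constant of a joint eigenvector. -/
def levelNorm (i : ℕ × ℕ) : ℂ := ((‖polyVec hB (levelPol B i.1 i.2)‖⁻¹ : ℝ) : ℂ)

/-- The normalised joint eigenvectors, as polynomials times the ground state. -/
def basisPol (i : ℕ × ℕ) : Pol := C (levelNorm hB i) * levelPol B i.1 i.2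

lemma polH_C_mul (c : ℂ) (P : Pol) : polH B (C c * P) = C c * polH B P := by
  simp only [polH_eq, pderiv_mul, pderiv_C, zero_mul, zero_add]; ring

lemma polK_C_mul (c : ℂ) (P : Pol) : polK B (C c * P) = C c * polK B P := by
  simp only [polK_eq, pderiv_mul, pderiv_C, zero_mul, zero_add]; ring

lemma polH_basisPol (i : ℕ × ℕ) :
    polH B (basisPol hB i) = C (level B i.1 : ℂ) * basisPol hB i := by
  rw [basisPol, polH_C_mul, polH_levelPol, level]; ring

lemma polK_basisPol (i : ℕ × ℕ) :
    polK B (basisPol hB i) = C (level B i.2 : ℂ) * basisPol hB i := by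
  rw [basisPol, polK_C_mul, polK_levelPol, level]; ring

/-- Distinct indices differ in the Landau level or in the guiding centre level, and the
corresponding symmetric operator separates the eigenvectors. -/
lemma inner_polyVec_basisPol {i j : ℕ × ℕ} (hij : i ≠ j) :
    inner ℂ (polyVec hB (basisPol hB i)) (polyVec hB (basisPol hB j)) = 0 := by
  have key : ∀ {a b : ℝ} {x : ℂ}, a ≠ b → (b : ℂ) * x = a * x → x = 0 := by
    intro a b x hab h
    have h1 : ((b : ℂ) - a) * x = 0 := by rw [sub_mul, h, sub_self]
    exact (mul_eq_zero.1 h1).resolve_left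
      (sub_ne_zero.2 fun h => hab (Complex.ofReal_injective h).symm)
  have hw : ∀ c : ℂ, (c • polyVec hB (basisPol hB j) : L2) =ᵐ[volume]
      polyFun B (C c * basisPol hB j) := by
    intro c
    rw [← polyVec_C_mul]
    exact polyVec_ae hB _
  by_cases h : i.1 = j.1
  · have h2 : level B i.2 ≠ level B j.2 :=
      fun h' => hij (Prod.ext h (level_injective hB h'))
    have h1 := inner_polyVec_guideExpr hB (polK_basisPol hB i)
      (Or.inl ⟨basisPol hB j, rfl⟩) (polyVec_ae hB (basisPol hB j))
      (w := (level B j.2 : ℂ) • polyVec hB (basisPol hB j))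
      (by rw [guideExpr_polyFun, polK_basisPol]; exact hw _)
    rw [inner_smul_right] at h1
    exact key h2 h1
  · have h2 : level B i.1 ≠ level B j.1 := fun h' => h (level_injective hB h')
    have h1 := inner_polyVec_landauExpr hB (polH_basisPol hB i)
      (Or.inl ⟨basisPol hB j, rfl⟩) (polyVec_ae hB (basisPol hB j))
      (w := (level B j.1 : ℂ) • polyVec hB (basisPol hB j))
      (by rw [landauExpr_polyFun, polH_basisPol]; exact hw _)
    rw [inner_smul_right] at h1
    exact key h2 h1

lemma orthonormal_basisPol : Orthonormal ℂ fun i => polyVec hB (basisPol hB i) := by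
  refine ⟨fun i => ?_, fun i j hij => inner_polyVec_basisPol hB hij⟩
  simp only [basisPol]
  rw [polyVec_C_mul, norm_smul, levelNorm, Complex.norm_real, norm_inv, norm_norm,
    inv_mul_cancel₀ (norm_ne_zero_iff.2 (polyVec_levelPol_ne_zero hB _ _))]

lemma orthogonal_span_basisPol :
    (Submodule.span ℂ (Set.range fun i => polyVec hB (basisPol hB i)))ᗮ = ⊥ := by
  rw [Submodule.eq_bot_iff]
  intro u hu
  refine eq_zero_of_inner_polyVec hB fun P => ?_
  have hP : P ∈ Submodule.span ℂ (Set.range fun i : ℕ × ℕ => levelPol B i.1 i.2) := by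
    rw [span_levelPol hB.ne']; trivial
  induction hP using Submodule.span_induction with
  | mem x hx =>
    obtain ⟨i, rfl⟩ := hx
    have h1 := (Submodule.mem_orthogonal _ _).1 hu _ (Submodule.subset_span ⟨i, rfl⟩)
    simp only [basisPol] at h1
    rw [polyVec_C_mul, inner_smul_left] at h1
    refine (mul_eq_zero.1 h1).resolve_left ((map_ne_zero _).2 ?_)
    exact Complex.ofReal_ne_zero.2
      (inv_ne_zero (norm_ne_zero_iff.2 (polyVec_levelPol_ne_zero hB _ _)))
  | zero =>
    rw [show polyVec hB 0 = 0 from (polyVecL hB).map_zero, inner_zero_left]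
  | add x y _ _ hx hy => rw [polyVec_add, inner_add_left, hx, hy, add_zero]
  | smul c x _ hx => rw [smul_eq_C_mul, polyVec_C_mul, inner_smul_left, hx, mul_zero]

/-- The Hilbert basis of joint eigenvectors of the Landau Hamiltonian and of the guiding
centre Hamiltonian. -/
def landauBasis : HilbertBasis (ℕ × ℕ) ℂ L2 :=
  HilbertBasis.mkOfOrthogonalEqBot (orthonormal_basisPol hB) (orthogonal_span_basisPol hB)

lemma landauBasis_apply (i : ℕ × ℕ) : landauBasis hB i = polyVec hB (basisPol hB i) := by
  rw [landauBasis, HilbertBasis.coe_mkOfOrthogonalEqBot]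

end Basis


/-! ### The graph of the Landau Hamiltonian -/

section Graph

open MvPolynomial ComplexConjugate

lemma mom_mul (v : ℝ × ℝ) (l : ℝ × ℝ → ℝ) {χ f : ℝ × ℝ → ℂ} {p : ℝ × ℝ}
    (hχ : DifferentiableAt ℝ χ p) (hf : DifferentiableAt ℝ f p) :
    mom v l (fun q => χ q * f q) p =
      χ p * mom v l f p - Complex.I * fderiv ℝ χ p v * f p := by
  have h : fderiv ℝ (fun q => χ q * f q) p v = χ p * fderiv ℝ f p v + fderiv ℝ χ p v * f p := by
    rw [fderiv_fun_mul hχ hf]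
    simp [mul_comm]
  rw [mom, h, mom]; ring

lemma contDiff_fderiv_apply {χ : ℝ × ℝ → ℂ} (hχ : ContDiff ℝ ∞ χ) (v : ℝ × ℝ) :
    ContDiff ℝ ∞ fun p => fderiv ℝ χ p v :=
  (hχ.fderiv_right (m := ∞) (by simp)).clm_apply contDiff_const

lemma mom_mom_mul (v : ℝ × ℝ) {l : ℝ × ℝ → ℝ} (hl : ContDiff ℝ ∞ l) {χ f : ℝ × ℝ → ℂ}
    (hχ : ContDiff ℝ ∞ χ) (hf : ContDiff ℝ ∞ f) (p : ℝ × ℝ) :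
    mom v l (mom v l fun q => χ q * f q) p =
      χ p * mom v l (mom v l f) p - 2 * Complex.I * fderiv ℝ χ p v * mom v l f p
        - fderiv ℝ (fun q => fderiv ℝ χ q v) p v * f p := by
  have hχ' := contDiff_fderiv_apply hχ v
  have hχ₁ := hχ.differentiable (by simp)
  have hχ₂ := hχ'.differentiable (by simp)
  have hf₁ := hf.differentiable (by simp)
  have hm := (contDiff_mom v hl hf).differentiable (by simp)
  have e : (mom v l fun q => χ q * f q) = (fun q => χ q * mom v l f q) +
      fun q => (-Complex.I * fderiv ℝ χ q v) * f q := by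
    funext q
    rw [mom_mul v l (hχ₁ q) (hf₁ q), Pi.add_apply]; ring
  have hadd : ∀ g h : ℝ × ℝ → ℂ, DifferentiableAt ℝ g p → DifferentiableAt ℝ h p →
      mom v l (g + h) p = mom v l g p + mom v l h p := by
    intro g h hg hh
    simp only [mom, fderiv_add hg hh, Pi.add_apply, add_apply]; ring
  have hd : fderiv ℝ (fun q => -Complex.I * fderiv ℝ χ q v) p v =
      -Complex.I * fderiv ℝ (fun q => fderiv ℝ χ q v) p v := by
    rw [fderiv_const_mul (hχ₂ p)]; rfl
  rw [e, hadd (fun q => χ q * mom v l f q) (fun q => (-Complex.I * fderiv ℝ χ q v) * f q)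
    ((hχ₁ p).mul (hm p)) (((hχ₂ p).const_mul _).mul (hf₁ p)),
    mom_mul v l (hχ₁ p) (hm p), mom_mul v l ((hχ₂ p).const_mul _) (hf₁ p), hd]
  ring_nf
  rw [Complex.I_sq]; ring

lemma norm_sq_eq_integral {u : L2} {f : ℝ × ℝ → ℂ} (hu : u =ᵐ[volume] f) :
    ‖u‖ ^ 2 = ∫ p, ‖f p‖ ^ 2 := by
  have h : inner ℂ u u = ((‖u‖ ^ 2 : ℝ) : ℂ) :=
    (inner_self_eq_norm_sq_to_K u).trans (by push_cast; rfl)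
  rw [inner_eq_integral hu hu] at h
  have e : ∀ p, conj (f p) * f p = ((‖f p‖ ^ 2 : ℝ) : ℂ) := fun p => by
    rw [← Complex.normSq_eq_conj_mul_self, Complex.normSq_eq_norm_sq]
  simp only [e] at h
  rw [integral_complex_ofReal] at h
  exact (Complex.ofReal_injective h).symm

lemma tendsto_mulCLM {θ : ℕ → ℝ × ℝ → ℂ} {M : ℝ} (hθ : ∀ n, AEStronglyMeasurable (θ n) volume)
    (hM : ∀ n p, ‖θ n p‖ ≤ M) (h1 : ∀ p, ∀ᶠ n in atTop, θ n p = 1) (u : L2) :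
    Tendsto (fun n => mulCLM (θ n) M (hθ n) (hM n) u) atTop (𝓝 u) := by
  rw [tendsto_iff_norm_sub_tendsto_zero]
  have hM0 : 0 ≤ M := (norm_nonneg _).trans (hM 0 0)
  have hsq : Tendsto (fun n => ∫ p, ‖(θ n p - 1) * u p‖ ^ 2) atTop (𝓝 (∫ _ : ℝ × ℝ, (0 : ℝ))) := by
    refine tendsto_integral_of_dominated_convergence (fun p => (M + 1) ^ 2 * ‖u p‖ ^ 2)
      (fun n => ?_) ?_ (fun n => Eventually.of_forall fun p => ?_)
      (Eventually.of_forall fun p => ?_)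
    · exact ((((hθ n).sub aestronglyMeasurable_const).mul (Lp.aestronglyMeasurable u)).norm).pow 2
    · exact ((Lp.memLp u).integrable_norm_pow (by norm_num)).const_mul _
    · rw [norm_pow, norm_norm, norm_mul, mul_pow]
      have : ‖θ n p - 1‖ ≤ M + 1 := (norm_sub_le _ _).trans (by simpa using hM n p)
      gcongr
    · refine tendsto_const_nhds.congr' ?_
      filter_upwards [h1 p] with n hn
      rw [hn]; simp
  have e : ∀ n, ‖mulCLM (θ n) M (hθ n) (hM n) u - u‖ =
      Real.sqrt (∫ p, ‖(θ n p - 1) * u p‖ ^ 2) := by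
    intro n
    have hae : (mulCLM (θ n) M (hθ n) (hM n) u - u : L2) =ᵐ[volume] fun p => (θ n p - 1) * u p := by
      filter_upwards [Lp.coeFn_sub (mulCLM (θ n) M (hθ n) (hM n) u) u,
        mulCLM_ae (hθ n) (hM n) u] with p h2 h3
      rw [h2, Pi.sub_apply, h3]; ring
    rw [← norm_sq_eq_integral hae, Real.sqrt_sq (norm_nonneg _)]
  simp only [e]
  have h := (Real.continuous_sqrt.tendsto _).comp hsq
  rw [integral_zero, Real.sqrt_zero] at h
  exact h

/-- A smooth cutoff function on the plane, equal to one near the origin. -/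
def bump : ContDiffBump (0 : ℝ × ℝ) := ⟨1, 2, one_pos, one_lt_two⟩

/-- The cutoff function at scale `c⁻¹`. -/
def scaledBump (c : ℝ) (p : ℝ × ℝ) : ℂ := (bump (c • p) : ℂ)

lemma contDiff_scaledBump (c : ℝ) : ContDiff ℝ ∞ (scaledBump c) :=
  Complex.ofRealCLM.contDiff.comp ((ContDiffBump.contDiff bump).comp (contDiff_const_smul c))

lemma scaledBump_eq (c : ℝ) : scaledBump c = fun p => scaledBump 1 (c • p) := by
  funext p; simp [scaledBump]

lemma norm_scaledBump_le (c : ℝ) (p : ℝ × ℝ) : ‖scaledBump c p‖ ≤ 1 := by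
  rw [scaledBump, Complex.norm_real, Real.norm_of_nonneg bump.nonneg]
  exact bump.le_one

lemma scaledBump_eq_one {c : ℝ} {p : ℝ × ℝ} (h : ‖c • p‖ ≤ 1) : scaledBump c p = 1 := by
  rw [scaledBump, bump.one_of_mem_closedBall (by simpa [bump] using h), Complex.ofReal_one]

lemma hasCompactSupport_scaledBump {c : ℝ} (hc : c ≠ 0) : HasCompactSupport (scaledBump c) := by
  have h1 : HasCompactSupport (scaledBump 1) := by
    have : scaledBump 1 = Complex.ofReal ∘ bump := by funext p; simp [scaledBump]
    rw [this]
    exact bump.hasCompactSupport.comp_left rfl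
  rw [scaledBump_eq]
  exact h1.comp_smul hc

lemma fderiv_comp_const_smul {f : ℝ × ℝ → ℂ} (hf : Differentiable ℝ f) (c : ℝ) (p v : ℝ × ℝ) :
    fderiv ℝ (fun q => f (c • q)) p v = c * fderiv ℝ f (c • p) v := by
  have h : HasFDerivAt (fun q => f (c • q)) _ p :=
    (hf (c • p)).hasFDerivAt.comp p ((hasFDerivAt_id p).const_smul c)
  rw [h.fderiv]
  simp

/-- Each derivative of the dilated bump brings out one factor c. A single K serves all scales. -/
lemma exists_bound_fderiv_scaledBump (v : ℝ × ℝ) : ∃ K, ∀ c p,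
    ‖fderiv ℝ (scaledBump c) p v‖ ≤ |c| * K ∧
    ‖fderiv ℝ (fun q => fderiv ℝ (scaledBump c) q v) p v‖ ≤ |c| ^ 2 * K := by
  have hd := contDiff_fderiv_apply (contDiff_scaledBump 1) v
  have hdd := contDiff_fderiv_apply hd v
  have hs : HasCompactSupport fun p => fderiv ℝ (scaledBump 1) p v :=
    ((hasCompactSupport_scaledBump one_ne_zero).fderiv (𝕜 := ℝ)).comp_left
      (g := fun L : ℝ × ℝ →L[ℝ] ℂ => L v) rfl
  have hss : HasCompactSupport fun p => fderiv ℝ (fun q => fderiv ℝ (scaledBump 1) q v) p v :=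
    (hs.fderiv (𝕜 := ℝ)).comp_left (g := fun L : ℝ × ℝ →L[ℝ] ℂ => L v) rfl
  obtain ⟨K₁, h1⟩ := hd.continuous.bounded_above_of_compact_support hs
  obtain ⟨K₂, h2⟩ := hdd.continuous.bounded_above_of_compact_support hss
  refine ⟨max K₁ K₂, fun c p => ?_⟩
  have e : (fun q => fderiv ℝ (scaledBump c) q v) =
      fun q => (c : ℂ) * fderiv ℝ (scaledBump 1) (c • q) v := by
    funext q
    rw [scaledBump_eq c, fderiv_comp_const_smul ((contDiff_scaledBump 1).differentiable (by simp))]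
  have hcomp : DifferentiableAt ℝ (fun q : ℝ × ℝ => fderiv ℝ (scaledBump 1) (c • q) v) p :=
    ((hd.differentiable (by simp)) (c • p)).comp p (differentiableAt_id.const_smul c)
  constructor
  · rw [congrFun e p, norm_mul, Complex.norm_real, Real.norm_eq_abs]
    exact mul_le_mul_of_nonneg_left ((h1 _).trans (le_max_left _ _)) (abs_nonneg _)
  · rw [e, fderiv_const_mul hcomp]
    change ‖(c : ℂ) * fderiv ℝ (fun q => fderiv ℝ (scaledBump 1) (c • q) v) p v‖ ≤ _
    rw [fderiv_comp_const_smul (hd.differentiable (by simp)), norm_mul, norm_mul, Complex.norm_real,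
      Real.norm_eq_abs, ← mul_assoc, ← pow_two]
    exact mul_le_mul_of_nonneg_left ((h2 _).trans (le_max_right _ _)) (by positivity)

variable {B : ℝ} (hB : 0 < B)

lemma landauExpr_mul {χ f : ℝ × ℝ → ℂ} (hχ : ContDiff ℝ ∞ χ) (hf : ContDiff ℝ ∞ f) (p : ℝ × ℝ) :
    magneticExpr B 0 (fun q => χ q * f q) p = χ p * magneticExpr B 0 f p
      + (-2 * Complex.I * fderiv ℝ χ p (1, 0)) * momX B f p
      + (-2 * Complex.I * fderiv ℝ χ p (0, 1)) * momY f p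
      + -(fderiv ℝ (fun q => fderiv ℝ χ q (1, 0)) p (1, 0) +
        fderiv ℝ (fun q => fderiv ℝ χ q (0, 1)) p (0, 1)) * f p := by
  rw [landauExpr_apply, landauExpr_apply, momX_eq_mom, momY_eq_mom,
    mom_mom_mul _ (contDiff_const.mul contDiff_snd) hχ hf, mom_mom_mul _ contDiff_const hχ hf]
  ring

/-- Multiplying by bumps of scale c → 0 gives test functions. The commutator terms pair O(c) and
O(c²) multipliers with fixed L² vectors, so convergence holds in the graph norm. -/
lemma polyVec_mem_closure_magneticGraph (P : Pol) :
    (polyVec hB P, polyVec hB (polH B P)) ∈ (magneticGraph B 0).topologicalClosure := by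
  obtain ⟨K₁, hK₁⟩ := exists_bound_fderiv_scaledBump (1, 0)
  obtain ⟨K₂, hK₂⟩ := exists_bound_fderiv_scaledBump (0, 1)
  let c : ℕ → ℝ := fun n => 1 / ((n : ℝ) + 1)
  have hc0 : ∀ n, 0 < c n := fun n => by positivity
  have hc : Tendsto c atTop (𝓝 0) := tendsto_one_div_add_atTop_nhds_zero_nat
  have hcs : ∀ n, ContDiff ℝ ∞ (scaledBump (c n)) := fun n => contDiff_scaledBump _
  have hm1 : ∀ n, AEStronglyMeasurable (fun p => -2 * Complex.I *
      fderiv ℝ (scaledBump (c n)) p (1, 0)) volume := fun n =>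
    (contDiff_const.mul (contDiff_fderiv_apply (hcs n) _)).continuous.aestronglyMeasurable
  have hm2 : ∀ n, AEStronglyMeasurable (fun p => -2 * Complex.I *
      fderiv ℝ (scaledBump (c n)) p (0, 1)) volume := fun n =>
    (contDiff_const.mul (contDiff_fderiv_apply (hcs n) _)).continuous.aestronglyMeasurable
  have hm3 : ∀ n, AEStronglyMeasurable (fun p =>
      -(fderiv ℝ (fun q => fderiv ℝ (scaledBump (c n)) q (1, 0)) p (1, 0) +
        fderiv ℝ (fun q => fderiv ℝ (scaledBump (c n)) q (0, 1)) p (0, 1))) volume := fun n =>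
    ((contDiff_fderiv_apply (contDiff_fderiv_apply (hcs n) _) _).add
      (contDiff_fderiv_apply (contDiff_fderiv_apply (hcs n) _) _)).neg.continuous.aestronglyMeasurable
  have hb1 : ∀ n p, ‖-2 * Complex.I * fderiv ℝ (scaledBump (c n)) p (1, 0)‖ ≤
      2 * (|c n| * K₁) := fun n p => by
    rw [norm_mul]
    simpa using (hK₁ (c n) p).1
  have hb2 : ∀ n p, ‖-2 * Complex.I * fderiv ℝ (scaledBump (c n)) p (0, 1)‖ ≤
      2 * (|c n| * K₂) := fun n p => by
    rw [norm_mul]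
    simpa using (hK₂ (c n) p).1
  have hb3 : ∀ n p, ‖-(fderiv ℝ (fun q => fderiv ℝ (scaledBump (c n)) q (1, 0)) p (1, 0) +
        fderiv ℝ (fun q => fderiv ℝ (scaledBump (c n)) q (0, 1)) p (0, 1))‖ ≤
      |c n| ^ 2 * K₁ + |c n| ^ 2 * K₂ := fun n p => by
    rw [norm_neg]
    exact (norm_add_le _ _).trans (add_le_add (hK₁ (c n) p).2 (hK₂ (c n) p).2)
  have hθm : ∀ n, AEStronglyMeasurable (scaledBump (c n)) volume :=
    fun n => (hcs n).continuous.aestronglyMeasurable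
  have hθb : ∀ n p, ‖scaledBump (c n) p‖ ≤ 1 := fun n p => norm_scaledBump_le _ _
  have hθ1 : ∀ p, ∀ᶠ n in atTop, scaledBump (c n) p = 1 := by
    intro p
    have h1 : Tendsto (fun n => ‖c n • p‖) atTop (𝓝 0) := by
      simpa using (hc.smul_const p).norm
    filter_upwards [h1.eventually (ge_mem_nhds one_pos)] with n hn
    exact scaledBump_eq_one hn
  let u : ℕ → L2 := fun n => mulCLM (scaledBump (c n)) 1 (hθm n) (hθb n) (polyVec hB P)
  let w : ℕ → L2 := fun n => mulCLM (scaledBump (c n)) 1 (hθm n) (hθb n) (polyVec hB (polH B P))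
    + mulCLM _ _ (hm1 n) (hb1 n) (polyVec hB (polPiX B P))
    + mulCLM _ _ (hm2 n) (hb2 n) (polyVec hB (polPiY B P))
    + mulCLM _ _ (hm3 n) (hb3 n) (polyVec hB P)
  have hsmall : ∀ (v : ℕ → ℝ × ℝ → ℂ) (M : ℕ → ℝ) (hv : ∀ n, AEStronglyMeasurable (v n) volume)
      (hM : ∀ n p, ‖v n p‖ ≤ M n) (_ : Tendsto M atTop (𝓝 0)) (x : L2),
      Tendsto (fun n => mulCLM (v n) (M n) (hv n) (hM n) x) atTop (𝓝 0) := by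
    intro v M hv hM h x
    refine squeeze_zero_norm (a := fun n => M n * ‖x‖) (fun n => ?_)
      (by simpa using h.mul_const ‖x‖)
    exact (ContinuousLinearMap.le_opNorm _ _).trans
      (mul_le_mul_of_nonneg_right (norm_mulCLM_le _ _) (norm_nonneg _))
  have hca : Tendsto (fun n => |c n|) atTop (𝓝 0) := by simpa using hc.abs
  refine mem_closure_of_tendsto (f := fun n => (u n, w n)) (b := atTop) ?_
    (Eventually.of_forall fun n => ?_)
  · refine Tendsto.prodMk_nhds (tendsto_mulCLM hθm hθb hθ1 _) ?_
    have h := (((tendsto_mulCLM hθm hθb hθ1 (polyVec hB (polH B P))).add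
      (hsmall _ _ hm1 hb1 (by simpa using (hca.mul_const K₁).const_mul 2)
        (polyVec hB (polPiX B P)))).add
      (hsmall _ _ hm2 hb2 (by simpa using (hca.mul_const K₂).const_mul 2)
        (polyVec hB (polPiY B P)))).add
      (hsmall _ _ hm3 hb3 (by simpa using ((hca.pow 2).mul_const K₁).add ((hca.pow 2).mul_const K₂))
        (polyVec hB P))
    simp only [add_zero] at h
    exact h
  · refine ⟨fun p => scaledBump (c n) p * polyFun B P p, (hcs n).mul (contDiff_polyFun B P),
      (hasCompactSupport_scaledBump (hc0 n).ne').mul_right, ?_, ?_⟩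
    · filter_upwards [mulCLM_ae (hθm n) (hθb n) (polyVec hB P), polyVec_ae hB P] with p h1 h2
      change mulCLM _ _ _ _ _ p = _
      rw [h1, h2]
    · filter_upwards [mulCLM_ae (hθm n) (hθb n) (polyVec hB (polH B P)), polyVec_ae hB P,
        polyVec_ae hB (polH B P), polyVec_ae hB (polPiX B P), polyVec_ae hB (polPiY B P),
        mulCLM_ae (hm1 n) (hb1 n) (polyVec hB (polPiX B P)),
        mulCLM_ae (hm2 n) (hb2 n) (polyVec hB (polPiY B P)),
        mulCLM_ae (hm3 n) (hb3 n) (polyVec hB P),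
        Lp.coeFn_add (mulCLM (scaledBump (c n)) 1 (hθm n) (hθb n) (polyVec hB (polH B P))
          + mulCLM _ _ (hm1 n) (hb1 n) (polyVec hB (polPiX B P))
          + mulCLM _ _ (hm2 n) (hb2 n) (polyVec hB (polPiY B P)))
          (mulCLM _ _ (hm3 n) (hb3 n) (polyVec hB P)),
        Lp.coeFn_add (mulCLM (scaledBump (c n)) 1 (hθm n) (hθb n) (polyVec hB (polH B P))
          + mulCLM _ _ (hm1 n) (hb1 n) (polyVec hB (polPiX B P)))
          (mulCLM _ _ (hm2 n) (hb2 n) (polyVec hB (polPiY B P))),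
        Lp.coeFn_add (mulCLM (scaledBump (c n)) 1 (hθm n) (hθb n) (polyVec hB (polH B P)))
          (mulCLM _ _ (hm1 n) (hb1 n) (polyVec hB (polPiX B P)))]
        with p h1 h2 h3 h4 h5 h6 h7 h8 h9 h10 h11
      rw [landauExpr_mul (hcs n) (contDiff_polyFun B P), landauExpr_polyFun, momX_polyFun,
        momY_polyFun, ← h2, ← h3, ← h4, ← h5, ← h1, ← h6, ← h7, ← h8]
      refine h9.trans ?_
      rw [Pi.add_apply, h10, Pi.add_apply, h11, Pi.add_apply]

/-- The graph of the operator with eigenvalues `lam` in the Hilbert basis `b`. -/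
def diagonalGraph {ι : Type*} (b : HilbertBasis ι ℂ L2) (lam : ι → ℝ) : Submodule ℂ (L2 × L2) where
  carrier := {q | ∀ i, inner ℂ (b i) q.2 = lam i * inner ℂ (b i) q.1}
  zero_mem' := by simp
  add_mem' := by
    intro q r hq hr i
    rw [Prod.fst_add, Prod.snd_add, inner_add_right, inner_add_right, hq i, hr i, mul_add]
  smul_mem' := by
    intro c q hq i
    rw [Prod.smul_fst, Prod.smul_snd, inner_smul_right, inner_smul_right, hq i]; ring

lemma isClosed_diagonalGraph {ι : Type*} (b : HilbertBasis ι ℂ L2) (lam : ι → ℝ) :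
    IsClosed (diagonalGraph b lam : Set (L2 × L2)) := by
  have : (diagonalGraph b lam : Set (L2 × L2)) =
      ⋂ i, {q | inner ℂ (b i) q.2 = lam i * inner ℂ (b i) q.1} := by
    ext q; simp [diagonalGraph]
  rw [this]
  exact isClosed_iInter fun i => isClosed_eq (by fun_prop) (by fun_prop)

lemma eq_zero_of_mem_diagonalGraph {ι : Type*} {b : HilbertBasis ι ℂ L2} {lam : ι → ℝ}
    {q : L2 × L2} (hq : q ∈ diagonalGraph b lam) (h0 : q.1 = 0) : q.2 = 0 := by
  refine b.repr.injective (lp.ext (funext fun i => ?_))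
  rw [b.repr_apply_apply, hq i, h0, inner_zero_right, mul_zero, map_zero]
  rfl

/-- Essential self-adjointness on test functions. One inclusion is symmetry against the eigenvectors
plus closedness; for the other, eigenpairs lie in the closure and every pair of the diagonal graph
is the limit of its simultaneous partial expansions. -/
lemma topologicalClosure_magneticGraph :
    (magneticGraph B 0).topologicalClosure =
      diagonalGraph (landauBasis hB) fun i => level B i.1 := by
  refine le_antisymm ?_ ?_
  · refine Submodule.topologicalClosure_minimal _ ?_ (isClosed_diagonalGraph _ _)
    rintro q ⟨φ, h1, h2, h3, h4⟩ i
    rw [landauBasis_apply]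
    exact inner_polyVec_landauExpr hB (polH_basisPol hB i) (Or.inr ⟨h1, h2⟩) h3 h4
  · rintro ⟨u, v⟩ hq
    have hb : ∀ i, (landauBasis hB i, (level B i.1 : ℂ) • landauBasis hB i) ∈
        (magneticGraph B 0).topologicalClosure := by
      intro i
      have := polyVec_mem_closure_magneticGraph hB (basisPol hB i)
      rwa [polH_basisPol, polyVec_C_mul, ← landauBasis_apply] at this
    have hu := (landauBasis hB).hasSum_repr u
    have hv := (landauBasis hB).hasSum_repr v
    refine (Submodule.isClosed_topologicalClosure _).mem_of_tendsto (hu.prodMk hv)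
      (Eventually.of_forall fun s => ?_)
    refine Submodule.sum_mem _ fun i _ => ?_
    have := Submodule.smul_mem _ ((landauBasis hB).repr u i) (hb i)
    convert! this using 1
    rw [Prod.smul_mk, (landauBasis hB).repr_apply_apply, (landauBasis hB).repr_apply_apply, hq i,
      smul_smul, mul_comm]

lemma graph_landauOp :
    (landauOp B).graph = diagonalGraph (landauBasis hB) fun i => level B i.1 := by
  have hg : (magneticGraph B 0).toLinearPMap.graph = magneticGraph B 0 :=
    Submodule.toLinearPMap_graph_eq _ (magneticGraph_single_valued B 0)
  have hcl : (magneticGraph B 0).toLinearPMap.IsClosable := by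
    refine ⟨(diagonalGraph (landauBasis hB) fun i => level B i.1).toLinearPMap, ?_⟩
    rw [hg, topologicalClosure_magneticGraph hB, Submodule.toLinearPMap_graph_eq _
      fun q hq h => eq_zero_of_mem_diagonalGraph hq h]
  rw [landauOp, magneticOp, ← hcl.graph_closure_eq_closure_graph, hg,
    topologicalClosure_magneticGraph hB]

end Graph


/-! ### Diagonal operators -/

section Diagonal

open ComplexConjugate

variable {ι : Type*} (b : HilbertBasis ι ℂ L2) {c : ι → ℂ} {M : ℝ}

lemma eq_of_inner_basis_eq {x y : L2} (h : ∀ i, inner ℂ (b i) x = inner ℂ (b i) y) : x = y := by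
  refine b.repr.injective (lp.ext (funext fun i => ?_))
  rw [b.repr_apply_apply, b.repr_apply_apply, h i]

lemma hasSum_norm_inner_sq (x : L2) : HasSum (fun i => ‖inner ℂ (b i) x‖ ^ 2) (‖x‖ ^ 2) := by
  have h := b.hasSum_inner_mul_inner x x
  rw [show inner ℂ x x = ((‖x‖ ^ 2 : ℝ) : ℂ) from
    (inner_self_eq_norm_sq_to_K x).trans (by push_cast; rfl)] at h
  have e : ∀ i, inner ℂ x (b i) * inner ℂ (b i) x = ((‖inner ℂ (b i) x‖ ^ 2 : ℝ) : ℂ) := fun i => by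
    rw [← inner_conj_symm, ← Complex.normSq_eq_conj_mul_self, Complex.normSq_eq_norm_sq]
  simp only [e] at h
  exact Complex.hasSum_ofReal.1 h

lemma memℓp_mul (hc : ∀ i, ‖c i‖ ≤ M) (x : L2) : Memℓp (fun i => c i * b.repr x i) 2 := by
  have hx := ((lp.memℓp (b.repr x)).summable (by norm_num)).mul_left (M ^ 2)
  refine memℓp_gen (hx.of_nonneg_of_le (fun i => by positivity) fun i => ?_)
  simp only [ENNReal.toReal_ofNat, Real.rpow_ofNat, norm_mul, mul_pow]
  have := hc i
  gcongr

/-- The bounded operator with eigenvalues `c` in the Hilbert basis `b`. -/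
def diagonalCLM (hc : ∀ i, ‖c i‖ ≤ M) : L2 →L[ℂ] L2 :=
  LinearMap.mkContinuous
    { toFun := fun x => b.repr.symm ⟨_, memℓp_mul b hc x⟩
      map_add' := fun x y => eq_of_inner_basis_eq b fun i => by
        rw [inner_add_right, ← b.repr_apply_apply, ← b.repr_apply_apply, ← b.repr_apply_apply,
          LinearIsometryEquiv.apply_symm_apply, LinearIsometryEquiv.apply_symm_apply,
          LinearIsometryEquiv.apply_symm_apply]
        change c i * b.repr (x + y) i = c i * b.repr x i + c i * b.repr y i
        rw [map_add, lp.coeFn_add, Pi.add_apply, mul_add]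
      map_smul' := fun a x => eq_of_inner_basis_eq b fun i => by
        rw [RingHom.id_apply, inner_smul_right, ← b.repr_apply_apply, ← b.repr_apply_apply,
          LinearIsometryEquiv.apply_symm_apply, LinearIsometryEquiv.apply_symm_apply]
        change c i * b.repr (a • x) i = a * (c i * b.repr x i)
        rw [map_smul, lp.coeFn_smul, Pi.smul_apply, smul_eq_mul]; ring } |M|
    fun x => by
      refine abs_le_of_sq_le_sq' (a := ‖_‖) ?_ (by positivity) |>.2
      rw [mul_pow, sq_abs]
      refine hasSum_le (fun i => ?_) (hasSum_norm_inner_sq b _)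
        ((hasSum_norm_inner_sq b x).mul_left (M ^ 2))
      rw [← b.repr_apply_apply]
      change ‖b.repr (b.repr.symm ⟨_, memℓp_mul b hc x⟩) i‖ ^ 2 ≤ _
      rw [LinearIsometryEquiv.apply_symm_apply]
      change ‖c i * b.repr x i‖ ^ 2 ≤ _
      rw [b.repr_apply_apply, norm_mul, mul_pow]
      have := hc i
      gcongr

lemma inner_diagonalCLM (hc : ∀ i, ‖c i‖ ≤ M) (x : L2) (i : ι) :
    inner ℂ (b i) (diagonalCLM b hc x) = c i * inner ℂ (b i) x := by
  rw [← b.repr_apply_apply, ← b.repr_apply_apply]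
  change b.repr (b.repr.symm ⟨_, memℓp_mul b hc x⟩) i = _
  rw [LinearIsometryEquiv.apply_symm_apply]

lemma norm_diagonalCLM_le (hc : ∀ i, ‖c i‖ ≤ M) : ‖diagonalCLM b hc‖ ≤ |M| :=
  LinearMap.mkContinuous_norm_le _ (abs_nonneg _) _

variable {b} {T : L2 →ₗ.[ℂ] L2} {lam : ι → ℝ}

lemma inner_basis_apply (hT : T.graph = diagonalGraph b lam)
    (x : T.domain) (i : ι) :
    inner ℂ (b i) (T x) = lam i * inner ℂ (b i) (x : L2) := by
  have h := T.mem_graph x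
  rw [hT] at h
  exact h i

lemma isFormalAdjoint_of_graph_eq (hT : T.graph = diagonalGraph b lam) :
    T.IsFormalAdjoint T := by
  intro x y
  rw [← b.tsum_inner_mul_inner, ← b.tsum_inner_mul_inner]
  refine tsum_congr fun i => ?_
  rw [← inner_conj_symm, inner_basis_apply hT, inner_basis_apply hT, map_mul, Complex.conj_ofReal,
    inner_conj_symm]
  ring

lemma isResolventAt_diagonalCLM (hT : T.graph = diagonalGraph b lam)
    {z : ℂ} {δ : ℝ} (hδ : 0 < δ) (h : ∀ i, δ ≤ ‖(lam i : ℂ) - z‖) :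
    IsResolventAt T z (diagonalCLM b (c := fun i => ((lam i : ℂ) - z)⁻¹) (M := δ⁻¹) fun i => by
      rw [norm_inv]; exact inv_anti₀ hδ (h i)) := by
  have hne : ∀ i, (lam i : ℂ) - z ≠ 0 := fun i => norm_pos_iff.1 (hδ.trans_le (h i))
  set R := diagonalCLM b (c := fun i => ((lam i : ℂ) - z)⁻¹) (M := δ⁻¹) fun i => by
      rw [norm_inv]; exact inv_anti₀ hδ (h i)
  have hR : ∀ x i, inner ℂ (b i) (R x) = ((lam i : ℂ) - z)⁻¹ * inner ℂ (b i) x :=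
    inner_diagonalCLM b _
  constructor
  · intro ψ
    have hmem : (R ψ, ψ + z • R ψ) ∈ T.graph := by
      rw [hT]
      intro i
      change inner ℂ (b i) (ψ + z • R ψ) = lam i * inner ℂ (b i) (R ψ)
      rw [inner_add_right, inner_smul_right, hR]
      field_simp [hne i]
      ring
    obtain ⟨y, hy1, hy2⟩ := T.mem_graph_iff.1 hmem
    simp only at hy1 hy2
    have hy : R ψ ∈ T.domain := hy1 ▸ y.2
    refine ⟨hy, ?_⟩
    have : (⟨R ψ, hy⟩ : T.domain) = y := Subtype.ext hy1.symm
    rw [this, hy2, add_sub_cancel_right]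
  · intro ψ
    refine eq_of_inner_basis_eq b fun i => ?_
    rw [hR, inner_sub_right, inner_smul_right, inner_basis_apply hT, ← sub_mul, ← mul_assoc,
      inv_mul_cancel₀ (hne i), one_mul]

end Diagonal

/-! ### Spectrum of the Landau Hamiltonian -/

section LandauSpectrum

variable {B : ℝ}

/-- The levels tend to infinity, so the distance from z to them is attained. -/
lemma exists_pos_le_norm_level_sub (hB : 0 < B) {z : ℂ} (hz : ∀ n, z ≠ (level B n : ℂ)) :
    ∃ δ > 0, ∀ n, δ ≤ ‖(level B n : ℂ) - z‖ := by
  have h1 : Tendsto (fun n : ℕ => ‖(level B n : ℂ) - z‖) atTop atTop := by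
    have h2 : Tendsto (fun n : ℕ => level B n - ‖z‖) atTop atTop := by
      refine tendsto_atTop_add_const_right _ _ ?_
      refine Tendsto.atTop_mul_const hB ?_
      exact tendsto_atTop_add_const_right _ _
        (tendsto_natCast_atTop_atTop.const_mul_atTop two_pos)
    refine tendsto_atTop_mono (fun n => ?_) h2
    have h3 := norm_sub_norm_le (level B n : ℂ) z
    rwa [Complex.norm_real, Real.norm_of_nonneg (level_pos hB n).le] at h3
  rw [← Nat.cofinite_eq_atTop, ← cocompact_eq_cofinite] at h1
  obtain ⟨n, hn⟩ := continuous_of_discreteTopology.exists_forall_le h1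
  exact ⟨_, norm_pos_iff.2 (sub_ne_zero.2 (hz n).symm), hn⟩

lemma isFormalAdjoint_landauOp (hB : 0 < B) : (landauOp B).IsFormalAdjoint (landauOp B) :=
  isFormalAdjoint_of_graph_eq (graph_landauOp hB)

lemma mem_resolventSet_landauOp (hB : 0 < B) {z : ℂ} (hz : ∀ n, z ≠ (level B n : ℂ)) :
    z ∈ resolventSet (landauOp B) := by
  obtain ⟨δ, hδ, h⟩ := exists_pos_le_norm_level_sub hB hz
  exact ⟨_, isResolventAt_diagonalCLM (graph_landauOp hB) hδ fun i => h i.1⟩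

lemma exists_isResolventAt_landauOp (hB : 0 < B) {K : ℝ} (hK : 0 < K) :
    ∃ A, IsResolventAt (landauOp B) ((-K : ℝ) : ℂ) A ∧ ‖A‖ ≤ K⁻¹ := by
  have h : ∀ i : ℕ × ℕ, K ≤ ‖(level B i.1 : ℂ) - ((-K : ℝ) : ℂ)‖ := by
    intro i
    rw [← Complex.ofReal_sub, Complex.norm_real, Real.norm_eq_abs]
    have := level_pos hB i.1
    exact le_trans (by linarith) (le_abs_self _)
  refine ⟨_, isResolventAt_diagonalCLM (graph_landauOp hB) hK h, ?_⟩
  refine (norm_diagonalCLM_le _ _).trans ?_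
  rw [abs_of_pos (inv_pos.2 hK)]

/-- The eigenvectors with fixed n and varying guiding centre index are an infinite orthonormal
sequence in one eigenspace. -/
lemma not_hasSeqCompactKernel_landauOp (hB : 0 < B) (n : ℕ) :
    ¬ HasSeqCompactKernel (landauOp B) (level B n : ℂ) := by
  intro h
  set b := landauBasis hB
  have hmem : ∀ k : ℕ, (b (n, k), (level B n : ℂ) • b (n, k)) ∈ (landauOp B).graph := by
    intro k
    rw [graph_landauOp hB]
    rintro ⟨i, j⟩
    change inner ℂ (b (i, j)) ((level B n : ℂ) • b (n, k)) =
      level B i * inner ℂ (b (i, j)) (b (n, k))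
    rw [inner_smul_right]
    by_cases hi : (i, j) = (n, k)
    · rw [show i = n from congrArg Prod.fst hi]
    · rw [b.orthonormal.2 hi, mul_zero, mul_zero]
  choose y hy1 hy2 using fun k => (landauOp B).mem_graph_iff.1 (hmem k)
  simp only at hy1 hy2
  obtain ⟨φ, hφ, x, hx⟩ := h y 0 ⟨1, fun k => by rw [hy1, b.orthonormal.1]⟩
    (by simp only [hy1, hy2, sub_self]; exact tendsto_const_nhds)
  simp only [hy1] at hx
  have h1 : ‖x‖ = 1 := by
    refine tendsto_nhds_unique hx.norm ?_
    simp only [b.orthonormal.1]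
    exact tendsto_const_nhds
  -- Pair the subsequence with its shift by one: consecutive terms are orthogonal.
  have h2 : inner ℂ x x = (0 : ℂ) := by
    refine tendsto_nhds_unique (hx.inner (hx.comp (tendsto_add_atTop_nat 1))) ?_
    refine tendsto_const_nhds.congr fun k => (b.orthonormal.2 fun h => ?_).symm
    exact (Nat.succ_ne_self k).symm (hφ.injective (congrArg Prod.snd h))
  rw [inner_self_eq_zero] at h2
  rw [h2, norm_zero] at h1
  exact zero_ne_one h1

lemma essSpec_landauOp (hB : 0 < B) :
    essSpec (landauOp B) = {z : ℂ | ∃ n : ℕ, z = (level B n : ℂ)} := by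
  obtain ⟨A, hA, -⟩ := exists_isResolventAt_landauOp hB one_pos
  ext z
  constructor
  · intro hz
    by_contra hn
    exact hz.1 (mem_resolventSet_landauOp hB fun n h => hn ⟨n, h⟩)
  · rintro ⟨n, rfl⟩
    exact (hA.mem_essSpec_iff (isFormalAdjoint_landauOp hB)).2
      (not_hasSeqCompactKernel_landauOp hB n)

end LandauSpectrum


/-! ### Relative compactness of localised potentials -/

section Compactness

open ComplexConjugate

lemma integral_conj_mul_self (f : ℝ × ℝ → ℂ) :
    ∫ p, conj (f p) * f p = ((∫ p, ‖f p‖ ^ 2 : ℝ) : ℂ) := by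
  have e : ∀ p, conj (f p) * f p = ((‖f p‖ ^ 2 : ℝ) : ℂ) := fun p => by
    rw [← Complex.normSq_eq_conj_mul_self, Complex.normSq_eq_norm_sq]
  simp only [e]
  rw [integral_complex_ofReal]

lemma integral_norm_sq_le {F a n : ℝ × ℝ → ℂ} {L : ℝ} (ha : MemLp a 2 volume)
    (hn : MemLp n 2 volume) (h : ∀ p, ‖F p‖ ≤ L * (‖a p‖ + 2 * ‖n p‖)) :
    ∫ p, ‖F p‖ ^ 2 ≤ L ^ 2 * (2 * ∫ p, ‖a p‖ ^ 2) + L ^ 2 * (8 * ∫ p, ‖n p‖ ^ 2) := by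
  have ha' : Integrable (fun p => L ^ 2 * (2 * ‖a p‖ ^ 2)) volume :=
    ((ha.integrable_norm_pow (by norm_num)).const_mul _).const_mul _
  have hn' : Integrable (fun p => L ^ 2 * (8 * ‖n p‖ ^ 2)) volume :=
    ((hn.integrable_norm_pow (by norm_num)).const_mul _).const_mul _
  rw [← integral_const_mul, ← integral_const_mul, ← integral_const_mul, ← integral_const_mul,
    ← integral_add ha' hn']
  refine integral_mono_of_nonneg (Eventually.of_forall fun p => by positivity) (ha'.add hn')
    (Eventually.of_forall fun p => ?_)
  calc ‖F p‖ ^ 2 ≤ (L * (‖a p‖ + 2 * ‖n p‖)) ^ 2 := pow_le_pow_left₀ (norm_nonneg _) (h p) 2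
    _ = L ^ 2 * (‖a p‖ + 2 * ‖n p‖) ^ 2 := mul_pow _ _ _
    _ ≤ L ^ 2 * (2 * ‖a p‖ ^ 2 + 8 * ‖n p‖ ^ 2) := by
      refine mul_le_mul_of_nonneg_left ?_ (sq_nonneg L)
      nlinarith [sq_nonneg (‖a p‖ - 2 * ‖n p‖)]
    _ = _ := by ring

variable {B : ℝ}

/-- The quadratic forms of the Landau and of the guiding centre Hamiltonian, in terms of the
coefficients in the basis of joint eigenvectors. -/
lemma hasSum_level_mul_norm_inner_sq (hB : 0 < B) {f : ℝ × ℝ → ℂ} (hf : IsNice B f) {g : L2}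
    (hg : g =ᵐ[volume] f) :
    HasSum (fun i => (level B i.1 + level B i.2) * ‖inner ℂ (landauBasis hB i) g‖ ^ 2)
      (((∫ p, ‖momX B f p‖ ^ 2) + ∫ p, ‖momY f p‖ ^ 2) +
        ((∫ p, ‖guideX f p‖ ^ 2) + ∫ p, ‖guideY B f p‖ ^ 2)) := by
  have key : ∀ (E : ℝ × ℝ → ℂ) (hE : MemLp E 2 volume) (l : ℕ × ℕ → ℝ) (X Y : ℝ),
      (∀ i, inner ℂ (landauBasis hB i) (hE.toLp E) = l i * inner ℂ (landauBasis hB i) g) →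
      ∫ p, conj (f p) * E p = (X : ℂ) + (Y : ℂ) →
      HasSum (fun i => l i * ‖inner ℂ (landauBasis hB i) g‖ ^ 2) (X + Y) := by
    intro E hE l X Y h1 h2
    have h := (landauBasis hB).hasSum_inner_mul_inner g (hE.toLp E)
    rw [inner_eq_integral hg (MemLp.coeFn_toLp hE), h2, ← Complex.ofReal_add] at h
    refine Complex.hasSum_ofReal.1 (h.congr_fun ?_)
    intro i
    rw [h1, mul_left_comm, ← inner_conj_symm g, ← Complex.normSq_eq_conj_mul_self,
      Complex.normSq_eq_norm_sq]
    push_cast; rfl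
  have hH := key _ (hf.landauExpr.memLp hB) (fun i => level B i.1) _ _
    (fun i => by
      rw [landauBasis_apply]
      exact inner_polyVec_landauExpr hB (polH_basisPol hB i) hf hg (MemLp.coeFn_toLp _))
    (by rw [integral_conj_mul_landauExpr hB hf hf, integral_conj_mul_self, integral_conj_mul_self])
  have hK := key _ (hf.guideExpr.memLp hB) (fun i => level B i.2) _ _
    (fun i => by
      rw [landauBasis_apply]
      exact inner_polyVec_guideExpr hB (polK_basisPol hB i) hf hg (MemLp.coeFn_toLp _))
    (by rw [integral_conj_mul_guideExpr hB hf hf, integral_conj_mul_self, integral_conj_mul_self])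
  simpa only [add_mul] using hH.add hK

lemma exists_bound_localised {χ : ℝ × ℝ → ℂ} (hχ : ContDiff ℝ ∞ χ) (hχs : HasCompactSupport χ) :
    ∃ K, 0 ≤ K ∧ ∀ p : ℝ × ℝ, ‖χ p‖ ≤ K ∧ ‖fderiv ℝ χ p (1, 0)‖ ≤ K ∧ ‖fderiv ℝ χ p (0, 1)‖ ≤ K ∧
      ‖(p.1 : ℂ) * χ p‖ ≤ K ∧ ‖(p.2 : ℂ) * χ p‖ ≤ K := by
  have hd : ∀ v : ℝ × ℝ, HasCompactSupport fun p => fderiv ℝ χ p v := fun v =>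
    (hχs.fderiv (𝕜 := ℝ)).comp_left (g := fun L : ℝ × ℝ →L[ℝ] ℂ => L v) rfl
  have hc : ∀ v : ℝ × ℝ, Continuous fun p => fderiv ℝ χ p v :=
    fun v => (contDiff_fderiv_apply hχ v).continuous
  have hχc := hχ.continuous
  obtain ⟨K₀, h0⟩ := hχc.bounded_above_of_compact_support hχs
  obtain ⟨K₁, h1⟩ := (hc (1, 0)).bounded_above_of_compact_support (hd _)
  obtain ⟨K₂, h2⟩ := (hc (0, 1)).bounded_above_of_compact_support (hd _)
  obtain ⟨K₃, h3⟩ := (by fun_prop : Continuous fun p : ℝ × ℝ => (p.1 : ℂ) *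
    χ p).bounded_above_of_compact_support (hχs.mul_left (f := fun p : ℝ × ℝ => (p.1 : ℂ)))
  obtain ⟨K₄, h4⟩ := (by fun_prop : Continuous fun p : ℝ × ℝ => (p.2 : ℂ) *
    χ p).bounded_above_of_compact_support (hχs.mul_left (f := fun p : ℝ × ℝ => (p.2 : ℂ)))
  have p0 := (norm_nonneg _).trans (h0 0)
  have p1 := (norm_nonneg _).trans (h1 0)
  have p2 := (norm_nonneg _).trans (h2 0)
  have p3 := (norm_nonneg _).trans (h3 0)
  have p4 := (norm_nonneg _).trans (h4 0)
  refine ⟨K₀ + K₁ + K₂ + K₃ + K₄, by positivity, fun p => ?_⟩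
  have := h0 p
  have := h1 p
  have := h2 p
  have := h3 p
  have := h4 p
  refine ⟨?_, ?_, ?_, ?_, ?_⟩ <;> linarith

/-- The guiding centre momenta differ from the kinetic ones only by -By and Bx, which are bounded on
the support of χ. A cutoff therefore bounds the energy of both Hamiltonians by that of the Landau
Hamiltonian and the L² norm. -/
lemma exists_energy_bound (hB : 0 < B)
    {χ : ℝ × ℝ → ℂ} (hχ : ContDiff ℝ ∞ χ) (hχs : HasCompactSupport χ) :
    ∃ D, 0 ≤ D ∧ ∀ u : ℝ × ℝ → ℂ, ContDiff ℝ ∞ u → HasCompactSupport u →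
      ((∫ p, ‖momX B (fun q => χ q * u q) p‖ ^ 2) + ∫ p, ‖momY (fun q => χ q * u q) p‖ ^ 2) +
        ((∫ p, ‖guideX (fun q => χ q * u q) p‖ ^ 2) + ∫ p, ‖guideY B (fun q => χ q * u q) p‖ ^ 2)
      ≤ D * (((∫ p, ‖momX B u p‖ ^ 2) + ∫ p, ‖momY u p‖ ^ 2) + ∫ p, ‖u p‖ ^ 2) := by
  obtain ⟨K, hK0, hK⟩ := exists_bound_localised hχ hχs
  -- The constant is 4 · 8: each of the four integrals contributes 8((1 + B)K)² times the squared
  -- norm of u.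
  refine ⟨32 * ((1 + B) * K) ^ 2, by positivity, fun u hu hus => ?_⟩
  have hn : IsNice B u := Or.inr ⟨hu, hus⟩
  have hχ₁ := hχ.differentiable (by simp)
  have hu₁ := hu.differentiable (by simp)
  have hX : ∀ p, ‖momX B (fun q => χ q * u q) p‖ ≤ K * (‖momX B u p‖ + ‖u p‖) := by
    intro p
    obtain ⟨h0, h1, h2, h3, h4⟩ := hK p
    rw [momX_eq_mom, mom_mul _ _ (hχ₁ p) (hu₁ p)]
    refine (norm_sub_le _ _).trans ?_
    rw [norm_mul, norm_mul, norm_mul, Complex.norm_I, one_mul, mul_add]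
    gcongr
  have hY : ∀ p, ‖momY (fun q => χ q * u q) p‖ ≤ K * (‖momY u p‖ + ‖u p‖) := by
    intro p
    obtain ⟨h0, h1, h2, h3, h4⟩ := hK p
    rw [momY_eq_mom, mom_mul _ _ (hχ₁ p) (hu₁ p)]
    refine (norm_sub_le _ _).trans ?_
    rw [norm_mul, norm_mul, norm_mul, Complex.norm_I, one_mul, mul_add]
    gcongr
  have hle : ∀ a n : ℝ, 0 ≤ a → 0 ≤ n → K * (a + n) + B * (K * n) ≤ (1 + B) * K * (a + 2 * n) := by
    intro a n ha hn
    have : 0 ≤ K * n + B * K * a + B * K * n := by positivity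
    linarith [mul_nonneg hK0 hn, mul_nonneg (mul_nonneg hB.le hK0) hn]
  have hle' : ∀ a n : ℝ, 0 ≤ a → 0 ≤ n → K * (a + n) ≤ (1 + B) * K * (a + 2 * n) := by
    intro a n ha hn
    refine le_trans ?_ (hle a n ha hn)
    have : 0 ≤ B * (K * n) := by positivity
    linarith
  have i1 := integral_norm_sq_le (hn.momX.memLp hB) (hn.memLp hB)
    fun p => (hX p).trans (hle' _ _ (norm_nonneg _) (norm_nonneg _))
  have i2 := integral_norm_sq_le (hn.momY.memLp hB) (hn.memLp hB)
    fun p => (hY p).trans (hle' _ _ (norm_nonneg _) (norm_nonneg _))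
  have i3 : ∫ p, ‖guideX (fun q => χ q * u q) p‖ ^ 2 ≤ _ :=
    integral_norm_sq_le (hn.momX.memLp hB) (hn.memLp hB) (L := (1 + B) * K) fun p => by
      refine le_trans ?_ (hle _ _ (norm_nonneg _) (norm_nonneg _))
      have e : guideX (fun q => χ q * u q) p =
          momX B (fun q => χ q * u q) p - B * (((p.2 : ℂ) * χ p) * u p) := by
        simp only [guideX, mom, momX]; push_cast; ring
      rw [e]
      refine (norm_sub_le _ _).trans (add_le_add (hX p) ?_)
      rw [norm_mul, norm_mul, Complex.norm_real, Real.norm_of_nonneg hB.le]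
      have := (hK p).2.2.2.2
      gcongr
  have i4 : ∫ p, ‖guideY B (fun q => χ q * u q) p‖ ^ 2 ≤ _ :=
    integral_norm_sq_le (hn.momY.memLp hB) (hn.memLp hB) (L := (1 + B) * K) fun p => by
      refine le_trans ?_ (hle _ _ (norm_nonneg _) (norm_nonneg _))
      have e : guideY B (fun q => χ q * u q) p =
          momY (fun q => χ q * u q) p + B * (((p.1 : ℂ) * χ p) * u p) := by
        simp only [guideY, mom, momY]; push_cast; ring
      rw [e]
      refine (norm_add_le _ _).trans (add_le_add (hY p) ?_)
      rw [norm_mul, norm_mul, Complex.norm_real, Real.norm_of_nonneg hB.le]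
      have := (hK p).2.2.2.1
      gcongr
  have q1 : 0 ≤ ∫ p, ‖momX B u p‖ ^ 2 := integral_nonneg fun p => by positivity
  have q2 : 0 ≤ ∫ p, ‖momY u p‖ ^ 2 := integral_nonneg fun p => by positivity
  have q3 := mul_nonneg (sq_nonneg ((1 + B) * K)) (add_nonneg q1 q2)
  linarith

/-- A localised vector in the domain of the Landau Hamiltonian has finite energy. -/
lemma exists_sum_level_bound (hB : 0 < B)
    {χ : ℝ × ℝ → ℂ} (hχ : ContDiff ℝ ∞ χ) (hχs : HasCompactSupport χ)
    {M : ℝ} (hv : AEStronglyMeasurable χ volume) (hM : ∀ p, ‖χ p‖ ≤ M) :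
    ∃ D, 0 ≤ D ∧ ∀ q ∈ (landauOp B).graph, ∀ s : Finset (ℕ × ℕ),
      ∑ i ∈ s, (level B i.1 + level B i.2) *
        ‖inner ℂ (landauBasis hB i) (mulCLM χ M hv hM q.1)‖ ^ 2 ≤ D * (‖q.1‖ ^ 2 + ‖q.2‖ ^ 2) := by
  obtain ⟨D, hD0, hD⟩ := exists_energy_bound hB hχ hχs
  refine ⟨D * 2, by positivity, fun q hq s => ?_⟩
  rw [graph_landauOp hB, ← topologicalClosure_magneticGraph hB] at hq
  -- For a finite index set the estimate is a closed condition on the pair, so it need only be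
  -- verified on test functions.
  refine closure_minimal (s := (magneticGraph B 0 : Set (L2 × L2)))
    (t := {q | ∑ i ∈ s, (level B i.1 + level B i.2) *
        ‖inner ℂ (landauBasis hB i) (mulCLM χ M hv hM q.1)‖ ^ 2 ≤ D * 2 * (‖q.1‖ ^ 2 + ‖q.2‖ ^ 2)})
    ?_ (isClosed_le (by fun_prop) (by fun_prop)) hq
  rintro ⟨x, w⟩ ⟨u, hu, hus, hx, hw⟩
  simp only at hx hw
  have hn : IsNice B u := Or.inr ⟨hu, hus⟩
  have hg : mulCLM χ M hv hM x =ᵐ[volume] fun p => χ p * u p := by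
    filter_upwards [mulCLM_ae hv hM x, hx] with p h1 h2
    rw [h1, h2]
  have h1 := hasSum_level_mul_norm_inner_sq hB
    (Or.inr ⟨hχ.mul hu, hχs.mul_right⟩ : IsNice B fun p => χ p * u p) hg
  have h2 := sum_le_hasSum s (fun i _ => mul_nonneg
    (add_nonneg (level_pos hB i.1).le (level_pos hB i.2).le) (sq_nonneg _)) h1
  refine h2.trans ((hD u hu hus).trans ?_)
  -- The energy equals ⟨u, H_L u⟩, which Cauchy–Schwarz bounds by the graph norm.
  have h3 : ((∫ p, ‖momX B u p‖ ^ 2) + ∫ p, ‖momY u p‖ ^ 2) ≤ ‖x‖ * ‖w‖ := by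
    have h4 := norm_inner_le_norm (𝕜 := ℂ) x w
    rw [inner_eq_integral hx hw, integral_conj_mul_landauExpr hB hn hn, integral_conj_mul_self,
      integral_conj_mul_self, ← Complex.ofReal_add, Complex.norm_real] at h4
    exact (le_abs_self _).trans h4
  rw [← norm_sq_eq_integral hx, mul_assoc]
  refine mul_le_mul_of_nonneg_left ?_ hD0
  nlinarith [sq_nonneg (‖x‖ - ‖w‖), sq_nonneg ‖w‖]

/-- A Rellich argument: the localised vectors have uniformly bounded energy for H_L + K, whose
eigenvalues exceed B(k+1) off the box of indices below k+1 in both coordinates. Finite-rank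
truncations thus converge in norm at rate (k+1)^(-1/2). -/
lemma isCompactOperator_mulCLM_comp (hB : 0 < B) {χ : ℝ × ℝ → ℂ} (hχ : ContDiff ℝ ∞ χ)
    (hχs : HasCompactSupport χ) {M : ℝ} (hv : AEStronglyMeasurable χ volume)
    (hM : ∀ p, ‖χ p‖ ≤ M) {z : ℂ} {A : L2 →L[ℂ] L2} (hA : IsResolventAt (landauOp B) z A) :
    IsCompactOperator (mulCLM χ M hv hM ∘L A) := by
  classical
  set b := landauBasis hB
  obtain ⟨D, hD0, hD⟩ := exists_sum_level_bound hB hχ hχs hv hM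
  set G := mulCLM χ M hv hM ∘L A
  set D' := D * (‖A‖ ^ 2 + (1 + ‖z‖ * ‖A‖) ^ 2)
  have hbound : ∀ ψ : L2, ∀ s : Finset (ℕ × ℕ),
      ∑ i ∈ s, (level B i.1 + level B i.2) * ‖inner ℂ (b i) (G ψ)‖ ^ 2 ≤ D' * ‖ψ‖ ^ 2 := by
    intro ψ s
    obtain ⟨h, hψ⟩ := hA.1 ψ
    refine (hD _ ((landauOp B).mem_graph ⟨A ψ, h⟩) s).trans ?_
    have h1 : landauOp B ⟨A ψ, h⟩ = ψ + z • A ψ := by rw [← sub_eq_iff_eq_add, hψ]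
    have h2 : ‖A ψ‖ ≤ ‖A‖ * ‖ψ‖ := A.le_opNorm ψ
    have h3 : ‖landauOp B ⟨A ψ, h⟩‖ ≤ (1 + ‖z‖ * ‖A‖) * ‖ψ‖ := by
      rw [h1]
      refine (norm_add_le _ _).trans ?_
      rw [norm_smul, add_mul, one_mul, mul_assoc]
      gcongr
    rw [show D' * ‖ψ‖ ^ 2 = D * ((‖A‖ * ‖ψ‖) ^ 2 + ((1 + ‖z‖ * ‖A‖) * ‖ψ‖) ^ 2) by
      simp only [D']; ring]
    refine mul_le_mul_of_nonneg_left ?_ hD0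
    change ‖A ψ‖ ^ 2 + ‖landauOp B ⟨A ψ, h⟩‖ ^ 2 ≤ _
    gcongr
  let S : ℕ → Finset (ℕ × ℕ) := fun k => Finset.range k ×ˢ Finset.range k
  let Q : ℕ → L2 →L[ℂ] L2 := fun k => ∑ i ∈ S k, (innerSL ℂ (b i)).smulRight (b i)
  have hQ : ∀ k x i, inner ℂ (b i) (Q k x) = if i ∈ S k then inner ℂ (b i) x else 0 := by
    intro k x i
    simp only [Q, sum_apply, ContinuousLinearMap.smulRight_apply, inner_sum,
      inner_smul_right, innerSL_apply_apply]
    simp only [orthonormal_iff_ite.1 b.orthonormal, mul_ite, mul_one, mul_zero]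
    rw [Finset.sum_ite_eq]
  have hQc : ∀ k, IsCompactOperator (Q k ∘L G) := by
    intro k
    refine IsCompactOperator.comp_clm (f := Q k) ?_ G
    have : ∀ s : Finset (ℕ × ℕ), IsCompactOperator
        (∑ i ∈ s, (innerSL ℂ (b i)).smulRight (b i) : L2 →L[ℂ] L2) := by
      intro s
      induction s using Finset.induction_on with
      | empty => rw [Finset.sum_empty]; exact isCompactOperator_zero
      | insert a s ha ih =>
        rw [Finset.sum_insert ha]
        refine IsCompactOperator.add ?_ ih
        have h1 : IsCompactOperator (innerSL ℂ (b a) : L2 →L[ℂ] ℂ) :=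
          ⟨Metric.closedBall 0 1, isCompact_closedBall 0 1,
            (innerSL ℂ (b a)).continuous.continuousAt
              (by rw [map_zero]; exact Metric.closedBall_mem_nhds _ one_pos)⟩
        exact h1.clm_comp (ContinuousLinearMap.smulRight (1 : ℂ →L[ℂ] ℂ) (b a))
    exact this (S k)
  have hdiff : ∀ k : ℕ, ‖G - Q (k + 1) ∘L G‖ ≤ Real.sqrt (D' / (B * (k + 1))) := by
    intro k
    refine ContinuousLinearMap.opNorm_le_bound _ (Real.sqrt_nonneg _) fun ψ => ?_
    have hBk : 0 < B * ((k : ℝ) + 1) := by positivity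
    refine abs_le_of_sq_le_sq' (a := ‖_‖) ?_ (by positivity) |>.2
    have hD' : 0 ≤ D' := mul_nonneg hD0 (by positivity)
    rw [mul_pow, Real.sq_sqrt (by positivity), div_mul_eq_mul_div, le_div_iff₀ hBk]
    refine le_of_tendsto ((hasSum_norm_inner_sq b ((G - Q (k + 1) ∘L G) ψ)).mul_right
      (B * ((k : ℝ) + 1))) (Eventually.of_forall fun s => le_trans ?_ (hbound ψ s))
    refine Finset.sum_le_sum fun i _ => ?_
    rw [sub_apply, inner_sub_right,
      show (Q (k + 1) ∘L G) ψ = Q (k + 1) (G ψ) from rfl, hQ]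
    by_cases hi : i ∈ S (k + 1)
    · rw [if_pos hi, sub_self, norm_zero]
      have := level_pos hB i.1
      have := level_pos hB i.2
      have : 0 ≤ (level B i.1 + level B i.2) * ‖inner ℂ (b i) (G ψ)‖ ^ 2 := by positivity
      simpa using this
    · rw [if_neg hi, sub_zero, mul_comm]
      refine mul_le_mul_of_nonneg_right ?_ (sq_nonneg _)
      have h1 : k + 1 ≤ i.1 ∨ k + 1 ≤ i.2 := by
        by_contra hcon
        push Not at hcon
        exact hi (Finset.mem_product.2 ⟨Finset.mem_range.2 hcon.1, Finset.mem_range.2 hcon.2⟩)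
      have h2 : (k : ℝ) + 1 ≤ i.1 + i.2 := by
        have : k + 1 ≤ i.1 + i.2 := by omega
        exact_mod_cast this
      unfold level
      nlinarith [(Nat.cast_nonneg i.1 : (0 : ℝ) ≤ i.1), (Nat.cast_nonneg i.2 : (0 : ℝ) ≤ i.2)]
  refine isCompactOperator_of_tendsto (l := atTop) (F := fun k => Q (k + 1) ∘L G) ?_
    (Eventually.of_forall fun k => hQc (k + 1))
  rw [tendsto_iff_norm_sub_tendsto_zero]
  refine squeeze_zero (fun k => norm_nonneg _) (fun k => (norm_sub_rev _ _).trans_le (hdiff k)) ?_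
  have h1 : Tendsto (fun k : ℕ => D' / (B * ((k : ℝ) + 1))) atTop (𝓝 0) := by
    refine tendsto_const_nhds.div_atTop (Tendsto.const_mul_atTop hB ?_)
    exact tendsto_atTop_add_const_right _ _ tendsto_natCast_atTop_atTop
  simpa using h1.sqrt

/-- Decay at infinity makes v times a wide bump converge uniformly to v, and norm limits of compact
operators are compact. -/
lemma isCompactOperator_mulCLM_comp_of_vanishesAtInfinity (hB : 0 < B)
    {v : ℝ × ℝ → ℂ} {M : ℝ}
    (hv : AEStronglyMeasurable v volume) (hM : ∀ p, ‖v p‖ ≤ M) (h0 : VanishesAtInfinity v)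
    {z : ℂ} {A : L2 →L[ℂ] L2} (hA : IsResolventAt (landauOp B) z A) :
    IsCompactOperator (mulCLM v M hv hM ∘L A) := by
  let c : ℕ → ℝ := fun n => 1 / ((n : ℝ) + 1)
  have hc0 : ∀ n, 0 < c n := fun n => by positivity
  have hm : ∀ n, AEStronglyMeasurable (scaledBump (c n)) volume :=
    fun n => (contDiff_scaledBump _).continuous.aestronglyMeasurable
  let G : ℕ → L2 →L[ℂ] L2 := fun n => mulCLM (scaledBump (c n)) 1 (hm n) (norm_scaledBump_le _)
  have hG : ∀ n, IsCompactOperator (mulCLM v M hv hM ∘L (G n ∘L A)) := fun n =>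
    (isCompactOperator_mulCLM_comp hB (contDiff_scaledBump _)
      (hasCompactSupport_scaledBump (hc0 n).ne') (hm n) (norm_scaledBump_le _) hA).clm_comp
      (mulCLM v M hv hM)
  have hvm : ∀ n, AEStronglyMeasurable (fun p => v p * scaledBump (c n) p) volume :=
    fun n => hv.mul (hm n)
  have hvb : ∀ n p, ‖v p * scaledBump (c n) p‖ ≤ M := fun n p => by
    rw [norm_mul]
    exact (mul_le_of_le_one_right (norm_nonneg _) (norm_scaledBump_le _ _)).trans (hM p)
  have hlim : Tendsto (fun n => mulCLM v M hv hM ∘L G n) atTop (𝓝 (mulCLM v M hv hM)) := by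
    rw [Metric.tendsto_atTop]
    intro δ hδ
    obtain ⟨r, hr⟩ := h0 (δ / 4) (by positivity)
    obtain ⟨N, hN⟩ := exists_nat_ge r
    refine ⟨N, fun n hn => ?_⟩
    have hb : ∀ p, ‖v p - v p * scaledBump (c n) p‖ ≤ δ / 2 := by
      intro p
      by_cases hp : ‖p‖ ≤ (n : ℝ) + 1
      · rw [scaledBump_eq_one, mul_one, sub_self, norm_zero]
        · positivity
        · rw [norm_smul, Real.norm_of_nonneg (hc0 n).le, div_mul_eq_mul_div, one_mul]
          exact (div_le_one (by positivity)).2 hp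
      · have h1 : r < ‖p‖ := by
          have : (N : ℝ) ≤ n := by exact_mod_cast hn
          linarith [not_le.1 hp]
        refine (norm_sub_le _ _).trans ?_
        have h2 := hr p h1
        have h3 : ‖v p * scaledBump (c n) p‖ ≤ ‖v p‖ := by
          rw [norm_mul]
          exact mul_le_of_le_one_right (norm_nonneg _) (norm_scaledBump_le _ _)
        linarith
    have e1 : mulCLM v M hv hM ∘L G n = mulCLM _ M (hvm n) (hvb n) :=
      mulCLM_mul_mulCLM hv hM (hm n) (norm_scaledBump_le _) (hvm n) (hvb n) fun p => rfl
    rw [dist_comm, dist_eq_norm, e1, mulCLM_sub_mulCLM hv hM (hvm n) (hvb n) (hv.sub (hvm n)) hb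
      fun p => rfl]
    exact (norm_mulCLM_le _ _).trans_lt (by linarith)
  refine isCompactOperator_of_tendsto (l := atTop) (F := fun n => mulCLM v M hv hM ∘L (G n ∘L A)) ?_
    (Eventually.of_forall hG)
  have hcont : Continuous fun S : L2 →L[ℂ] L2 => S ∘L A := by fun_prop
  exact (hcont.tendsto _).comp hlim

/-- Multiplication by a bounded function vanishing at infinity is relatively compact with respect
to the Landau Hamiltonian. -/
lemma isRelativelyCompact_mulCLM (hB : 0 < B) {v : ℝ × ℝ → ℂ} {M : ℝ}
    (hv : AEStronglyMeasurable v volume)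
    (hM : ∀ p, ‖v p‖ ≤ M) (h0 : VanishesAtInfinity v) :
    IsRelativelyCompact (landauOp B) (mulCLM v M hv hM) := by
  obtain ⟨A, hA, -⟩ := exists_isResolventAt_landauOp hB one_pos
  have hc := isCompactOperator_mulCLM_comp_of_vanishesAtInfinity hB hv hM h0 hA
  rintro ψ ⟨C, hC⟩ ⟨D, hD⟩
  have hcpt := hc.isCompact_closure_image_closedBall (r := D + C)
  obtain ⟨x, -, φ, hφ, hx⟩ := hcpt.tendsto_subseq (x := fun k => (mulCLM v M hv hM) (ψ k : L2))
    fun k => subset_closure ⟨landauOp B (ψ k) - ((-1 : ℝ) : ℂ) • (ψ k : L2), by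
      rw [mem_closedBall_zero_iff]
      refine (norm_sub_le _ _).trans (add_le_add (hD k) ?_)
      rw [norm_smul]; simpa using hC k, by
      change mulCLM v M hv hM (A _) = _
      rw [hA.2]⟩
  exact ⟨φ, hφ, x, hx⟩

end Compactness


/-! ### Families of bounded perturbations -/

section Families

variable {H : Type*} [NormedAddCommGroup H] [InnerProductSpace ℂ H] [CompleteSpace H]
  {T : H →ₗ.[ℂ] H} {ι : Type*} {l : Filter ι} {W : ι → H →L[ℂ] H}

lemma tendsto_resolvent_perturb {z : ℂ} (hz : z.im ≠ 0) (hT : z ∈ resolventSet T)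
    (hs : ∀ᶠ i in l, ((W i : H →ₗ[ℂ] H) +ᵥ T).IsFormalAdjoint ((W i : H →ₗ[ℂ] H) +ᵥ T))
    (hW : ∀ᶠ i in l, z ∈ resolventSet ((W i : H →ₗ[ℂ] H) +ᵥ T))
    (h0 : Tendsto (fun i => ‖W i‖) l (𝓝 0)) :
    Tendsto (fun i => ‖resolvent ((W i : H →ₗ[ℂ] H) +ᵥ T) z - resolvent T z‖) l (𝓝 0) := by
  have h1 : Tendsto (fun i => |z.im|⁻¹ * ‖W i‖ * ‖resolvent T z‖) l (𝓝 0) := by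
    simpa using (h0.const_mul |z.im|⁻¹).mul_const ‖resolvent T z‖
  refine squeeze_zero' (Eventually.of_forall fun i => norm_nonneg _) ?_ h1
  filter_upwards [hs, hW] with i hi hWi
  have hR := isResolventAt_resolvent hWi
  rw [(isResolventAt_resolvent hT).perturb_sub hR, norm_neg]
  refine (norm_mul_le _ _).trans (mul_le_mul_of_nonneg_right ?_ (norm_nonneg _))
  exact (norm_mul_le _ _).trans (mul_le_mul_of_nonneg_right (hR.norm_le hi hz) (norm_nonneg _))

/-- At a real point the bound 1/|Im z| is not available. Instead ‖R‖ ≤ 2‖A‖ comes from absorbing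
‖R‖/2 in the resolvent identity. -/
lemma tendsto_resolvent_perturb_of_mem {μ : ℂ} (hT : μ ∈ resolventSet T)
    (h0 : Tendsto (fun i => ‖W i‖) l (𝓝 0)) :
    (∀ᶠ i in l, μ ∈ resolventSet ((W i : H →ₗ[ℂ] H) +ᵥ T)) ∧
      Tendsto (fun i => resolvent ((W i : H →ₗ[ℂ] H) +ᵥ T) μ) l (𝓝 (resolvent T μ)) := by
  set A := resolvent T μ
  have hA : IsResolventAt T μ A := isResolventAt_resolvent hT
  have h1 : Tendsto (fun i => ‖W i‖ * ‖A‖) l (𝓝 0) := by simpa using h0.mul_const ‖A‖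
  have h2 : ∀ᶠ i in l, ‖W i‖ * ‖A‖ ≤ 1 / 2 := h1.eventually (ge_mem_nhds (by norm_num))
  have h3 : ∀ᶠ i in l, μ ∈ resolventSet ((W i : H →ₗ[ℂ] H) +ᵥ T) := by
    filter_upwards [h2] with i hi
    exact hA.exists_perturb (by linarith)
  refine ⟨h3, ?_⟩
  rw [tendsto_iff_norm_sub_tendsto_zero]
  have h4 : Tendsto (fun i => 2 * ‖A‖ * (‖W i‖ * ‖A‖)) l (𝓝 0) := by
    simpa using h1.const_mul (2 * ‖A‖)
  refine squeeze_zero' (Eventually.of_forall fun i => norm_nonneg _) ?_ h4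
  filter_upwards [h2, h3] with i hi h3i
  set R := resolvent ((W i : H →ₗ[ℂ] H) +ᵥ T) μ
  have hR : IsResolventAt ((W i : H →ₗ[ℂ] H) +ᵥ T) μ R := isResolventAt_resolvent h3i
  have h5 : ‖R - A‖ ≤ ‖R‖ * (‖W i‖ * ‖A‖) := by
    rw [hA.perturb_sub hR, norm_neg, mul_assoc]
    exact (norm_mul_le _ _).trans (mul_le_mul_of_nonneg_left (norm_mul_le _ _) (norm_nonneg _))
  have h6 : ‖R‖ ≤ 2 * ‖A‖ := by
    have h7 := norm_le_norm_add_norm_sub A R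
    have h8 := mul_le_mul_of_nonneg_left hi (norm_nonneg R)
    rw [norm_sub_rev] at h7
    linarith
  exact h5.trans (mul_le_mul_of_nonneg_right h6 (by positivity))

/-- Every point of the spectrum of `T` is within `‖W‖` of the spectrum of `T + W`. -/
lemma exists_mem_spec_perturb {W : H →L[ℂ] H}
    (hT : ((W : H →ₗ[ℂ] H) +ᵥ T).IsFormalAdjoint ((W : H →ₗ[ℂ] H) +ᵥ T)) {e : ℝ}
    (he : (e : ℂ) ∈ spec T) :
    ∃ lam : ℝ, (lam : ℂ) ∈ spec ((W : H →ₗ[ℂ] H) +ᵥ T) ∧ |e - lam| ≤ ‖W‖ := by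
  have h := exists_mem_spec_of_perturb (W := -W) hT (lam := e)
    (by
      rw [ContinuousLinearMap.toLinearMap_neg, neg_vadd_vadd]
      exact he)
  rwa [norm_neg] at h

/-- The Neumann series makes a whole interval resolvent. The 1 added to ‖A‖ keeps the radius finite
when A = 0. -/
lemma exists_gap {a : ℝ} (ha : (a : ℂ) ∈ resolventSet T) :
    ∃ δ > 0, ∀ t : ℝ, (t : ℂ) ∈ spec T → δ ≤ |t - a| := by
  obtain ⟨A, hA⟩ := ha
  refine ⟨(‖A‖ + 1)⁻¹, by positivity, fun t ht => ?_⟩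
  by_contra! hlt
  refine ht ?_
  have hn : ‖((t : ℂ) - a) • A‖ < 1 := by
    rw [norm_smul, ← Complex.ofReal_sub, Complex.norm_real, Real.norm_eq_abs]
    have h1 : 0 < ‖A‖ + 1 := by positivity
    calc |t - a| * ‖A‖ ≤ |t - a| * (‖A‖ + 1) := by gcongr; linarith
      _ < (‖A‖ + 1)⁻¹ * (‖A‖ + 1) := by gcongr
      _ = 1 := inv_mul_cancel₀ h1.ne'
  obtain ⟨u, hu⟩ := isUnit_one_sub_of_norm_lt_one hn
  exact (hA.of_inverse (U := (u⁻¹ : (H →L[ℂ] H)ˣ)) (by rw [← hu]; simp)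
    (by rw [← hu]; simp)).mem_resolventSet

lemma tendsto_spectralProjection {μ : ℝ} (hT : T.IsFormalAdjoint T) (hμ : (μ : ℂ) ∈ resolventSet T)
    (hs : ∀ᶠ i in l, ((W i : H →ₗ[ℂ] H) +ᵥ T).IsFormalAdjoint ((W i : H →ₗ[ℂ] H) +ᵥ T))
    (h0 : Tendsto (fun i => ‖W i‖) l (𝓝 0)) {a b : ℝ} (ha : (a : ℂ) ∉ spec T)
    (hb : (b : ℂ) ∉ spec T) {Δ : Set ℝ} (h₁ : Set.Ioo a b ⊆ Δ) (h₂ : Δ ⊆ Set.Icc a b) :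
    ∃ (P₀ : H →L[ℂ] H) (P : ι → H →L[ℂ] H), IsSpectralProjection T Δ P₀ ∧
      (∀ᶠ i in l, IsSpectralProjection ((W i : H →ₗ[ℂ] H) +ᵥ T) Δ (P i)) ∧
      Tendsto (fun i => ‖P i - P₀‖) l (𝓝 0) := by
  obtain ⟨δ₁, hδ₁, hg₁⟩ := exists_gap (not_not.1 ha)
  obtain ⟨δ₂, hδ₂, hg₂⟩ := exists_gap (not_not.1 hb)
  -- Half of the gap is kept in reserve: a perturbation of norm at most δ moves the spectrum by at
  -- most δ, so a margin δ survives at both endpoints.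
  set δ := min δ₁ δ₂ / 2
  have hδ : 0 < δ := by positivity
  have hl₁ : 2 * δ ≤ δ₁ := by simp only [δ]; linarith [min_le_left δ₁ δ₂]
  have hl₂ : 2 * δ ≤ δ₂ := by simp only [δ]; linarith [min_le_right δ₁ δ₂]
  have hA := isResolventAt_resolvent hμ
  obtain ⟨h3, h4⟩ := tendsto_resolvent_perturb_of_mem hμ h0
  refine ⟨cfc (resolventTrapezoid a b δ μ) (resolvent T μ),
    fun i => cfc (resolventTrapezoid a b δ μ) (resolvent ((W i : H →ₗ[ℂ] H) +ᵥ T) μ),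
    hA.isSpectralProjection_resolventTrapezoid hT hδ (fun t ht => ?_) h₁ h₂, ?_, ?_⟩
  · have := hg₁ t ht
    have := hg₂ t ht
    constructor <;> linarith
  · filter_upwards [hs, h3, h0.eventually (ge_mem_nhds hδ)] with i hi h3i h0i
    refine (isResolventAt_resolvent h3i).isSpectralProjection_resolventTrapezoid hi hδ
      (fun t ht => ?_) h₁ h₂
    obtain ⟨t', ht', hd⟩ := exists_mem_spec_of_perturb hT ht
    have h5 := hg₁ t' ht'
    have h6 := hg₂ t' ht'
    have h7 := abs_sub_le t' t a
    have h8 := abs_sub_le t' t b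
    rw [abs_sub_comm t' t] at h7 h8
    constructor <;> linarith
  · rw [← tendsto_iff_norm_sub_tendsto_zero]
    refine tendsto_cfc_resolventTrapezoid h4 (hA.isSelfAdjoint hT) ?_ hδ μ
    filter_upwards [hs, h3] with i hi h3i
    exact (isResolventAt_resolvent h3i).isSelfAdjoint hi

/-- Spectrum of the perturbed operators converging to an isolated point of the spectrum stays
within `‖W‖` of it. -/
lemma eventually_abs_sub_le {e r : ℝ} (hT : T.IsFormalAdjoint T) (hr : 0 < r)
    (hiso : ∀ w ∈ spec T, ‖w - e‖ < r → w = e) (h0 : Tendsto (fun i => ‖W i‖) l (𝓝 0))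
    {lam : ι → ℝ} (hlam : ∀ᶠ i in l, (lam i : ℂ) ∈ spec ((W i : H →ₗ[ℂ] H) +ᵥ T))
    (hlim : Tendsto lam l (𝓝 e)) : ∀ᶠ i in l, |lam i - e| ≤ ‖W i‖ := by
  have h1 : ∀ᶠ i in l, |lam i - e| < r / 2 := by
    have := Metric.tendsto_nhds.1 hlim (r / 2) (by positivity)
    simpa [Real.dist_eq] using this
  filter_upwards [hlam, h1, h0.eventually (gt_mem_nhds (half_pos hr))] with i h2 h3 h4
  obtain ⟨t, ht, hd⟩ := exists_mem_spec_of_perturb hT h2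
  have h5 : t = e := by
    refine Complex.ofReal_injective (hiso _ ht ?_)
    rw [← Complex.ofReal_sub, Complex.norm_real, Real.norm_eq_abs]
    have := abs_sub_le t (lam i) e
    rw [abs_sub_comm t (lam i)] at this
    linarith
  rwa [h5] at hd

end Families

/-! ### Bounded and relatively compact perturbations of the Landau Hamiltonian -/

section Landau

variable {B : ℝ}

/-- The Landau Hamiltonian is positive, so at -(‖W‖ + 1) its resolvent is small enough for a Neumann
series. -/
lemma exists_isResolventAt_vadd_landauOp (hB : 0 < B) (W : L2 →L[ℂ] L2) :
    ∃ (μ : ℝ) (A : L2 →L[ℂ] L2), IsResolventAt ((W : L2 →ₗ[ℂ] L2) +ᵥ landauOp B) μ A := by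
  have hK : 0 < ‖W‖ + 1 := by positivity
  obtain ⟨A, hA, hn⟩ := exists_isResolventAt_landauOp hB hK
  obtain ⟨R, hR⟩ := hA.exists_perturb (W := W) (by
    calc ‖W‖ * ‖A‖ ≤ ‖W‖ * (‖W‖ + 1)⁻¹ := by gcongr
      _ < (‖W‖ + 1) * (‖W‖ + 1)⁻¹ := by gcongr; linarith
      _ = 1 := mul_inv_cancel₀ hK.ne')
  exact ⟨_, R, hR⟩

/-- Relatively compact symmetric perturbations do not change the essential spectrum. -/
lemma essSpec_eq_of_hasSeqCompactKernel_iff (hB : 0 < B) {T : L2 →ₗ.[ℂ] L2}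
    (hT : T.IsFormalAdjoint T) {μ : ℝ} {A : L2 →L[ℂ] L2} (hA : IsResolventAt T μ A)
    (h : ∀ z, HasSeqCompactKernel T z ↔ HasSeqCompactKernel (landauOp B) z) :
    essSpec T = essSpec (landauOp B) := by
  obtain ⟨A₀, hA₀, -⟩ := exists_isResolventAt_landauOp hB one_pos
  ext z
  by_cases hz : z.im = 0
  · have e : z = (z.re : ℂ) := Complex.ext rfl (by simpa using hz)
    rw [e, hA.mem_essSpec_iff hT, hA₀.mem_essSpec_iff (isFormalAdjoint_landauOp hB), h]
  · exact ⟨fun h => absurd (hA.im_eq_zero_of_mem_spec hT h.1) hz,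
      fun h => absurd (hA₀.im_eq_zero_of_mem_spec (isFormalAdjoint_landauOp hB) h.1) hz⟩

end Landau

end

end MagneticStark

/-! ### Assembly of the theorem -/

open MagneticStark in
theorem mainTheorem5
    (B : ℝ) (hB : 0 < B)
    (β a₀ a₁ : ℝ) (hβ : 0 < β) (ha₀ : 0 < a₀) (ha₁ : 0 < a₁)
    (V : ℂ → ℝ → ℂ)
    (hV_real : ∀ x y : ℝ, (V x y).im = 0)
    (hV_meas : AEStronglyMeasurable (fun p : ℝ × ℝ => V p.1 p.2) volume)
    (F₁ : ℝ) (hF₁ : 0 < F₁)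
    (hV_a : ∀ F : ℝ, 0 < F → F < F₁ → MagneticStark.IsTranslationAnalytic B F β V)
    (hV_b : MagneticStark.IsGaussianLocalised β a₀ a₁ V)
    (ε γ₀ C τ : ℝ) (hε : 0 < ε) (hγ₀ : 0 < γ₀) (hC : 0 < C)
    (H₀ : MagneticStark.L2 →ₗ.[ℂ] MagneticStark.L2)
    (hH₀ : H₀ = MagneticStark.impurityOp B V)
    (H₂ : ℝ → MagneticStark.L2 →ₗ.[ℂ] MagneticStark.L2)
    (hH₂ : ∀ F : ℝ, H₂ F = MagneticStark.localFieldOp B V ε γ₀ C a₁ τ F) :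
    -- the operators are self-adjoint
    (IsSelfAdjoint (MagneticStark.landauOp B) ∧ IsSelfAdjoint H₀ ∧
      ∀ F : ℝ, 0 < F → IsSelfAdjoint (H₂ F)) ∧
    -- norm-resolvent convergence
    (∀ z : ℂ, z.im ≠ 0 →
      z ∈ MagneticStark.resolventSet H₀ ∧
      (∀ F : ℝ, 0 < F → z ∈ MagneticStark.resolventSet (H₂ F)) ∧
      Tendsto (fun F : ℝ => ‖MagneticStark.resolvent (H₂ F) z - MagneticStark.resolvent H₀ z‖)
        (𝓝[>] 0) (𝓝 0)) ∧
    -- every point of the spectrum of `H(0)` is a limit of points of the spectra of `H₂(F)`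
    (∀ e : ℝ, (e : ℂ) ∈ MagneticStark.spec H₀ →
      ∃ lam : ℝ → ℝ, (∀ F : ℝ, 0 < F → (lam F : ℂ) ∈ MagneticStark.spec (H₂ F)) ∧
        Tendsto lam (𝓝[>] 0) (𝓝 e)) ∧
    -- norm convergence of the spectral projections onto intervals `Δ` with endpoints `a`, `b`
    (∀ a b : ℝ, a < b → (a : ℂ) ∉ MagneticStark.spec H₀ → (b : ℂ) ∉ MagneticStark.spec H₀ →
      ∀ Δ : Set ℝ, Set.Ioo a b ⊆ Δ → Δ ⊆ Set.Icc a b →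
      ∃ (P₀ : MagneticStark.L2 →L[ℂ] MagneticStark.L2)
        (P : ℝ → MagneticStark.L2 →L[ℂ] MagneticStark.L2),
        MagneticStark.IsSpectralProjection H₀ Δ P₀ ∧
        (∀ᶠ F in 𝓝[>] (0 : ℝ), MagneticStark.IsSpectralProjection (H₂ F) Δ (P F)) ∧
        Tendsto (fun F : ℝ => ‖P F - P₀‖) (𝓝[>] 0) (𝓝 0)) ∧
    -- the essential spectrum
    ((∀ F : ℝ, 0 < F →
        MagneticStark.essSpec (H₂ F) = MagneticStark.essSpec (MagneticStark.landauOp B)) ∧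
      MagneticStark.essSpec (MagneticStark.landauOp B) =
        {z : ℂ | ∃ n : ℕ, z = (((2 * n + 1) * B : ℝ) : ℂ)}) ∧
    -- the rate of convergence at discrete eigenvalues
    (∀ e : ℝ, (e : ℂ) ∈ MagneticStark.discreteSpec H₀ →
      ∃ c : ℝ, 0 < c ∧ ∀ lam : ℝ → ℝ,
        (∀ᶠ F in 𝓝[>] (0 : ℝ), (lam F : ℂ) ∈ MagneticStark.spec (H₂ F)) →
        Tendsto lam (𝓝[>] 0) (𝓝 e) →
        ∀ᶠ F in 𝓝[>] (0 : ℝ), (lam F : ℂ) ∈ MagneticStark.discreteSpec (H₂ F) ∧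
          lam F ∈ Set.Icc (e - c * F ^ ε) (e + c * F ^ ε)) := by
  have hL := isFormalAdjoint_landauOp hB
  obtain ⟨⟨M, hM⟩, hV0⟩ := hV_b.exists_bound
  set MV : L2 →L[ℂ] L2 := mulCLM (fun p => V p.1 p.2) M hV_meas hM
  have hWm : ∀ F, AEStronglyMeasurable (fun p => (localField ε γ₀ C a₁ τ F p : ℂ)) volume :=
    fun F => (Complex.measurable_ofReal.comp measurable_localField).aestronglyMeasurable
  have hWb : ∀ F, 0 < F → ∀ p, ‖(localField ε γ₀ C a₁ τ F p : ℂ)‖ ≤ C * F ^ ε :=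
    fun F hF p => norm_localField_le hγ₀ hC hF p
  -- The value 0 for F ≤ 0 only makes the family total; all limits are taken from the right.
  let W : ℝ → L2 →L[ℂ] L2 := fun F =>
    if hF : 0 < F then mulCLM _ (C * F ^ ε) (hWm F) (hWb F hF) else 0
  have hW : ∀ F (hF : 0 < F), W F = mulCLM _ (C * F ^ ε) (hWm F) (hWb F hF) :=
    fun F hF => dif_pos hF
  have hWn : ∀ F, 0 < F → ‖W F‖ ≤ C * F ^ ε := fun F hF => by
    rw [hW F hF]; exact norm_mulCLM_le _ _
  have hWs : ∀ F, 0 < F → (W F : L2 →ₗ[ℂ] L2).IsSymmetric := fun F hF => by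
    rw [hW F hF]; exact isSymmetric_mulCLM _ _ fun p => Complex.ofReal_im _
  have hWc : ∀ F, 0 < F → IsRelativelyCompact (landauOp B) (W F) := fun F hF => by
    rw [hW F hF]
    exact isRelativelyCompact_mulCLM hB _ _ (vanishesAtInfinity_localField hγ₀ hC hF)
  have hVc : IsRelativelyCompact (landauOp B) MV := isRelativelyCompact_mulCLM hB _ _ hV0
  have eH₀ : H₀ = (MV : L2 →ₗ[ℂ] L2) +ᵥ landauOp B := by
    rw [hH₀, impurityOp, add_mulOp hV_meas hM]
  have eH₂ : ∀ F, 0 < F → H₂ F = (W F : L2 →ₗ[ℂ] L2) +ᵥ H₀ := fun F hF => by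
    rw [hH₂, hH₀, localFieldOp, impurityOp, add_mulOp (hWm F) (hWb F hF), hW F hF]
  have hs₀ : H₀.IsFormalAdjoint H₀ := by
    rw [eH₀]; exact symm_vadd hL (isSymmetric_mulCLM _ _ fun p => hV_real _ _)
  have hs₂ : ∀ F, 0 < F → (H₂ F).IsFormalAdjoint (H₂ F) := fun F hF => by
    rw [eH₂ F hF]; exact symm_vadd hs₀ (hWs F hF)
  obtain ⟨μ, A, hA⟩ : ∃ (μ : ℝ) (A : L2 →L[ℂ] L2), IsResolventAt H₀ μ A := by
    rw [eH₀]; exact exists_isResolventAt_vadd_landauOp hB MV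
  have hr₂ : ∀ F, 0 < F → ∃ (μ : ℝ) (A : L2 →L[ℂ] L2), IsResolventAt (H₂ F) μ A := fun F hF => by
    rw [eH₂ F hF, eH₀, ← add_vadd, ← ContinuousLinearMap.toLinearMap_add]
    exact exists_isResolventAt_vadd_landauOp hB _
  have hpos : ∀ᶠ F in 𝓝[>] (0 : ℝ), 0 < F := self_mem_nhdsWithin
  have hpow : Tendsto (fun F : ℝ => C * F ^ ε) (𝓝[>] 0) (𝓝 0) := by
    have h1 : Tendsto (fun F : ℝ => F ^ ε) (𝓝 0) (𝓝 0) := by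
      have := (Real.continuousAt_rpow_const 0 ε (Or.inr hε.le)).tendsto
      rwa [Real.zero_rpow hε.ne'] at this
    simpa using (h1.mono_left nhdsWithin_le_nhds).const_mul C
  have hW0 : Tendsto (fun F => ‖W F‖) (𝓝[>] 0) (𝓝 0) := by
    refine squeeze_zero' (Eventually.of_forall fun F => norm_nonneg _) ?_ hpow
    filter_upwards [hpos] with F hF using hWn F hF
  have hess₂ : ∀ F, 0 < F → essSpec (H₂ F) = essSpec (landauOp B) := fun F hF => by
    obtain ⟨μ', A', hA'⟩ := hr₂ F hF
    refine essSpec_eq_of_hasSeqCompactKernel_iff hB (hs₂ F hF) hA' fun z => ?_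
    -- The field term is stripped first. Its relative compactness passes from H_L to H_L + V because
    -- V is bounded.
    rw [eH₂ F hF, eH₀, hasSeqCompactKernel_vadd_iff (hWc F hF).vadd_left,
      hasSeqCompactKernel_vadd_iff hVc]
  have hess₀ : essSpec H₀ = essSpec (landauOp B) := by
    refine essSpec_eq_of_hasSeqCompactKernel_iff hB hs₀ hA fun z => ?_
    rw [eH₀, hasSeqCompactKernel_vadd_iff hVc]
  have hs₂' : ∀ᶠ F in 𝓝[>] (0 : ℝ),
      ((W F : L2 →ₗ[ℂ] L2) +ᵥ H₀).IsFormalAdjoint ((W F : L2 →ₗ[ℂ] L2) +ᵥ H₀) := by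
    filter_upwards [hpos] with F hF
    rw [← eH₂ F hF]; exact hs₂ F hF
  refine ⟨⟨?_, hA.isSelfAdjoint_pmap hs₀, fun F hF => ?_⟩, fun z hz => ?_, fun e he => ?_,
    fun a b hab ha hb Δ h₁ h₂ => ?_, ⟨hess₂, essSpec_landauOp hB⟩, fun e he => ?_⟩
  · obtain ⟨A₀, hA₀, -⟩ := exists_isResolventAt_landauOp hB one_pos
    exact hA₀.isSelfAdjoint_pmap hL
  · obtain ⟨μ', A', hA'⟩ := hr₂ F hF
    exact hA'.isSelfAdjoint_pmap (hs₂ F hF)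
  · have hz₀ := hA.mem_resolventSet_of_im_ne_zero hs₀ hz
    have hz₂ : ∀ F, 0 < F → z ∈ MagneticStark.resolventSet (H₂ F) := fun F hF => by
      obtain ⟨μ', A', hA'⟩ := hr₂ F hF
      exact hA'.mem_resolventSet_of_im_ne_zero (hs₂ F hF) hz
    refine ⟨hz₀, hz₂, ?_⟩
    refine (tendsto_resolvent_perturb hz hz₀ hs₂' ?_ hW0).congr' ?_
    · filter_upwards [hpos] with F hF
      rw [← eH₂ F hF]; exact hz₂ F hF
    · filter_upwards [hpos] with F hF
      rw [← eH₂ F hF]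
  · have hex : ∀ F, ∃ lam : ℝ, 0 < F → (lam : ℂ) ∈ spec (H₂ F) ∧ |e - lam| ≤ C * F ^ ε := by
      intro F
      by_cases hF : 0 < F
      · have hs := hs₂ F hF
        rw [eH₂ F hF] at hs
        obtain ⟨t, ht, hd⟩ := exists_mem_spec_perturb hs he
        exact ⟨t, fun _ => ⟨by rw [eH₂ F hF]; exact ht, hd.trans (hWn F hF)⟩⟩
      · exact ⟨0, fun h => absurd h hF⟩
    choose lam hlam using hex
    refine ⟨lam, fun F hF => (hlam F hF).1, ?_⟩
    rw [tendsto_iff_dist_tendsto_zero]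
    refine squeeze_zero' (Eventually.of_forall fun F => dist_nonneg) ?_ hpow
    filter_upwards [hpos] with F hF
    rw [dist_comm, Real.dist_eq]
    exact (hlam F hF).2
  · obtain ⟨P₀, P, hP₀, hP, hlim⟩ :=
      tendsto_spectralProjection hs₀ hA.mem_resolventSet hs₂' hW0 ha hb h₁ h₂
    refine ⟨P₀, P, hP₀, ?_, hlim⟩
    filter_upwards [hP, hpos] with F hPF hF
    rw [eH₂ F hF]; exact hPF
  · refine ⟨C, hC, fun lam hlam hlim => ?_⟩
    obtain ⟨-, ⟨r, hr, hiso⟩, -⟩ := id he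
    -- Landau levels form the essential spectrum of H(0), which is disjoint from the discrete one.
    -- The resulting gap keeps lam(F) off the essential spectrum of H_2(F) once it is close to e.
    have hlev : ∀ n, (e : ℂ) ≠ (level B n : ℂ) := by
      intro n hn
      have h1 : (e : ℂ) ∈ essSpec H₀ := by
        rw [hess₀, essSpec_landauOp hB]; exact ⟨n, hn⟩
      exact h1.2 he
    obtain ⟨δ, hδ, hgap⟩ := exists_pos_le_norm_level_sub hB hlev
    have hlam' : ∀ᶠ F in 𝓝[>] (0 : ℝ), (lam F : ℂ) ∈ spec ((W F : L2 →ₗ[ℂ] L2) +ᵥ H₀) := by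
      filter_upwards [hlam, hpos] with F h hF
      rw [← eH₂ F hF]; exact h
    have hnear : ∀ᶠ F in 𝓝[>] (0 : ℝ), |lam F - e| < δ := by
      simpa [Real.dist_eq] using Metric.tendsto_nhds.1 hlim δ hδ
    filter_upwards [eventually_abs_sub_le hs₀ hr hiso hW0 hlam' hlim, hlam, hnear, hpos]
      with F h1 h2 h3 hF
    constructor
    · by_contra hnd
      have h4 : (lam F : ℂ) ∈ essSpec (H₂ F) := ⟨h2, hnd⟩
      rw [hess₂ F hF, essSpec_landauOp hB] at h4
      obtain ⟨n, hn⟩ := h4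
      have h5 := hgap n
      rw [← hn, ← Complex.ofReal_sub, Complex.norm_real, Real.norm_eq_abs] at h5
      linarith
    · have h4 := abs_le.1 (h1.trans (hWn F hF))
      exact ⟨by linarith [h4.1], by linarith [h4.2]⟩
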